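/- **Setting.** Let $n\ge 1$ and consider the system $x_k=Ax_{k-1}+B\phi_k+w_k$, $y_k=Cx_k+v_k$ ($k\ge 0$) with $x_k\in\mathbb R^n$, $y_k\in\mathbb R^m$, $\phi_k\in\mathbb R^p$. Here $w_k\sim\mathcal N(0,Q)$, $v_k\sim\mathcal N(0,R)$ ($Q,R\ge0$), $x_{-1}\sim\mathcal N(0,\Sigma)$ with $\Sigma=A\Sigma A^T+Q$, and $\zeta_k\sim\mathcal N(0,I_p)$ are all mutually independent. Let $A$ be strictly stable and diagonalizable over $\mathbb C$, with $\tilde n$ distinct eigenvalues ($\tilde n$ is known to the algorithm), $(A,B)$ controllable and $(A,C)$ observable, and let $\mathcal W=C\Sigma C^T+R$ be positive definite. Let $X=\begin{bmatrix}X_{yy}&X_{y\phi}\\X_{\phi y}&X_{\phi\phi}\end{bmatrix}>0$ and $\delta>0$. Put $H_\tau=CA^\tau B$ and, for a sequence $G=(G_\tau)$ of $m\times p$ matrices, $$\mathcal P(G,W)=\sum_{\tau\ge0}G_\tau^TW^{-1}G_\tau,\qquad \mathcal X(G)=\sum_{\tau\ge0}G_\tau^TX_{yy}G_\tau+G_0^TX_{y\phi}+X_{\phi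 y}G_0+X_{\phi\phi}.$$ Assume that the largest eigenvalue of $\mathcal X(H)^{-1}\mathcal P(H,\mathcal W)$ is simple. With $\mathcal U(U)=\sum_{\tau\ge 0} H_\tau UH_\tau^T$, let $U_*$ maximize $\operatorname{tr}(\mathcal U(U)\mathcal W^{-1})$ over $U\ge0$ subject to $\operatorname{tr}\Big(X\begin{bmatrix}\mathcal U(U)&H_0U\\UH_0^T&U\end{bmatrix}\Big)\le\delta$. **Algorithm.** Let $0<\beta<1$, $\mathcal P_{-1}=I$, $\mathcal X_{-1}=X_{\phi\phi}$. At each time $k\ge0$: 1. choose, as a measurable function of what happened before time $k$ (that is, of $x_{-1}$ and of $w_t,v_t,\zeta_t$ with $t<k$; in particular any choice based on the recorded data is allowed), a maximizer $U_{k,*}$ of $\operatorname{tr}(U\mathcal P_{k-1})$ over $U\ge0$, $\operatorname{tr}(U\mathcal X_{k-1})\le\delta$; put $U_k=U_{k,*}+\delta(k+1)^{-\beta}I$, apply $\phi_k=U_k^{1/2}\zeta_k$ and measure $y_k$ (no attack takes place); 2. for $0\le\tau\le3\tilde n-2$ put $H_{k,\tau}=\frac1{k-\tau+1}\sum_{t=\tau}^ky_t\phi_{t-\tau}^TU_{t-\tau}^{-1}$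 (zero if $k<\tau$); let $\mathcal H_{k,i}$ be the vertical stack of $H_{k,i},\dots,H_{k,i+2\tilde n-2}$, let $\Xi_k=(\operatorname{tr}\mathcal H_{k,i}^T\mathcal H_{k,j})_{0\le i,j<\tilde n}$, $\alpha_k=-\Xi_k^{-1}(\operatorname{tr}\mathcal H_{k,i}^T\mathcal H_{k,\tilde n})_{0\le i<\tilde n}$ and $p_k(x)=x^{\tilde n}+\alpha_{k,\tilde n-1}x^{\tilde n-1}+\dots+\alpha_{k,0}$; $p_k$ is regarded as defined if $k\ge3\tilde n-2$ and $\Xi_k$ is invertible; 3. let $\lambda_{k,1},\dots,\lambda_{k,\tilde n}$ be the roots of $p_k$ with multiplicity (arbitrary numbers if $p_k$ is not defined), labelled consistently in time: if $p_{k-1}$ and $p_k$ are defined and the roots of $p_k$ can be paired with those of $p_{k-1}$ so that each root moves by less than half the smallest distance between two roots of $p_{k-1}$, then the labels follow this pairing, and otherwise they are arbitrary; let $V_k=(\lambda_{k,i}^r)_{0\le r\le3\tilde n-2,\,1\le i\le\tilde n}$ and let $\Omega_{k,1},\dots,\Omega_{k,\tilde n}$ be the $m\times p$ blocks of $(V_k\otimes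 I_m)^+[H_{k,0};\dots;H_{k,3\tilde n-2}]$ ($^+$ is the Moore–Penrose inverse); 4. put $\hat\varphi_{k,i}=\lambda_{k,i}\hat\varphi_{k-1,i}+\Omega_{k,i}\phi_k$ ($\hat\varphi_{-1,i}=0$), $\hat\varphi_k=\operatorname{Re}\sum_i\hat\varphi_{k,i}$, $\hat\vartheta_k=y_k-\hat\varphi_k$, $\mathcal W_k=\frac1{k+1}\sum_{t=0}^k\hat\vartheta_t\hat\vartheta_t^T$; 5. if $p_k$ is defined and Schur stable and $\mathcal W_k$ is invertible, put $\hat H_{k,\tau}=\sum_i\lambda_{k,i}^\tau\Omega_{k,i}$ (a real matrix) and $\mathcal P_k=\mathcal P(\hat H_k,\mathcal W_k)$, $\mathcal X_k=\mathcal X(\hat H_k)$; otherwise $\mathcal P_k=\mathcal P_{k-1}$, $\mathcal X_k=\mathcal X_{k-1}$. **Statement.** The optimal covariance $U_*$ exists and is unique, and with $\gamma=(1-\beta)/2$, for every $\epsilon>0$, $$\lim_{k\to\infty}\frac{U_k-U_*}{k^{-\min(\gamma,\beta)+\epsilon}}=0\quad\text{almost surely.}$$ Moreover, over $0<\beta<1$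 the exponent $\min((1-\beta)/2,\beta)$ is largest exactly at $\beta=1/3$. -/

import Mathlib

open MeasureTheory ProbabilityTheory Filter Topology Matrix
open scoped Kronecker MatrixOrder BigOperators ENNReal

noncomputable section

namespace Watermark

/-! ### Linear algebra -/

/-- The Moore–Penrose pseudo-inverse `A⁺ = (Aᴴ A)⁺ Aᴴ`, where the pseudo-inverse of the Hermitian
matrix `Aᴴ A` inverts its nonzero eigenvalues and keeps the zero ones. -/
def pinv {r s : Type*} [Fintype r] [Fintype s] [DecidableEq s] (A : Matrix r s ℂ) :
    Matrix s r ℂ :=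
  cfc (fun x : ℝ => x⁻¹) (Aᴴ * A) * Aᴴ

section PinvFacts

theorem gram_isSelfAdjoint {r s : Type*} [Fintype r] (A : Matrix r s ℂ) : IsSelfAdjoint (Aᴴ * A) :=
  Matrix.isHermitian_conjTranspose_mul_self A

variable {r s : Type*} [Fintype r] [Fintype s] [DecidableEq s]

theorem cfc_inv_isHermitian (A : Matrix r s ℂ) :
    (cfc (fun x : ℝ => x⁻¹) (Aᴴ * A))ᴴ = cfc (fun x : ℝ => x⁻¹) (Aᴴ * A) :=
  cfc_predicate (p := IsSelfAdjoint) (fun x : ℝ => x⁻¹) (Aᴴ * A)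

theorem cfc_gram_continuousOn (A : Matrix r s ℂ) (f : ℝ → ℝ) :
    ContinuousOn f (spectrum ℝ (Aᴴ * A)) :=
  (Matrix.finite_real_spectrum).continuousOn f

theorem cfc_inv_comm (A : Matrix r s ℂ) :
    (Aᴴ * A) * cfc (fun x : ℝ => x⁻¹) (Aᴴ * A) = cfc (fun x : ℝ => x⁻¹) (Aᴴ * A) * (Aᴴ * A) := by
  have h := gram_isSelfAdjoint A
  have e1 : (Aᴴ * A) = cfc (id : ℝ → ℝ) (Aᴴ * A) := (cfc_id ℝ (Aᴴ * A) h).symm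
  have := cfc_commute_cfc (R := ℝ) (id : ℝ → ℝ) (fun x : ℝ => x⁻¹) (Aᴴ * A)
  rw [← e1] at this
  exact this

theorem gram_mul_inv_mul_gram (A : Matrix r s ℂ) :
    (Aᴴ * A) * cfc (fun x : ℝ => x⁻¹) (Aᴴ * A) * (Aᴴ * A) = Aᴴ * A := by
  have h := gram_isSelfAdjoint A
  have e1 : cfc (id : ℝ → ℝ) (Aᴴ * A) = (Aᴴ * A) := cfc_id ℝ (Aᴴ * A) h
  have hc := cfc_gram_continuousOn A
  calc (Aᴴ * A) * cfc (fun x : ℝ => x⁻¹) (Aᴴ * A) * (Aᴴ * A)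
      = cfc (id : ℝ → ℝ) (Aᴴ * A) * cfc (fun x : ℝ => x⁻¹) (Aᴴ * A)
          * cfc (id : ℝ → ℝ) (Aᴴ * A) := by rw [e1]
    _ = cfc (fun x : ℝ => id x * x⁻¹ * id x) (Aᴴ * A) := by
        rw [cfc_mul (fun x : ℝ => id x * x⁻¹) id (Aᴴ * A) (hc _) (hc _),
          cfc_mul id (fun x : ℝ => x⁻¹) (Aᴴ * A) (hc _) (hc _)]
    _ = cfc (id : ℝ → ℝ) (Aᴴ * A) := by
        congr 1; funext x; exact mul_inv_mul_cancel x
    _ = Aᴴ * A := e1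

theorem inv_mul_gram_mul_inv (A : Matrix r s ℂ) :
    cfc (fun x : ℝ => x⁻¹) (Aᴴ * A) * (Aᴴ * A) * cfc (fun x : ℝ => x⁻¹) (Aᴴ * A)
      = cfc (fun x : ℝ => x⁻¹) (Aᴴ * A) := by
  have h := gram_isSelfAdjoint A
  have e1 : cfc (id : ℝ → ℝ) (Aᴴ * A) = (Aᴴ * A) := cfc_id ℝ (Aᴴ * A) h
  have hc := cfc_gram_continuousOn A
  calc cfc (fun x : ℝ => x⁻¹) (Aᴴ * A) * (Aᴴ * A) * cfc (fun x : ℝ => x⁻¹) (Aᴴ * A)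
      = cfc (fun x : ℝ => x⁻¹) (Aᴴ * A) * cfc (id : ℝ → ℝ) (Aᴴ * A)
          * cfc (fun x : ℝ => x⁻¹) (Aᴴ * A) := by rw [e1]
    _ = cfc (fun x : ℝ => x⁻¹ * id x * x⁻¹) (Aᴴ * A) := by
        rw [cfc_mul (fun x : ℝ => x⁻¹ * id x) (fun x : ℝ => x⁻¹) (Aᴴ * A) (hc _) (hc _),
          cfc_mul (fun x : ℝ => x⁻¹) id (Aᴴ * A) (hc _) (hc _)]
    _ = cfc (fun x : ℝ => x⁻¹) (Aᴴ * A) := by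
        congr 1; funext x
        by_cases hx : x = 0
        · simp [hx]
        · simp [hx]

open scoped ComplexOrder in
/-- The four Penrose equations, which characterize the Moore–Penrose pseudo-inverse. -/
theorem pinv_penrose (A : Matrix r s ℂ) :
    A * pinv A * A = A ∧ pinv A * A * pinv A = pinv A ∧
      (A * pinv A)ᴴ = A * pinv A ∧ (pinv A * A)ᴴ = pinv A * A := by
  have hH := cfc_inv_isHermitian A
  have h1 := gram_mul_inv_mul_gram A
  have h2 := inv_mul_gram_mul_inv A
  have h3 := cfc_inv_comm A
  unfold pinv
  generalize cfc (fun x : ℝ => x⁻¹) (Aᴴ * A) = G at *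
  refine ⟨?_, ?_, ?_, ?_⟩
  · have hz : (A * (G * Aᴴ) * A - A)ᴴ * (A * (G * Aᴴ) * A - A) = 0 := by
      have : (A * (G * Aᴴ) * A - A) = A * (G * (Aᴴ * A) - 1) := by
        simp only [Matrix.mul_sub, Matrix.mul_one, Matrix.mul_assoc]
      rw [this, Matrix.conjTranspose_mul]
      have : Aᴴ * (A * (G * (Aᴴ * A) - 1)) = 0 := by
        rw [← Matrix.mul_assoc, Matrix.mul_sub, Matrix.mul_one, ← Matrix.mul_assoc, h1, sub_self]
      rw [Matrix.mul_assoc, this, Matrix.mul_zero]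
    exact sub_eq_zero.mp (Matrix.conjTranspose_mul_self_eq_zero.mp hz)
  · have : G * Aᴴ * A * (G * Aᴴ) = (G * (Aᴴ * A) * G) * Aᴴ := by
      simp only [Matrix.mul_assoc]
    rw [this, h2]
  · simp only [Matrix.conjTranspose_mul, Matrix.conjTranspose_conjTranspose, hH, Matrix.mul_assoc]
  · rw [Matrix.mul_assoc, Matrix.conjTranspose_mul, hH, Matrix.conjTranspose_mul,
      Matrix.conjTranspose_conjTranspose, h3]

end PinvFacts

/-- A real matrix seen as a complex one. -/
def toC {r s : Type*} (M : Matrix r s ℝ) : Matrix r s ℂ := M.map ((↑) : ℝ → ℂ)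

/-- The number of distinct (complex) eigenvalues of a real matrix. -/
def numEigenvalues {n : ℕ} (A : Matrix (Fin n) (Fin n) ℝ) : ℕ := (spectrum ℂ (toC A)).ncard

/-- Strict (discrete-time) stability: all complex eigenvalues lie in the open unit disc. -/
def StrictlyStable {n : ℕ} (A : Matrix (Fin n) (Fin n) ℝ) : Prop :=
  ∀ z ∈ spectrum ℂ (toC A), ‖z‖ < 1

/-- Diagonalizability over `ℂ`. -/
def Diagonalizable {n : ℕ} (A : Matrix (Fin n) (Fin n) ℝ) : Prop :=
  ∃ S : Matrix (Fin n) (Fin n) ℂ, IsUnit S.det ∧ (S⁻¹ * toC A * S).IsDiag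

/-- `(A, B)` is controllable: `[B, AB, …, A^(n-1) B]` has rank `n`. -/
def Controllable {n p : ℕ} (A : Matrix (Fin n) (Fin n) ℝ) (B : Matrix (Fin n) (Fin p) ℝ) : Prop :=
  (Matrix.of fun (i : Fin n) (j : Fin n × Fin p) => (A ^ (j.1 : ℕ) * B) i j.2).rank = n

/-- `(A, C)` is observable: the stacked matrix of `C, CA, …, C A^(n-1)` has rank `n`. -/
def Observable {n m : ℕ} (A : Matrix (Fin n) (Fin n) ℝ) (C : Matrix (Fin m) (Fin n) ℝ) : Prop :=
  (Matrix.of fun (i : Fin n × Fin m) (j : Fin n) => (C * A ^ (i.1 : ℕ)) i.2 j).rank = n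

/-- The largest (real) eigenvalue of `M` exists and is simple. -/
def HasUniqueMaxEigenvalue {p : ℕ} (M : Matrix (Fin p) (Fin p) ℝ) : Prop :=
  ∃ μ : ℝ, Module.finrank ℝ (Module.End.eigenspace (Matrix.toLin' M) μ) = 1 ∧
    ∀ ν : ℝ, Module.End.HasEigenvalue (Matrix.toLin' M) ν → ν ≤ μ

/-! ### The system and the optimal watermark -/

/-- The coefficients of the linear system `x_k = A x_{k-1} + B φ_k + w_k`, `y_k = C x_k + v_k`. -/
structure LinSys (n m p : ℕ) where
  A : Matrix (Fin n) (Fin n) ℝ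
  B : Matrix (Fin n) (Fin p) ℝ
  C : Matrix (Fin m) (Fin n) ℝ

variable {n m p : ℕ}

/-- The state `x_k`, `k ≥ 0`, driven by the watermark `φ` and the noise `w` from `x_{-1} = xi`. -/
def LinSys.state (S : LinSys n m p) (xi : Fin n → ℝ) (φ : ℕ → Fin p → ℝ) (w : ℕ → Fin n → ℝ) :
    ℕ → Fin n → ℝ
  | 0 => S.A *ᵥ xi + S.B *ᵥ φ 0 + w 0
  | k + 1 => S.A *ᵥ S.state xi φ w k + S.B *ᵥ φ (k + 1) + w (k + 1)

/-- The sensor measurement `y_k`. -/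
def LinSys.output (S : LinSys n m p) (xi : Fin n → ℝ) (φ : ℕ → Fin p → ℝ) (w : ℕ → Fin n → ℝ)
    (v : ℕ → Fin m → ℝ) (k : ℕ) : Fin m → ℝ :=
  S.C *ᵥ S.state xi φ w k + v k

/-- The Markov parameters `H_τ = C A^τ B`. -/
def LinSys.H (S : LinSys n m p) (τ : ℕ) : Matrix (Fin m) (Fin p) ℝ := S.C * S.A ^ τ * S.B

/-- The stationary covariance `𝒰 = ∑_τ H_τ U H_τᵀ` of the response to a watermark of
covariance `U`. -/
def LinSys.respCov (S : LinSys n m p) (U : Matrix (Fin p) (Fin p) ℝ) :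
    Matrix (Fin m) (Fin m) ℝ :=
  ∑' τ : ℕ, S.H τ * U * (S.H τ)ᵀ

/-- The joint covariance `S = [[𝒰, H₀U], [U H₀ᵀ, U]]` entering the LQG loss `tr (X S)`. -/
def LinSys.jointCov (S : LinSys n m p) (U : Matrix (Fin p) (Fin p) ℝ) :
    Matrix (Fin m ⊕ Fin p) (Fin m ⊕ Fin p) ℝ :=
  Matrix.fromBlocks (S.respCov U) (S.H 0 * U) (U * (S.H 0)ᵀ) U

/-- `U` maximizes `tr (𝒰 W⁻¹)` among the `U ≥ 0` with `tr (X S) ≤ δ`. -/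
def LinSys.IsOptimalCov (S : LinSys n m p) (W : Matrix (Fin m) (Fin m) ℝ)
    (X : Matrix (Fin m ⊕ Fin p) (Fin m ⊕ Fin p) ℝ) (δ : ℝ) (U : Matrix (Fin p) (Fin p) ℝ) : Prop :=
  (U.PosSemidef ∧ (X * S.jointCov U).trace ≤ δ) ∧
    ∀ V : Matrix (Fin p) (Fin p) ℝ, V.PosSemidef → (X * S.jointCov V).trace ≤ δ →
      (S.respCov V * W⁻¹).trace ≤ (S.respCov U * W⁻¹).trace

/-- `𝒫 = ∑_τ H_τᵀ W⁻¹ H_τ`, for a sequence `H` of Markov parameters. -/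
def Pmat (H : ℕ → Matrix (Fin m) (Fin p) ℝ) (W : Matrix (Fin m) (Fin m) ℝ) :
    Matrix (Fin p) (Fin p) ℝ :=
  ∑' τ : ℕ, (H τ)ᵀ * W⁻¹ * H τ

/-- `𝒳 = ∑_τ H_τᵀ X_yy H_τ + H₀ᵀ X_yφ + X_φy H₀ + X_φφ`, for a sequence `H` of Markov parameters. -/
def Xmat (H : ℕ → Matrix (Fin m) (Fin p) ℝ) (X : Matrix (Fin m ⊕ Fin p) (Fin m ⊕ Fin p) ℝ) :
    Matrix (Fin p) (Fin p) ℝ :=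
  (∑' τ : ℕ, (H τ)ᵀ * X.toBlocks₁₁ * H τ) + (H 0)ᵀ * X.toBlocks₁₂ + X.toBlocks₂₁ * H 0
    + X.toBlocks₂₂

/-! ### The online algorithm

Everything in this section is a function of the recorded data: measurements `y`, watermarks `φ`,
applied covariances `U`, the known number `q` of distinct eigenvalues of `A`, the labelled roots
`lam`, and the design parameters `X`, `δ`, `β`. -/

/-- `H_{k,τ} = (k-τ+1)⁻¹ ∑_{t=τ}^k y_t φ_{t-τ}ᵀ U_{t-τ}⁻¹` (an empty sum for `k < τ`). -/
def markovEst (y : ℕ → Fin m → ℝ) (φ : ℕ → Fin p → ℝ) (U : ℕ → Matrix (Fin p) (Fin p) ℝ)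
    (k τ : ℕ) : Matrix (Fin m) (Fin p) ℝ :=
  ((k : ℝ) - τ + 1)⁻¹ •
    ∑ t ∈ Finset.Icc τ k, Matrix.vecMulVec (y t) (φ (t - τ)) * (U (t - τ))⁻¹

/-- The stacked matrix of `G_i, G_{i+1}, …, G_{i+2q-2}`. -/
def stack (q : ℕ) (G : ℕ → Matrix (Fin m) (Fin p) ℝ) (i : ℕ) :
    Matrix (Fin (2 * q - 1) × Fin m) (Fin p) ℝ :=
  Matrix.of fun a b => G (i + a.1) a.2 b

/-- The Gram matrix `Ξ` of the stacked matrices. -/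
def gram (q : ℕ) (G : ℕ → Matrix (Fin m) (Fin p) ℝ) : Matrix (Fin q) (Fin q) ℝ :=
  Matrix.of fun i j => ((stack q G i)ᵀ * stack q G j).trace

/-- The coefficients `α_0, …, α_{q-1}` of the estimated characteristic polynomial. -/
def coeffEst (q : ℕ) (G : ℕ → Matrix (Fin m) (Fin p) ℝ) : Fin q → ℝ :=
  -((gram q G)⁻¹ *ᵥ fun i => ((stack q G i)ᵀ * stack q G q).trace)

/-- The polynomial `x^q + α_{q-1} x^{q-1} + ⋯ + α_0`, over `ℂ`. -/
def polyEst (q : ℕ) (G : ℕ → Matrix (Fin m) (Fin p) ℝ) : Polynomial ℂ :=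
  Polynomial.X ^ q + ∑ i : Fin q, Polynomial.C ((coeffEst q G i : ℝ) : ℂ) * Polynomial.X ^ (i : ℕ)

/-- The polynomial `p_k` is defined at time `k`: all the `H_{k,τ}` with `τ ≤ 3q-2` are averages of
at least one term, and `Ξ_k` is invertible. -/
def PolyDefined (q : ℕ) (y : ℕ → Fin m → ℝ) (φ : ℕ → Fin p → ℝ)
    (U : ℕ → Matrix (Fin p) (Fin p) ℝ) (k : ℕ) : Prop :=
  3 * q - 2 ≤ k ∧ IsUnit (gram q (markovEst y φ U k)).det

/-- `lam k 1, …, lam k q` are the roots of `p_k` with multiplicity, at each time `k` where `p_k` is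
defined, and the labels are carried along consistently: if the roots at time `k + 1` can be
paired with those at time `k` so that every root moves by less than half the smallest distance
between two roots at time `k` (such a pairing is unique), then the labels follow that pairing.
When there is no such pairing the roots may be labelled in any way. -/
structure IsRootLabelling (q : ℕ) (y : ℕ → Fin m → ℝ) (φ : ℕ → Fin p → ℝ)
    (U : ℕ → Matrix (Fin p) (Fin p) ℝ) (lam : ℕ → Fin q → ℂ) : Prop where
  roots : ∀ k, PolyDefined q y φ U k →
    Multiset.map (lam k) Finset.univ.val = (polyEst q (markovEst y φ U k)).roots
  tracking : ∀ k, PolyDefined q y φ U k → PolyDefined q y φ U (k + 1) →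
    ∀ s : ℝ, (∀ i j, i ≠ j → s ≤ ‖lam k i - lam k j‖) →
      (∃ σ : Equiv.Perm (Fin q), ∀ i, ‖lam (k + 1) (σ i) - lam k i‖ < s / 2) →
        ∀ i, ‖lam (k + 1) i - lam k i‖ < s / 2

/-- The Vandermonde-like matrix with rows `lam_i ^ r`, `0 ≤ r ≤ 3q-2`. -/
def vander {q : ℕ} (lam : Fin q → ℂ) : Matrix (Fin (3 * q - 1)) (Fin q) ℂ :=
  Matrix.of fun r i => lam i ^ (r : ℕ)

/-- The blocks `Ω_i` of `(V ⊗ I_m)⁺ [G_0; …; G_{3q-2}]`. -/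
def omegaEst {q : ℕ} (lam : Fin q → ℂ) (G : ℕ → Matrix (Fin m) (Fin p) ℝ) (i : Fin q) :
    Matrix (Fin m) (Fin p) ℂ :=
  Matrix.of fun a b =>
    (pinv (vander lam ⊗ₖ (1 : Matrix (Fin m) (Fin m) ℂ)) *
      Matrix.of fun (c : Fin (3 * q - 1) × Fin m) (b : Fin p) => ((G c.1 c.2 b : ℝ) : ℂ)) (i, a) b

/-- The Markov parameters `∑_i lam_i^τ Ω_i` of the estimated model. The sum is real because the
roots `lam_i` of a real polynomial come in conjugate pairs. -/
def fittedH {q : ℕ} (lam : Fin q → ℂ) (Om : Fin q → Matrix (Fin m) (Fin p) ℂ) (τ : ℕ) :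
    Matrix (Fin m) (Fin p) ℝ :=
  (∑ i, lam i ^ τ • Om i).map Complex.re

/-- `φ̂_{k,i} = lam_{k,i} φ̂_{k-1,i} + Ω_{k,i} φ_k` with `φ̂_{-1,i} = 0`. -/
def phiHatPart {q : ℕ} (lam : ℕ → Fin q → ℂ) (Om : ℕ → Fin q → Matrix (Fin m) (Fin p) ℂ)
    (φ : ℕ → Fin p → ℝ) : ℕ → Fin q → Fin m → ℂ
  | 0, i => Om 0 i *ᵥ fun b => ((φ 0 b : ℝ) : ℂ)
  | k + 1, i => lam (k + 1) i • phiHatPart lam Om φ k i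
      + Om (k + 1) i *ᵥ fun b => ((φ (k + 1) b : ℝ) : ℂ)

/-- `φ̂_k = ∑_i φ̂_{k,i}`; the real part is taken because the estimated quantity is real. -/
def phiHat {q : ℕ} (lam : ℕ → Fin q → ℂ) (Om : ℕ → Fin q → Matrix (Fin m) (Fin p) ℂ)
    (φ : ℕ → Fin p → ℝ) (k : ℕ) : Fin m → ℝ :=
  fun a => (∑ i, phiHatPart lam Om φ k i a).re

/-- `W_k = (k+1)⁻¹ ∑_{t ≤ k} ϑ̂_t ϑ̂_tᵀ` with `ϑ̂_t = y_t - φ̂_t`. -/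
def noiseCovEst (y φh : ℕ → Fin m → ℝ) (k : ℕ) : Matrix (Fin m) (Fin m) ℝ :=
  ((k : ℝ) + 1)⁻¹ • ∑ t ∈ Finset.range (k + 1), Matrix.vecMulVec (y t - φh t) (y t - φh t)

/-- `Ω_{k,i}`. -/
def omegaSeq {q : ℕ} (y : ℕ → Fin m → ℝ) (φ : ℕ → Fin p → ℝ)
    (U : ℕ → Matrix (Fin p) (Fin p) ℝ) (lam : ℕ → Fin q → ℂ) (k : ℕ) :
    Fin q → Matrix (Fin m) (Fin p) ℂ :=
  omegaEst (lam k) (markovEst y φ U k)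

/-- `W_k`. -/
def noiseCovSeq {q : ℕ} (y : ℕ → Fin m → ℝ) (φ : ℕ → Fin p → ℝ)
    (U : ℕ → Matrix (Fin p) (Fin p) ℝ) (lam : ℕ → Fin q → ℂ) : ℕ → Matrix (Fin m) (Fin m) ℝ :=
  noiseCovEst y (phiHat lam (omegaSeq y φ U lam) φ)

/-- The estimates are updated at time `k` if `p_k` is defined and Schur stable and `W_k`, whose
inverse enters the update, is invertible. -/
def UpdatesAt {q : ℕ} (y : ℕ → Fin m → ℝ) (φ : ℕ → Fin p → ℝ)
    (U : ℕ → Matrix (Fin p) (Fin p) ℝ) (lam : ℕ → Fin q → ℂ) (k : ℕ) : Prop :=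
  PolyDefined q y φ U k ∧ (∀ z ∈ (polyEst q (markovEst y φ U k)).roots, ‖z‖ < 1) ∧
    IsUnit (noiseCovSeq y φ U lam k).det

open scoped Classical in
/-- `estimates … k = (𝒫_{k-1}, 𝒳_{k-1})`, the estimates available before step `k`. -/
def estimates {q : ℕ} (X : Matrix (Fin m ⊕ Fin p) (Fin m ⊕ Fin p) ℝ)
    (y : ℕ → Fin m → ℝ) (φ : ℕ → Fin p → ℝ) (U : ℕ → Matrix (Fin p) (Fin p) ℝ)
    (lam : ℕ → Fin q → ℂ) : ℕ → Matrix (Fin p) (Fin p) ℝ × Matrix (Fin p) (Fin p) ℝ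
  | 0 => (1, X.toBlocks₂₂)
  | k + 1 =>
    if UpdatesAt y φ U lam k then
      (Pmat (fittedH (lam k) (omegaSeq y φ U lam k)) (noiseCovSeq y φ U lam k),
        Xmat (fittedH (lam k) (omegaSeq y φ U lam k)) X)
    else estimates X y φ U lam k

/-- `U` maximizes `tr (U P)` among the `U ≥ 0` with `tr (U Xc) ≤ δ`. -/
def IsArgmax (P Xc : Matrix (Fin p) (Fin p) ℝ) (δ : ℝ) (U : Matrix (Fin p) (Fin p) ℝ) : Prop :=
  (U.PosSemidef ∧ (U * Xc).trace ≤ δ) ∧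
    ∀ V : Matrix (Fin p) (Fin p) ℝ, V.PosSemidef → (V * Xc).trace ≤ δ →
      (V * P).trace ≤ (U * P).trace

/-- The applied covariance `U_k = U_{k,*} + δ (k+1)^(-β) I`. -/
def appliedCov (δ β : ℝ) (Ust : ℕ → Matrix (Fin p) (Fin p) ℝ) (k : ℕ) :
    Matrix (Fin p) (Fin p) ℝ :=
  Ust k + (δ * ((k : ℝ) + 1) ^ (-β)) • (1 : Matrix (Fin p) (Fin p) ℝ)

/-- The watermark `φ_k = U_k^{1/2} ζ_k`. -/
def watermark (U : ℕ → Matrix (Fin p) (Fin p) ℝ) (ζ : ℕ → Fin p → ℝ) (k : ℕ) : Fin p → ℝ :=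
  CFC.sqrt (U k) *ᵥ ζ k

/-- One trajectory of the closed loop: at every step `Ust k = U_{k,*}` is a maximizer for the
current estimates, when the watermark `φ_k = U_k^{1/2} ζ_k` is fed to the system and the estimates
are computed from the measured outputs. -/
structure IsRun (S : LinSys n m p) (X : Matrix (Fin m ⊕ Fin p) (Fin m ⊕ Fin p) ℝ) (δ β : ℝ)
    (xi : Fin n → ℝ) (w : ℕ → Fin n → ℝ) (v : ℕ → Fin m → ℝ) (ζ : ℕ → Fin p → ℝ)
    (lam : ℕ → Fin (numEigenvalues S.A) → ℂ) (Ust : ℕ → Matrix (Fin p) (Fin p) ℝ)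
    (φ : ℕ → Fin p → ℝ) (y : ℕ → Fin m → ℝ) : Prop where
  watermark_eq : φ = watermark (appliedCov δ β Ust) ζ
  output_eq : y = S.output xi φ w v
  labelling : IsRootLabelling (numEigenvalues S.A) y φ (appliedCov δ β Ust) lam
  argmax : ∀ k, IsArgmax (estimates X y φ (appliedCov δ β Ust) lam k).1
    (estimates X y φ (appliedCov δ β Ust) lam k).2 δ (Ust k)

/-! ### The random inputs -/

section Random

variable {Ω : Type*} [mΩ : MeasurableSpace Ω]

/-- A centred Gaussian random vector with covariance `Q` (possibly degenerate). -/
def IsCentredGaussian {d : ℕ} (μ : Measure Ω) (Z : Ω → Fin d → ℝ)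
    (Q : Matrix (Fin d) (Fin d) ℝ) : Prop :=
  Measurable Z ∧ HasLaw (fun ω => WithLp.toLp 2 (Z ω)) (multivariateGaussian 0 Q) μ

/-- The σ-algebras generated by `x_{-1}` and by each `w_k`, `v_k`, `ζ_k`. -/
@[reducible] def inputSigma (xi : Ω → Fin n → ℝ) (w : ℕ → Ω → Fin n → ℝ) (v : ℕ → Ω → Fin m → ℝ)
    (ζ : ℕ → Ω → Fin p → ℝ) : Unit ⊕ ℕ ⊕ ℕ ⊕ ℕ → MeasurableSpace Ω
  | .inl _ => MeasurableSpace.comap xi inferInstance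
  | .inr (.inl k) => MeasurableSpace.comap (w k) inferInstance
  | .inr (.inr (.inl k)) => MeasurableSpace.comap (v k) inferInstance
  | .inr (.inr (.inr k)) => MeasurableSpace.comap (ζ k) inferInstance

/-- `x_{-1}`, the `w_k`, the `v_k` and the `ζ_k` are mutually independent centred Gaussian vectors
with covariances `Sig`, `Q`, `R` and `I`. -/
structure GaussianInputs (μ : Measure Ω) (Sig Q : Matrix (Fin n) (Fin n) ℝ)
    (R : Matrix (Fin m) (Fin m) ℝ) (xi : Ω → Fin n → ℝ) (w : ℕ → Ω → Fin n → ℝ)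
    (v : ℕ → Ω → Fin m → ℝ) (ζ : ℕ → Ω → Fin p → ℝ) : Prop where
  init : IsCentredGaussian μ xi Sig
  process : ∀ k, IsCentredGaussian μ (w k) Q
  sensor : ∀ k, IsCentredGaussian μ (v k) R
  excitation : ∀ k, IsCentredGaussian μ (ζ k) 1
  indep : iIndep (inputSigma xi w v ζ) μ

/-- The σ-algebra of everything that happened before time `k`, generated by `x_{-1}` and
`w_t, v_t, ζ_t` for `t < k`. -/
@[reducible] def pastSigma (xi : Ω → Fin n → ℝ) (w : ℕ → Ω → Fin n → ℝ) (v : ℕ → Ω → Fin m → ℝ)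
    (ζ : ℕ → Ω → Fin p → ℝ) (k : ℕ) : MeasurableSpace Ω :=
  MeasurableSpace.comap xi inferInstance ⊔
    ⨆ t : Fin k, (MeasurableSpace.comap (w t) inferInstance ⊔
      MeasurableSpace.comap (v t) inferInstance ⊔ MeasurableSpace.comap (ζ t) inferInstance)

end Random

/-- The exponent `min (γ, β)` with `γ = (1 - β) / 2`. -/
def rateExponent (β : ℝ) : ℝ := min ((1 - β) / 2) β

end Watermark

end

/-!
The rates are expressed by `Growth c f`: for every `ε > 0`, the sequence `f` is of order
`(k + 1) ^ (c + ε)`, where a negative `c` is a rate of decay. Such statements can be added,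
multiplied, averaged and passed through stable recursions without following constants.

*The optimization problem.* Moving the sums over `τ` from one factor of a trace to the other turns
the problem defining the optimal covariance into the maximization of `tr (U 𝒫)` over `U ≥ 0`,
`tr (U 𝒳) ≤ δ` (`isOptimalCov_iff`). If the largest eigenvalue `μ` of `𝒳⁻¹ 𝒫` is simple, with
eigenvector `z`, then `μ 𝒳 - 𝒫` is positive semidefinite with kernel spanned by `z`
(`exists_spectral_gap`). So the maximum is attained at a multiple of `z zᵀ` only, and the gap makes
the maximizer a Lipschitz function of `(𝒫, 𝒳)` (`IsArgmax.lipschitz`). It remains to find the rates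
at which the estimates of `𝒫` and `𝒳` converge along a run.

*The random sums.* The term `δ (k + 1) ^ (-β) I` of the applied covariance lets the probes
`U_k⁻¹ φ_k` grow at most like `k ^ (β / 2)` (`isExcitation_of_isRun`). Unfolding the recursion of
the state writes `∑ (y_{s + τ} (U_s⁻¹ φ_s)ᵀ - H_τ)` in terms of sums of centred innovations with
weights determined by the past. Such sums are martingales; normalized by a power slightly larger
than their size, they are bounded in `L²` and converge almost surely (`ae_growth_sum_mul`). Hence
the correlation sums grow like `k ^ (β / 2 + 1 / 2)` (`IsExcitation.ae_growth_sum_output`), and the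
estimated Markov parameters converge like `k ^ (-(1 - β) / 2)` (`growth_markovEst`). The empirical
covariance of the noise part of the output converges like `k ^ (-1 / 2)` by the same argument, since
its deviation solves a stable Lyapunov recursion (`ae_growth_noiseOutput_cov`).

*The estimates along a path.* From here on the argument is deterministic. By controllability and
observability every mode has a nonzero residue, so the Gram matrix of the exact Markov parameters is
invertible and the estimated polynomial converges to the one whose roots are the distinct
eigenvalues of `A` (`IsModal.isUnit_gram`, `IsModal.eval_coeffEst`). Its roots are simple, hence the
estimated roots converge at the same rate, and the tracking of the labels makes each of them follow
one eigenvalue (`exists_perm_growth_roots`). The residues are then a stable least squares fit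
(`growth_omegaEst`), the estimated response to the watermark and with it the noise covariance follow
(`IsModal.growth_phiHat_sub`, `growth_noiseCovEst`), and `𝒫`, `𝒳` are rational functions of these
quantities (`growth_Pmat`, `growth_Xmat`). The Lipschitz bound carries the rate over to the
maximizers (`IsModal.growth_argmax`).

The applied covariance differs from the maximizer by a term of order `k ^ (-β)`, and the slower of
the two rates wins (`growth_appliedCov`).
-/

noncomputable section

namespace Watermark

/-! ### Polynomial growth rates -/

/-- `f` grows at most like `k ^ (c + ε)` for every `ε > 0`. A negative `c` is a rate of decay. -/
def Growth {E : Type*} [NormedAddCommGroup E] (c : ℝ) (f : ℕ → E) : Prop :=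
  ∀ ε > 0, f =O[atTop] fun k : ℕ => ((k : ℝ) + 1) ^ (c + ε)

theorem one_le_natCast_add_one (k : ℕ) : (1 : ℝ) ≤ (k : ℝ) + 1 := by
  have : (0 : ℝ) ≤ k := Nat.cast_nonneg k
  linarith

namespace Growth

section Basic

variable {E : Type*} [NormedAddCommGroup E] {c d : ℝ} {f g : ℕ → E}

theorem of_isBigO {F : Type*} [NormedAddCommGroup F] {h : ℕ → F} (hf : f =O[atTop] h)
    (hh : Growth c h) : Growth c f := fun ε hε => hf.trans (hh ε hε)

theorem of_small {e : ℝ} (he : 0 < e)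
    (h : ∀ ε > 0, ε < e → f =O[atTop] fun k : ℕ => ((k : ℝ) + 1) ^ (c + ε)) : Growth c f := by
  intro ε hε
  refine (h (min ε (e / 2)) (by positivity) (by
    have := min_le_right ε (e / 2); linarith)).trans ?_
  refine Asymptotics.IsBigO.of_bound 1 (Eventually.of_forall fun k => ?_)
  have hk := one_le_natCast_add_one k
  rw [one_mul, Real.norm_of_nonneg (by positivity), Real.norm_of_nonneg (by positivity)]
  exact Real.rpow_le_rpow_of_exponent_le hk (by have := min_le_left ε (e / 2); linarith)

theorem mono (h : Growth c f) (hcd : c ≤ d) : Growth d f := by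
  intro ε hε
  have := h (ε + (d - c)) (by linarith)
  rwa [show c + (ε + (d - c)) = d + ε by ring] at this

theorem congr' (h : Growth c f) (hfg : f =ᶠ[atTop] g) : Growth c g := fun ε hε =>
  (h ε hε).congr' hfg (Eventually.of_forall fun _ => rfl)

theorem add (hf : Growth c f) (hg : Growth c g) : Growth c fun k => f k + g k :=
  fun ε hε => (hf ε hε).add (hg ε hε)

theorem neg (hf : Growth c f) : Growth c fun k => -f k :=
  fun ε hε => (hf ε hε).neg_left

theorem sub (hf : Growth c f) (hg : Growth c g) : Growth c fun k => f k - g k :=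
  fun ε hε => (hf ε hε).sub (hg ε hε)

theorem zero : Growth c fun _ : ℕ => (0 : E) := fun _ _ => Asymptotics.isBigO_zero _ _

theorem sum {ι : Type*} (s : Finset ι) {F : ι → ℕ → E} (h : ∀ i ∈ s, Growth c (F i)) :
    Growth c fun k => ∑ i ∈ s, F i k := by
  intro ε hε
  have := Asymptotics.IsBigO.sum fun i hi => h i hi ε hε
  exact this.congr_left fun k => by simp

theorem of_bounded {C : ℝ} (h : ∀ᶠ k in atTop, ‖f k‖ ≤ C) : Growth 0 f := by
  intro ε hε
  refine Asymptotics.IsBigO.of_bound |C| (h.mono fun k hk => ?_)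
  rw [Real.norm_of_nonneg (by positivity)]
  have h1 : (1 : ℝ) ≤ ((k : ℝ) + 1) ^ (0 + ε) :=
    Real.one_le_rpow (one_le_natCast_add_one k) (by linarith)
  calc ‖f k‖ ≤ |C| * 1 := by rw [mul_one]; exact hk.trans (le_abs_self C)
    _ ≤ _ := by gcongr

theorem const (a : E) : Growth 0 fun _ : ℕ => a :=
  of_bounded (C := ‖a‖) (Eventually.of_forall fun _ => le_rfl)

theorem of_tendsto {a : E} (h : Tendsto f atTop (𝓝 a)) : Growth 0 f := by
  refine of_bounded (C := ‖a‖ + 1) ?_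
  exact (h.norm.eventually (gt_mem_nhds (lt_add_one _))).mono fun k hk => hk.le

theorem tendsto_zero (h : Growth c f) (hc : c < 0) : Tendsto f atTop (𝓝 0) := by
  refine (h (-c / 2) (by linarith)).trans_tendsto ?_
  rw [show c + -c / 2 = -(-c / 2) by ring]
  exact (tendsto_rpow_neg_atTop (by linarith : 0 < -c / 2)).comp
    (tendsto_atTop_add_const_right _ _ tendsto_natCast_atTop_atTop)

theorem tendsto {a : E} (h : Growth c fun k => f k - a) (hc : c < 0) :
    Tendsto f atTop (𝓝 a) := by
  have := (h.tendsto_zero hc).add_const a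
  simpa using this

theorem rpow_shift_isBigO (s : ℝ) (a : ℕ) :
    ((fun k : ℕ => (((k + a : ℕ) : ℝ) + 1) ^ s) =O[atTop] fun k : ℕ => ((k : ℝ) + 1) ^ s) ∧
    ((fun k : ℕ => ((k : ℝ) + 1) ^ s) =O[atTop] fun k : ℕ => (((k + a : ℕ) : ℝ) + 1) ^ s) := by
  have hlim : Tendsto (fun k : ℕ => ((((k + a : ℕ) : ℝ) + 1) / ((k : ℝ) + 1)) ^ s)
      atTop (𝓝 1) := by
    have h1 : Tendsto (fun k : ℕ => (((k + a : ℕ) : ℝ) + 1) / ((k : ℝ) + 1)) atTop (𝓝 1) := by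
      have h2 : Tendsto (fun k : ℕ => 1 + (a : ℝ) * (1 / ((k : ℝ) + 1))) atTop (𝓝 (1 + a * 0)) :=
        tendsto_const_nhds.add (tendsto_const_nhds.mul tendsto_one_div_add_atTop_nhds_zero_nat)
      rw [mul_zero, add_zero] at h2
      refine h2.congr fun k => ?_
      have : (k : ℝ) + 1 ≠ 0 := by positivity
      push_cast
      field_simp
      ring
    have := h1.rpow_const (p := s) (Or.inl one_ne_zero)
    rwa [Real.one_rpow] at this
  have hne : ∀ k : ℕ, ((k : ℝ) + 1) ^ s ≠ 0 := fun k => by positivity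
  have hlim' : Tendsto (fun k : ℕ => (((k + a : ℕ) : ℝ) + 1) ^ s / ((k : ℝ) + 1) ^ s)
      atTop (𝓝 1) := by
    refine hlim.congr fun k => ?_
    rw [Real.div_rpow (by positivity) (by positivity)]
  have heq := Asymptotics.isEquivalent_of_tendsto_one hlim'
  exact ⟨heq.isBigO, heq.symm.isBigO⟩

theorem shift (h : Growth c f) (a : ℕ) : Growth c fun k => f (k + a) := by
  intro ε hε
  exact ((h ε hε).comp_tendsto (tendsto_add_atTop_nat a)).trans (rpow_shift_isBigO _ a).1

theorem of_shift (a : ℕ) (h : Growth c fun k => f (k + a)) : Growth c f := by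
  intro ε hε
  have h1 := (h ε hε).trans (rpow_shift_isBigO _ a).2
  rw [Asymptotics.isBigO_iff] at h1 ⊢
  obtain ⟨C, hC⟩ := h1
  refine ⟨C, ?_⟩
  exact (eventually_atTop.2 (by
    obtain ⟨N, hN⟩ := eventually_atTop.1 hC
    refine ⟨N + a, fun k hk => ?_⟩
    have := hN (k - a) (by omega)
    rwa [Nat.sub_add_cancel (by omega)] at this))

theorem norm_growth : Growth c (fun k => ‖f k‖) ↔ Growth c f := by
  simp only [Growth, Asymptotics.isBigO_norm_left]

end Basic

section Field

variable {𝕜 : Type*} [NormedField 𝕜] {c d : ℝ} {f g : ℕ → 𝕜}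

theorem mul (hf : Growth c f) (hg : Growth d g) : Growth (c + d) fun k => f k * g k := by
  intro ε hε
  refine ((hf (ε / 2) (by linarith)).mul (hg (ε / 2) (by linarith))).congr_right fun k => ?_
  have : (0 : ℝ) < (k : ℝ) + 1 := by positivity
  rw [← Real.rpow_add this]
  congr 1; ring

theorem mul_left_bdd (hf : Growth 0 f) (hg : Growth c g) : Growth c fun k => f k * g k := by
  simpa using hf.mul hg

theorem mul_right_bdd (hf : Growth c f) (hg : Growth 0 g) : Growth c fun k => f k * g k := by
  simpa using hf.mul hg

theorem const_mul (a : 𝕜) (hg : Growth c g) : Growth c fun k => a * g k :=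
  (const a).mul_left_bdd hg

theorem mul_const (hg : Growth c g) (a : 𝕜) : Growth c fun k => g k * a :=
  hg.mul_right_bdd (const a)

/-- The rate at which a product converges, from the rates of its factors. -/
theorem mul_sub_mul {a b : 𝕜} (hc : c ≤ 0) (hf : Growth c fun k => f k - a)
    (hg : Growth c fun k => g k - b) : Growth c fun k => f k * g k - a * b := by
  have hgb : Growth 0 g := by
    have := (hg.mono hc).add (const b)
    simpa using this
  have := (hf.mul_right_bdd hgb).add (hg.const_mul a)
  refine this.congr' (Eventually.of_forall fun k => ?_)
  simp only; ring

end Field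

theorem inv_natCast : Growth (-1) fun k : ℕ => ((k : ℝ) + 1)⁻¹ := by
  intro ε hε
  refine Asymptotics.IsBigO.of_bound 1 (Eventually.of_forall fun k => ?_)
  have h0 : (0 : ℝ) < (k : ℝ) + 1 := by positivity
  rw [Real.norm_of_nonneg (by positivity), Real.norm_of_nonneg (by positivity), one_mul,
    ← Real.rpow_neg_one]
  exact Real.rpow_le_rpow_of_exponent_le (one_le_natCast_add_one k) (by linarith)

theorem ofReal_iff {c : ℝ} {f : ℕ → ℝ} : Growth c (fun k => (f k : ℂ)) ↔ Growth c f := by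
  rw [← norm_growth, ← norm_growth (f := f)]
  simp

theorem re {c : ℝ} {f : ℕ → ℂ} (h : Growth c f) : Growth c fun k => (f k).re :=
  h.of_isBigO (Asymptotics.IsBigO.of_bound 1 (Eventually.of_forall fun k => by
    simpa using Complex.abs_re_le_norm (f k)))

theorem star {c : ℝ} {f : ℕ → ℂ} (h : Growth c f) : Growth c fun k => star (f k) :=
  h.of_isBigO (Asymptotics.IsBigO.of_bound 1 (Eventually.of_forall fun k => by simp))

theorem of_rpow_bound {c C : ℝ} {f : ℕ → ℝ} (h : ∀ k : ℕ, |f k| ≤ C * ((k : ℝ) + 1) ^ c) :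
    Growth c f := by
  intro ε hε
  refine Asymptotics.IsBigO.of_bound |C| (Eventually.of_forall fun k => ?_)
  rw [Real.norm_of_nonneg (by positivity : (0 : ℝ) ≤ ((k : ℝ) + 1) ^ (c + ε)), Real.norm_eq_abs]
  refine (h k).trans ?_
  have h1 : ((k : ℝ) + 1) ^ c ≤ ((k : ℝ) + 1) ^ (c + ε) :=
    Real.rpow_le_rpow_of_exponent_le (one_le_natCast_add_one k) (by linarith)
  have h2 : C ≤ |C| := le_abs_self C
  have h3 : (0 : ℝ) ≤ ((k : ℝ) + 1) ^ c := by positivity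
  calc C * ((k : ℝ) + 1) ^ c ≤ |C| * ((k : ℝ) + 1) ^ c := by gcongr
    _ ≤ _ := by gcongr

theorem sum_rpow_le {s : ℝ} (hs : -1 < s) (hs0 : s ≤ 0) (k : ℕ) :
    (s + 1) * ∑ t ∈ Finset.range k, ((t : ℝ) + 1) ^ s ≤ (k : ℝ) ^ (s + 1) := by
  induction k with
  | zero => simp [Real.zero_rpow (by linarith : s + 1 ≠ 0)]
  | succ k ih =>
    rw [Finset.sum_range_succ, mul_add]
    have h0 : (0 : ℝ) < (k : ℝ) + 1 := by positivity
    -- Bernoulli: `(k / (k+1)) ^ (s+1) ≤ 1 - (s+1) / (k+1)`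
    have hb := rpow_one_add_le_one_add_mul_self (s := -1 / ((k : ℝ) + 1))
      (by rw [le_div_iff₀ h0]; have : (0 : ℝ) ≤ k := Nat.cast_nonneg k; linarith)
      (by linarith : 0 ≤ s + 1) (by linarith)
    have e1 : 1 + -1 / ((k : ℝ) + 1) = (k : ℝ) / ((k : ℝ) + 1) := by field_simp; ring
    rw [e1, Real.div_rpow (Nat.cast_nonneg k) h0.le, div_le_iff₀ (by positivity)] at hb
    have e2 : ((k : ℝ) + 1) ^ (s + 1) = ((k : ℝ) + 1) ^ s * ((k : ℝ) + 1) := by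
      rw [Real.rpow_add h0, Real.rpow_one]
    have e3 : (1 + (s + 1) * (-1 / ((k : ℝ) + 1))) * ((k : ℝ) + 1) ^ (s + 1)
        = ((k : ℝ) + 1) ^ (s + 1) - (s + 1) * ((k : ℝ) + 1) ^ s := by
      rw [e2]; field_simp; ring
    rw [e3] at hb
    push_cast
    linarith

/-- Partial sums of a sequence decaying like `k ^ c`, with `-1 < c < 0`, grow at most like
`k ^ (c + 1)`; so its averages decay at the same rate as the sequence. -/
theorem sum_range {E : Type*} [NormedAddCommGroup E] {c : ℝ} {f : ℕ → E} (hc : -1 < c)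
    (hc0 : c < 0) (hf : Growth c f) :
    Growth (c + 1) fun k => ∑ t ∈ Finset.range k, f t := by
  refine of_small (e := -c) (by linarith) fun ε hε hεc => ?_
  obtain ⟨C, hC, hb⟩ := Asymptotics.bound_of_isBigO_nat_atTop (hf ε hε)
  have hpos : 0 < c + ε + 1 := by linarith
  refine Asymptotics.IsBigO.of_bound (C / (c + ε + 1)) (Eventually.of_forall fun k => ?_)
  rw [Real.norm_of_nonneg (by positivity)]
  have h1 : ‖∑ t ∈ Finset.range k, f t‖ ≤ C * ∑ t ∈ Finset.range k, ((t : ℝ) + 1) ^ (c + ε) := by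
    rw [Finset.mul_sum]
    refine (norm_sum_le _ _).trans (Finset.sum_le_sum fun t _ => ?_)
    have := hb (x := t) (by positivity)
    rwa [Real.norm_of_nonneg (by positivity)] at this
  have h2 := sum_rpow_le (s := c + ε) (by linarith) (by linarith) k
  have h3 : (k : ℝ) ^ (c + ε + 1) ≤ ((k : ℝ) + 1) ^ (c + ε + 1) :=
    Real.rpow_le_rpow (Nat.cast_nonneg k) (by linarith) hpos.le
  calc _ ≤ C * ∑ t ∈ Finset.range k, ((t : ℝ) + 1) ^ (c + ε) := h1
    _ = C / (c + ε + 1) * ((c + ε + 1) * ∑ t ∈ Finset.range k, ((t : ℝ) + 1) ^ (c + ε)) := by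
        field_simp
    _ ≤ C / (c + ε + 1) * ((k : ℝ) + 1) ^ (c + ε + 1) := by
        have := h2.trans h3
        gcongr
    _ = _ := by rw [show c + ε + 1 = c + 1 + ε by ring]

/-- A stable scalar recursion inherits the growth rate of its input, also when this is a rate of
decay: the recursion forgets its past exponentially fast. -/
theorem of_recursion {c ρ : ℝ} {e l f : ℕ → ℂ} (hρ0 : 0 ≤ ρ) (hρ : ρ < 1)
    (hl : ∀ᶠ k in atTop, ‖l k‖ ≤ ρ) (he : ∀ᶠ k in atTop, e (k + 1) = l k * e k + f k)
    (hf : Growth c f) : Growth c e := by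
  intro ε hε
  set s := c + ε with hs
  obtain ⟨C, hC, hb⟩ := Asymptotics.bound_of_isBigO_nat_atTop (hf ε hε)
  -- an intermediate contraction rate, which absorbs the slow variation of the power
  set r := (1 + ρ) / 2 with hr
  have hr1 : r < 1 := by rw [hr]; linarith
  have hr2 : ρ < r := by rw [hr]; linarith
  have hlim : Tendsto (fun k : ℕ => ((((k + 1 : ℕ) : ℝ) + 1) / ((k : ℝ) + 1)) ^ s)
      atTop (𝓝 1) := by
    have h1 : Tendsto (fun k : ℕ => (((k + 1 : ℕ) : ℝ) + 1) / ((k : ℝ) + 1)) atTop (𝓝 1) := by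
      have h2 : Tendsto (fun k : ℕ => 1 + (1 / ((k : ℝ) + 1))) atTop (𝓝 (1 + 0)) :=
        tendsto_const_nhds.add tendsto_one_div_add_atTop_nhds_zero_nat
      rw [add_zero] at h2
      refine h2.congr fun k => ?_
      have : (k : ℝ) + 1 ≠ 0 := by positivity
      push_cast
      field_simp
    have := h1.rpow_const (p := s) (Or.inl one_ne_zero)
    rwa [Real.one_rpow] at this
  have hev := (hlim.eventually (lt_mem_nhds hr1)).and (hl.and he)
  obtain ⟨K, hK⟩ := eventually_atTop.1 hev
  set M := max (‖e K‖ / ((K : ℝ) + 1) ^ s) (C / (r - ρ)) with hM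
  have hM1 : C ≤ (r - ρ) * M := by
    have : C / (r - ρ) ≤ M := le_max_right _ _
    rw [div_le_iff₀ (by linarith)] at this
    linarith
  have hM0 : 0 ≤ M := le_trans (by have : 0 < r - ρ := by linarith
                                   positivity) (le_max_right _ _)
  refine Asymptotics.IsBigO.of_bound M (eventually_atTop.2 ⟨K, fun k hk => ?_⟩)
  rw [Real.norm_of_nonneg (by positivity)]
  induction k, hk using Nat.le_induction with
  | base =>
    have : ‖e K‖ / ((K : ℝ) + 1) ^ s ≤ M := le_max_left _ _
    rwa [div_le_iff₀ (by positivity)] at this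
  | succ k hk ih =>
    obtain ⟨h1, h2, h3⟩ := hK k hk
    rw [Real.div_rpow (by positivity) (by positivity), lt_div_iff₀ (by positivity)] at h1
    have hfk := hb (x := k) (by positivity)
    rw [Real.norm_of_nonneg (by positivity)] at hfk
    have hp : (0 : ℝ) ≤ ((k : ℝ) + 1) ^ s := by positivity
    calc ‖e (k + 1)‖ ≤ ‖l k‖ * ‖e k‖ + ‖f k‖ := by
          rw [h3, ← norm_mul]; exact norm_add_le _ _
      _ ≤ ρ * (M * ((k : ℝ) + 1) ^ s) + C * ((k : ℝ) + 1) ^ s := by gcongr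
      _ ≤ ρ * (M * ((k : ℝ) + 1) ^ s) + (r - ρ) * M * ((k : ℝ) + 1) ^ s := by gcongr
      _ = M * (r * ((k : ℝ) + 1) ^ s) := by ring
      _ ≤ M * (((k + 1 : ℕ) : ℝ) + 1) ^ s := by gcongr

end Growth

/-- Entrywise growth of a sequence of matrices. -/
def MGrowth {r s E : Type*} [NormedAddCommGroup E] (c : ℝ) (F : ℕ → Matrix r s E) : Prop :=
  ∀ i j, Growth c fun k => F k i j

namespace MGrowth

variable {r s t 𝕜 : Type*} [NormedField 𝕜] {c d : ℝ}

theorem mul [Fintype s] {F : ℕ → Matrix r s 𝕜} {G : ℕ → Matrix s t 𝕜} (hF : MGrowth c F)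
    (hG : MGrowth d G) : MGrowth (c + d) fun k => F k * G k := by
  intro i j
  simp only [Matrix.mul_apply]
  exact Growth.sum _ fun l _ => (hF i l).mul (hG l j)

theorem const (M : Matrix r s 𝕜) : MGrowth 0 fun _ : ℕ => M := fun i j => Growth.const (M i j)

theorem mul_left_bdd [Fintype s] {F : ℕ → Matrix r s 𝕜} {G : ℕ → Matrix s t 𝕜}
    (hF : MGrowth 0 F) (hG : MGrowth c G) : MGrowth c fun k => F k * G k := by
  simpa using hF.mul hG

theorem mul_right_bdd [Fintype s] {F : ℕ → Matrix r s 𝕜} {G : ℕ → Matrix s t 𝕜}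
    (hF : MGrowth c F) (hG : MGrowth 0 G) : MGrowth c fun k => F k * G k := by
  simpa using hF.mul hG

theorem add {F G : ℕ → Matrix r s 𝕜} (hF : MGrowth c F) (hG : MGrowth c G) :
    MGrowth c fun k => F k + G k := fun i j => (hF i j).add (hG i j)

theorem neg {F : ℕ → Matrix r s 𝕜} (hF : MGrowth c F) :
    MGrowth c fun k => -F k := fun i j => (hF i j).neg

theorem transpose {F : ℕ → Matrix r s 𝕜} (hF : MGrowth c F) :
    MGrowth c fun k => (F k)ᵀ := fun i j => hF j i

theorem mono {F : ℕ → Matrix r s 𝕜} (hF : MGrowth c F) (h : c ≤ d) : MGrowth d F :=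
  fun i j => (hF i j).mono h

theorem congr' {F G : ℕ → Matrix r s 𝕜} (hF : MGrowth c F) (h : F =ᶠ[atTop] G) :
    MGrowth c G := fun i j => (hF i j).congr' (h.mono fun k hk => by simp only [hk])

/-- The inverse of a convergent sequence of matrices with invertible limit is bounded. -/
theorem inv_bdd [Fintype r] [DecidableEq r] {F : ℕ → Matrix r r 𝕜} {M : Matrix r r 𝕜}
    (hF : ∀ i j, Tendsto (fun k => F k i j) atTop (𝓝 (M i j))) (hM : IsUnit M.det) :
    MGrowth 0 fun k => (F k)⁻¹ := by
  have hFM : Tendsto F atTop (𝓝 M) := tendsto_pi_nhds.2 fun i => tendsto_pi_nhds.2 fun j => hF i j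
  have hdet : Tendsto (fun k => (F k).det) atTop (𝓝 M.det) :=
    ((continuous_id.matrix_det).tendsto M).comp hFM
  have hadj : Tendsto (fun k => (F k).adjugate) atTop (𝓝 M.adjugate) :=
    ((continuous_id.matrix_adjugate).tendsto M).comp hFM
  have hdinv := hdet.inv₀ hM.ne_zero
  intro i j
  have h1 : Tendsto (fun k => ((F k).det)⁻¹ * (F k).adjugate i j) atTop
      (𝓝 ((M.det)⁻¹ * M.adjugate i j)) :=
    hdinv.mul (tendsto_pi_nhds.1 (tendsto_pi_nhds.1 hadj i) j)
  refine (Growth.of_tendsto h1).congr' (Eventually.of_forall fun k => ?_)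
  simp [Matrix.inv_def, Ring.inverse_eq_inv']

theorem eventually_isUnit_det [Fintype r] [DecidableEq r] {F : ℕ → Matrix r r 𝕜}
    {M : Matrix r r 𝕜} (hF : ∀ i j, Tendsto (fun k => F k i j) atTop (𝓝 (M i j)))
    (hM : IsUnit M.det) : ∀ᶠ k in atTop, IsUnit (F k).det := by
  have hFM : Tendsto F atTop (𝓝 M) := tendsto_pi_nhds.2 fun i => tendsto_pi_nhds.2 fun j => hF i j
  have hdet : Tendsto (fun k => (F k).det) atTop (𝓝 M.det) :=
    ((continuous_id.matrix_det).tendsto M).comp hFM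
  exact (hdet.eventually_ne hM.ne_zero).mono fun k hk => isUnit_iff_ne_zero.2 hk

theorem inv_sub_inv [Fintype r] [DecidableEq r] {F : ℕ → Matrix r r 𝕜} {M : Matrix r r 𝕜}
    (hc : c < 0) (hF : MGrowth c fun k => F k - M) (hM : IsUnit M.det) :
    MGrowth c fun k => (F k)⁻¹ - M⁻¹ := by
  have hlim : ∀ i j, Tendsto (fun k => F k i j) atTop (𝓝 (M i j)) := fun i j =>
    (hF i j).tendsto hc
  have h1 : MGrowth c fun k => (F k)⁻¹ * (-(F k - M)) * M⁻¹ :=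
    ((inv_bdd hlim hM).mul_left_bdd hF.neg).mul_right_bdd (const _)
  refine h1.congr' ((eventually_isUnit_det hlim hM).mono fun k hk => ?_)
  simp only [neg_sub, Matrix.mul_sub, Matrix.sub_mul]
  rw [Matrix.nonsing_inv_mul _ hk, Matrix.mul_assoc, Matrix.mul_nonsing_inv _ hM, Matrix.mul_one,
    Matrix.one_mul]

end MGrowth


/-! ### Almost sure growth of weighted sums of innovations -/

section Innovations

variable {Ω : Type*} [mΩ : MeasurableSpace Ω] {μ : Measure Ω}

/-- Summation by parts: if the normalized partial sums are bounded, the sums grow at most like the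
normalizing sequence. -/
theorem abs_sum_le_of_abs_sum_div_le {z b : ℕ → ℝ} {T : ℝ} (hb : ∀ t, 0 < b t) (hmono : Monotone b)
    (hT : ∀ k, |∑ t ∈ Finset.range k, z t / b t| ≤ T) (k : ℕ) :
    |∑ t ∈ Finset.range k, z t| ≤ 2 * T * b k := by
  have hT0 : 0 ≤ T := (abs_nonneg _).trans (hT 0)
  have key : ∀ k, |∑ t ∈ Finset.range k, z t - b k * ∑ t ∈ Finset.range k, z t / b t|
      ≤ T * (b k - b 0) := by
    intro k
    induction k with
    | zero => simp
    | succ k ih =>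
      have h1 : ∑ t ∈ Finset.range (k + 1), z t
          - b (k + 1) * ∑ t ∈ Finset.range (k + 1), z t / b t
          = (∑ t ∈ Finset.range k, z t - b k * ∑ t ∈ Finset.range k, z t / b t)
            - (b (k + 1) - b k) * ∑ t ∈ Finset.range (k + 1), z t / b t := by
        simp only [Finset.sum_range_succ]
        have := (hb k).ne'
        field_simp
        ring
      have h2 : 0 ≤ b (k + 1) - b k := sub_nonneg.2 (hmono k.le_succ)
      rw [h1]
      refine (abs_sub _ _).trans ?_
      rw [abs_mul, abs_of_nonneg h2]
      have h3 := mul_le_mul_of_nonneg_left (hT (k + 1)) h2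
      linarith
  have h1 := key k
  have h2 := hT k
  have h3 : |b k * ∑ t ∈ Finset.range k, z t / b t| ≤ b k * T := by
    rw [abs_mul, abs_of_pos (hb k)]
    exact mul_le_mul_of_nonneg_left h2 (hb k).le
  have h4 : |∑ t ∈ Finset.range k, z t| ≤ |∑ t ∈ Finset.range k, z t
      - b k * ∑ t ∈ Finset.range k, z t / b t| + |b k * ∑ t ∈ Finset.range k, z t / b t| := by
    have := abs_add_le (∑ t ∈ Finset.range k, z t - b k * ∑ t ∈ Finset.range k, z t / b t)
      (b k * ∑ t ∈ Finset.range k, z t / b t)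
    simpa using this
  have h5 : 0 ≤ T * b 0 := mul_nonneg hT0 (hb 0).le
  nlinarith

/-- Sums of innovations with predictable, square summable weights are bounded almost surely: they
form an `L²`-bounded martingale. -/
theorem ae_bddAbove_sum_mul [IsProbabilityMeasure μ] (ℱ : Filtration ℕ mΩ) {a g : ℕ → Ω → ℝ}
    {B : ℕ → ℝ} {C : ℝ} (ha : ∀ k, Measurable[ℱ k] (a k)) (haB : ∀ k ω, |a k ω| ≤ B k)
    (hB : Summable fun k => B k ^ 2)
    (hg : ∀ k, Measurable[ℱ (k + 1)] (g k))
    (hind : ∀ k, Indep (MeasurableSpace.comap (g k) inferInstance) (ℱ k) μ)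
    (hL2 : ∀ k, MemLp (g k) 2 μ) (h0 : ∀ k, ∫ ω, g k ω ∂μ = 0)
    (hC : ∀ k, ∫ ω, g k ω ^ 2 ∂μ ≤ C) :
    ∀ᵐ ω ∂μ, ∃ T, ∀ k, |∑ t ∈ Finset.range k, a t ω * g t ω| ≤ T := by
  have hC0 : 0 ≤ C := le_trans (integral_nonneg fun ω => sq_nonneg _) (hC 0)
  have ham : ∀ k, Measurable (a k) := fun k => (ha k).mono (ℱ.le k) le_rfl
  have hgm : ∀ k, Measurable (g k) := fun k => (hg k).mono (ℱ.le _) le_rfl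
  have hag2 : ∀ k, MemLp (fun ω => a k ω * g k ω) 2 μ := fun k =>
    (hL2 k).of_le_mul (c := B k) ((ham k).mul (hgm k)).aestronglyMeasurable
      (Eventually.of_forall fun ω => by
        rw [norm_mul]
        exact mul_le_mul_of_nonneg_right (haB k ω) (norm_nonneg _))
  set M : ℕ → Ω → ℝ := fun k ω => ∑ t ∈ Finset.range k, a t ω * g t ω with hM
  have hM2 : ∀ k, MemLp (M k) 2 μ := fun k => memLp_finsetSum _ fun t _ => hag2 t
  have hMint : ∀ k, Integrable (M k) μ := fun k => (hM2 k).integrable (by norm_num)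
  have hMad : ∀ k, Measurable[ℱ k] (M k) := by
    intro k
    refine Finset.measurable_fun_sum _ fun t ht => ?_
    have htk := Finset.mem_range.1 ht
    exact ((ha t).mono (ℱ.mono htk.le) le_rfl).mul ((hg t).mono (ℱ.mono htk) le_rfl)
  have hgint : ∀ k, Integrable (g k) μ := fun k => (hL2 k).integrable (by norm_num)
  have hagint : ∀ k, Integrable (a k * g k) μ := fun k => (hag2 k).integrable (by norm_num)
  have hmart : Martingale M ℱ μ := by
    refine martingale_of_condExp_sub_eq_zero_nat (fun k => (hMad k).stronglyMeasurable) hMint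
      fun k => ?_
    have e1 : M (k + 1) - M k = a k * g k := by
      funext ω
      simp [hM, Finset.sum_range_succ]
    rw [e1]
    refine (condExp_mul_of_stronglyMeasurable_left (ha k).stronglyMeasurable (hagint k)
      (hgint k)).trans ?_
    have h2 := condExp_indep_eq (hgm k).comap_le (ℱ.le k)
      (comap_measurable (g k)).stronglyMeasurable (hind k)
    filter_upwards [h2] with ω hω
    simp [hω, h0]
  -- the increments are orthogonal to the past, so `E M_k²` is the sum of their second moments
  have hcross : ∀ k, ∫ ω, M k ω * a k ω * g k ω ∂μ = 0 := by
    intro k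
    have hi : IndepFun (fun ω => M k ω * a k ω) (g k) μ := by
      rw [IndepFun_iff_Indep]
      exact (indep_of_indep_of_le_right (hind k) ((hMad k).mul (ha k)).comap_le).symm
    have := hi.integral_mul_eq_mul_integral
      (((hMad k).mono (ℱ.le k) le_rfl).mul (ham k)).aestronglyMeasurable
      (hgm k).aestronglyMeasurable
    rw [h0 k, mul_zero] at this
    exact this
  have hstep : ∀ k, ∫ ω, M k ω ^ 2 ∂μ ≤ C * ∑ t ∈ Finset.range k, B t ^ 2 := by
    intro k
    induction k with
    | zero => simp [hM]
    | succ k ih =>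
      have hMa : Integrable (fun ω => M k ω * a k ω * g k ω) μ := by
        have := (hM2 k).integrable_mul (hag2 k)
        refine this.congr (Eventually.of_forall fun ω => ?_)
        simp [mul_assoc]
      have hi : Integrable (fun ω => M k ω ^ 2 + 2 * (M k ω * a k ω * g k ω)) μ :=
        (hM2 k).integrable_sq.add (hMa.const_mul 2)
      have e1 : ∫ ω, M (k + 1) ω ^ 2 ∂μ = ∫ ω, M k ω ^ 2 ∂μ + 2 * ∫ ω, M k ω * a k ω * g k ω ∂μ
          + ∫ ω, (a k ω * g k ω) ^ 2 ∂μ := by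
        rw [← integral_const_mul, ← integral_add (hM2 k).integrable_sq (hMa.const_mul 2),
          ← integral_add hi (hag2 k).integrable_sq]
        refine integral_congr_ae (Eventually.of_forall fun ω => ?_)
        simp only [hM, Finset.sum_range_succ]
        ring
      have e2 : ∫ ω, (a k ω * g k ω) ^ 2 ∂μ ≤ B k ^ 2 * C := by
        calc ∫ ω, (a k ω * g k ω) ^ 2 ∂μ ≤ ∫ ω, B k ^ 2 * g k ω ^ 2 ∂μ := by
              refine integral_mono (hag2 k).integrable_sq ((hL2 k).integrable_sq.const_mul _)
                fun ω => ?_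
              simp only [mul_pow]
              refine mul_le_mul_of_nonneg_right ?_ (sq_nonneg _)
              rw [← sq_abs]
              exact pow_le_pow_left₀ (abs_nonneg _) (haB k ω) 2
          _ = B k ^ 2 * ∫ ω, g k ω ^ 2 ∂μ := integral_const_mul _ _
          _ ≤ B k ^ 2 * C := mul_le_mul_of_nonneg_left (hC k) (sq_nonneg _)
      rw [e1, hcross k, Finset.sum_range_succ, mul_add]
      linarith
  set R : ℝ := 1 + C * ∑' t, B t ^ 2 with hR
  have hR0 : 0 ≤ R := by
    have : 0 ≤ ∑' t, B t ^ 2 := tsum_nonneg fun t => sq_nonneg _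
    positivity
  have hbdd : ∀ k, eLpNorm (M k) 1 μ ≤ R.toNNReal := by
    intro k
    have h1 : ∫ ω, ‖M k ω‖ ∂μ ≤ R := by
      calc ∫ ω, ‖M k ω‖ ∂μ ≤ ∫ ω, (1 + M k ω ^ 2) ∂μ := by
            refine integral_mono (hMint k).norm ((integrable_const 1).add (hM2 k).integrable_sq)
              fun ω => ?_
            simp only [Real.norm_eq_abs]
            nlinarith [sq_nonneg (|M k ω| - 1), sq_abs (M k ω), abs_nonneg (M k ω)]
        _ = 1 + ∫ ω, M k ω ^ 2 ∂μ := by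
            rw [integral_add (integrable_const 1) (hM2 k).integrable_sq]; simp
        _ ≤ R := by
            have h2 := hstep k
            have h3 : ∑ t ∈ Finset.range k, B t ^ 2 ≤ ∑' t, B t ^ 2 :=
              hB.sum_le_tsum _ fun t _ => sq_nonneg _
            have := mul_le_mul_of_nonneg_left h3 hC0
            linarith
    rw [eLpNorm_one_eq_lintegral_enorm, ← ofReal_integral_norm_eq_lintegral_enorm (hMint k)]
    exact ENNReal.ofReal_le_ofReal h1
  -- an `L¹`-bounded martingale converges almost surely
  filter_upwards [hmart.submartingale.ae_tendsto_limitProcess hbdd] with ω hω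
  obtain ⟨T, hT⟩ := hω.abs.bddAbove_range
  exact ⟨T, fun k => hT ⟨k, rfl⟩⟩

/-- If the predictable weights `a_t` grow at most like `t ^ c` and the centred innovations `g_t`
are bounded in `L²`, then `∑_{t < k} a_t g_t` grows at most like `k ^ (c + 1/2)`. -/
theorem ae_growth_sum_mul [IsProbabilityMeasure μ] (ℱ : Filtration ℕ mΩ) {a g : ℕ → Ω → ℝ}
    {c C : ℝ} (hc : 0 ≤ c) (ha : ∀ k, Measurable[ℱ k] (a k))
    (hac : ∀ᵐ ω ∂μ, Growth c fun k => a k ω)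
    (hg : ∀ k, Measurable[ℱ (k + 1)] (g k))
    (hind : ∀ k, Indep (MeasurableSpace.comap (g k) inferInstance) (ℱ k) μ)
    (hL2 : ∀ k, MemLp (g k) 2 μ) (h0 : ∀ k, ∫ ω, g k ω ∂μ = 0)
    (hC : ∀ k, ∫ ω, g k ω ^ 2 ∂μ ≤ C) :
    ∀ᵐ ω ∂μ, Growth (c + 1 / 2) fun k => ∑ t ∈ Finset.range k, a t ω * g t ω := by
  -- truncate the weights at level `N (t+1) ^ (c + ε)` and normalize by `(t+1) ^ (c + 1/2 + 2ε)`
  set e : ℕ → ℝ := fun j => 1 / ((j : ℝ) + 1) with he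
  have he0 : ∀ j, 0 < e j := fun j => by simp only [he]; positivity
  set b : ℕ → ℕ → ℝ := fun j t => ((t : ℝ) + 1) ^ (c + 1 / 2 + 2 * e j) with hb
  have hb0 : ∀ j t, 0 < b j t := fun j t => by simp only [hb]; positivity
  have hbmono : ∀ j, Monotone (b j) := fun j s t hst => by
    have h1 : (s : ℝ) ≤ t := Nat.cast_le.2 hst
    have h2 := he0 j
    exact Real.rpow_le_rpow (by positivity) (by linarith) (by linarith)
  set tr : ℕ → ℕ → ℕ → Ω → ℝ := fun j N t ω =>
    (if |a t ω| ≤ N * ((t : ℝ) + 1) ^ (c + e j) then a t ω else 0) / b j t with htr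
  have hmain : ∀ᵐ ω ∂μ, ∀ j N : ℕ, ∃ T, ∀ k,
      |∑ t ∈ Finset.range k, tr j N t ω * g t ω| ≤ T := by
    rw [ae_all_iff]; intro j; rw [ae_all_iff]; intro N
    refine ae_bddAbove_sum_mul ℱ (B := fun t => N * ((t : ℝ) + 1) ^ (-(1 / 2) - e j))
      (fun k => ?_) (fun t ω => ?_) ?_ hg hind hL2 h0 hC
    · have hs : MeasurableSet[ℱ k] {ω | |a k ω| ≤ N * ((k : ℝ) + 1) ^ (c + e j)} :=
        measurableSet_le (continuous_abs.measurable.comp (ha k)) measurable_const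
      exact (Measurable.ite hs (ha k) measurable_const).div_const _
    · simp only [htr]
      rw [abs_div, abs_of_pos (hb0 j t), div_le_iff₀ (hb0 j t)]
      have e1 : N * ((t : ℝ) + 1) ^ (-(1 / 2) - e j) * b j t
          = N * ((t : ℝ) + 1) ^ (c + e j) := by
        simp only [hb]
        rw [mul_assoc, ← Real.rpow_add (by positivity)]
        congr 2; ring
      rw [e1]
      split_ifs with h
      · exact h
      · simp only [abs_zero]; positivity
    · have h1 : Summable fun t : ℕ => (((t + 1 : ℕ) : ℝ)) ^ (-1 - 2 * e j) :=
        (summable_nat_add_iff 1).2 (Real.summable_nat_rpow.2 (by have := he0 j; linarith))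
      refine (h1.mul_left ((N : ℝ) ^ 2)).congr fun t => ?_
      rw [mul_pow, ← Real.rpow_natCast (((t : ℝ) + 1) ^ (-(1 / 2) - e j)), ← Real.rpow_mul
        (by positivity)]
      push_cast
      congr 2
      ring
  filter_upwards [hmain, hac] with ω h1 h2
  intro ε hε
  obtain ⟨j, hj⟩ := exists_nat_one_div_lt (show 0 < ε / 2 by linarith)
  obtain ⟨D, hD0, hD⟩ := Asymptotics.bound_of_isBigO_nat_atTop (h2 (e j) (he0 j))
  obtain ⟨N, hN⟩ := exists_nat_ge D
  obtain ⟨T, hT⟩ := h1 j N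
  have hT0 : 0 ≤ T := (abs_nonneg _).trans (hT 0)
  have hT' : ∀ k, |∑ t ∈ Finset.range k, (a t ω * g t ω) / b j t| ≤ T := by
    intro k
    refine le_of_eq_of_le ?_ (hT k)
    congr 1
    refine Finset.sum_congr rfl fun t _ => ?_
    have h3 : |a t ω| ≤ N * ((t : ℝ) + 1) ^ (c + e j) := by
      have := hD (x := t) (by positivity)
      rw [Real.norm_of_nonneg (by positivity : (0 : ℝ) ≤ ((t : ℝ) + 1) ^ (c + e j))] at this
      exact this.trans (by gcongr)
    simp only [htr, if_pos h3]
    ring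
  have h4 := abs_sum_le_of_abs_sum_div_le (hb0 j) (hbmono j) hT'
  refine Asymptotics.IsBigO.of_bound (2 * T) (Eventually.of_forall fun k => ?_)
  rw [Real.norm_of_nonneg (by positivity : (0 : ℝ) ≤ ((k : ℝ) + 1) ^ (c + 1 / 2 + ε)),
    Real.norm_eq_abs]
  refine (h4 k).trans (mul_le_mul_of_nonneg_left ?_ (by positivity))
  exact Real.rpow_le_rpow_of_exponent_le (one_le_natCast_add_one k)
    (by simp only [he]; linarith)

/-- A sequence of random variables with bounded moments of all orders grows slower than every
power, almost surely. For each `r`, the series `∑ |Z_k| ^ r (k + 1) ^ (-2)` has finite expectation,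
so its terms are almost surely bounded and `|Z_k|` is at most of order `k ^ (2 / r)`. -/
theorem ae_growth_zero_of_moments [IsProbabilityMeasure μ] {Z : ℕ → Ω → ℝ}
    (hC : ∀ r : ℕ, ∃ C, ∀ k, Integrable (fun ω => |Z k ω| ^ r) μ ∧ ∫ ω, |Z k ω| ^ r ∂μ ≤ C) :
    ∀ᵐ ω ∂μ, Growth 0 fun k => Z k ω := by
  have key : ∀ᵐ ω ∂μ, ∀ r : ℕ, ∃ T, ∀ k : ℕ, |Z k ω| ^ r * ((k : ℝ) + 1) ^ (-2 : ℝ) ≤ T := by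
    rw [ae_all_iff]; intro r
    obtain ⟨C, hC⟩ := hC r
    have hsum : Summable fun k : ℕ => ((k : ℝ) + 1) ^ (-2 : ℝ) := by
      have := (summable_nat_add_iff 1).2 (Real.summable_nat_rpow.2 (by norm_num : (-2 : ℝ) < -1))
      exact this.congr fun k => by push_cast; rfl
    have hint : ∀ k, Integrable (fun ω => |Z k ω| ^ r * ((k : ℝ) + 1) ^ (-2 : ℝ)) μ := fun k =>
      (hC k).1.mul_const _
    have hfin : ∑' k, ∫⁻ ω, ENNReal.ofReal (|Z k ω| ^ r * ((k : ℝ) + 1) ^ (-2 : ℝ)) ∂μ ≠ ⊤ := by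
      have h1 : ∀ k, ∫⁻ ω, ENNReal.ofReal (|Z k ω| ^ r * ((k : ℝ) + 1) ^ (-2 : ℝ)) ∂μ
          ≤ ENNReal.ofReal (C * ((k : ℝ) + 1) ^ (-2 : ℝ)) := fun k => by
        rw [← ofReal_integral_eq_lintegral_ofReal (hint k)
          (Eventually.of_forall fun ω => by positivity), integral_mul_const]
        exact ENNReal.ofReal_le_ofReal (mul_le_mul_of_nonneg_right (hC k).2 (by positivity))
      refine ne_top_of_le_ne_top ?_ (ENNReal.tsum_le_tsum h1)
      exact (hsum.mul_left C).tsum_ofReal_ne_top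
    rw [← lintegral_tsum fun k => (hint k).aestronglyMeasurable.aemeasurable.ennreal_ofReal] at hfin
    have hae := ae_lt_top' (AEMeasurable.tsum fun k =>
      (hint k).aestronglyMeasurable.aemeasurable.ennreal_ofReal) hfin
    filter_upwards [hae] with ω hω
    refine ⟨(∑' k, ENNReal.ofReal (|Z k ω| ^ r * ((k : ℝ) + 1) ^ (-2 : ℝ))).toReal, fun k => ?_⟩
    have h2 := ENNReal.toReal_mono hω.ne (ENNReal.le_tsum (f := fun k : ℕ =>
      ENNReal.ofReal (|Z k ω| ^ r * ((k : ℝ) + 1) ^ (-2 : ℝ))) k)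
    rwa [ENNReal.toReal_ofReal (by positivity)] at h2
  filter_upwards [key] with ω hω
  intro ε hε
  obtain ⟨r, hr⟩ := exists_nat_gt (2 / ε)
  have hr0 : (0 : ℝ) < r := lt_of_le_of_lt (by positivity) hr
  obtain ⟨T, hT⟩ := hω r
  have hT0 : 0 ≤ T := le_trans (by positivity) (hT 0)
  have hr2 : 2 ≤ ε * r := by rw [div_lt_iff₀ hε] at hr; linarith
  refine Asymptotics.IsBigO.of_bound (T ^ (1 / (r : ℝ))) (Eventually.of_forall fun k => ?_)
  rw [Real.norm_of_nonneg (by positivity : (0 : ℝ) ≤ ((k : ℝ) + 1) ^ (0 + ε)), Real.norm_eq_abs]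
  have h1 : |Z k ω| ^ (r : ℝ) ≤ (T ^ (1 / (r : ℝ)) * ((k : ℝ) + 1) ^ (0 + ε)) ^ (r : ℝ) := by
    rw [Real.mul_rpow (by positivity) (by positivity), ← Real.rpow_mul hT0,
      one_div_mul_cancel hr0.ne', Real.rpow_one, ← Real.rpow_mul (by positivity), Real.rpow_natCast]
    have h2 := hT k
    rw [Real.rpow_neg (by positivity), ← div_eq_mul_inv, div_le_iff₀ (by positivity)] at h2
    refine h2.trans (mul_le_mul_of_nonneg_left ?_ hT0)
    exact Real.rpow_le_rpow_of_exponent_le (one_le_natCast_add_one k) (by linarith)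
  exact (Real.rpow_le_rpow_iff (abs_nonneg _) (by positivity) hr0).1 h1

end Innovations

/-! ### Stability of the optimal covariance under perturbations -/

section Optimal

variable {r : Type*} [Fintype r]

theorem dotProduct_mulVec_smul (M : Matrix r r ℝ) (a : ℝ) (x : r → ℝ) :
    (a • x) ⬝ᵥ M *ᵥ (a • x) = a ^ 2 * (x ⬝ᵥ M *ᵥ x) := by
  rw [Matrix.mulVec_smul, smul_dotProduct, dotProduct_smul, smul_eq_mul, smul_eq_mul]; ring

theorem continuous_dotProduct_mulVec (M : Matrix r r ℝ) :
    Continuous fun x : r → ℝ => x ⬝ᵥ M *ᵥ x := by fun_prop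

theorem isCompact_unitSphere : IsCompact {x : r → ℝ | x ⬝ᵥ x = 1} := by
  refine Metric.isCompact_of_isClosed_isBounded (isClosed_eq (by fun_prop) continuous_const) ?_
  refine (Metric.isBounded_closedBall (x := (0 : r → ℝ)) (r := 1)).subset fun x hx => ?_
  rw [mem_closedBall_zero_iff, pi_norm_le_iff_of_nonneg zero_le_one]
  intro i
  have h1 : x i * x i ≤ x ⬝ᵥ x :=
    Finset.single_le_sum (f := fun i => x i * x i) (fun j _ => mul_self_nonneg _)
      (Finset.mem_univ i)
  rw [Set.mem_ofPred_eq] at hx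
  rw [hx] at h1
  rw [Real.norm_eq_abs]
  exact abs_le_one_iff_mul_self_le_one.2 h1

theorem exists_smul_unit {x : r → ℝ} (hx : x ≠ 0) :
    ∃ (a : ℝ) (u : r → ℝ), a ≠ 0 ∧ u ⬝ᵥ u = 1 ∧ x = a • u := by
  have h0 : 0 < x ⬝ᵥ x := by
    have h1 : 0 ≤ x ⬝ᵥ x := Finset.sum_nonneg fun j _ => mul_self_nonneg _
    exact lt_of_le_of_ne h1 fun h => hx (dotProduct_self_eq_zero.1 h.symm)
  refine ⟨√(x ⬝ᵥ x), (√(x ⬝ᵥ x))⁻¹ • x, (Real.sqrt_pos.2 h0).ne', ?_, ?_⟩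
  · rw [smul_dotProduct, dotProduct_smul, smul_eq_mul, smul_eq_mul, ← mul_assoc, ← mul_inv,
      Real.mul_self_sqrt h0.le, inv_mul_cancel₀ h0.ne']
  · rw [smul_smul, mul_inv_cancel₀ (Real.sqrt_pos.2 h0).ne', one_smul]

theorem PosDef.quad_pos {X : Matrix r r ℝ} (hX : X.PosDef) {x : r → ℝ} (hx : x ≠ 0) :
    0 < x ⬝ᵥ X *ᵥ x := by
  have := hX.dotProduct_mulVec_pos hx
  rwa [star_trivial] at this

theorem PosSemidef.quad_nonneg {X : Matrix r r ℝ} (hX : X.PosSemidef) (x : r → ℝ) :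
    0 ≤ x ⬝ᵥ X *ᵥ x := by
  have := hX.dotProduct_mulVec_nonneg x
  rwa [star_trivial] at this

/-- A generalized Rayleigh quotient attains its maximum. -/
theorem exists_rayleigh_max [Nonempty r] (P : Matrix r r ℝ) {X : Matrix r r ℝ} (hX : X.PosDef) :
    ∃ x : r → ℝ, x ⬝ᵥ x = 1 ∧ ∀ y : r → ℝ,
      y ⬝ᵥ P *ᵥ y ≤ (x ⬝ᵥ P *ᵥ x) / (x ⬝ᵥ X *ᵥ x) * (y ⬝ᵥ X *ᵥ y) := by
  classical
  have hne : ({x : r → ℝ | x ⬝ᵥ x = 1}).Nonempty :=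
    ⟨Pi.single (Classical.arbitrary r) 1, by simp⟩
  have hpos : ∀ x : r → ℝ, x ⬝ᵥ x = 1 → 0 < x ⬝ᵥ X *ᵥ x := fun x hx =>
    PosDef.quad_pos hX (by rintro rfl; simp at hx)
  obtain ⟨x, hx, hmax⟩ := isCompact_unitSphere.exists_isMaxOn hne
    (f := fun x => (x ⬝ᵥ P *ᵥ x) / (x ⬝ᵥ X *ᵥ x))
    ((continuous_dotProduct_mulVec P).continuousOn.div (continuous_dotProduct_mulVec X).continuousOn
      fun x hx => (hpos x hx).ne')
  refine ⟨x, hx, fun y => ?_⟩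
  by_cases hy : y = 0
  · simp [hy]
  obtain ⟨a, u, ha, hu, rfl⟩ := exists_smul_unit hy
  have h1 := hmax hu
  simp only [Set.mem_ofPred_eq] at h1
  rw [div_le_iff₀ (hpos u hu)] at h1
  rw [dotProduct_mulVec_smul, dotProduct_mulVec_smul]
  have h2 : (0 : ℝ) ≤ a ^ 2 := sq_nonneg a
  nlinarith

theorem PosDef.exists_lower_bound {X : Matrix r r ℝ} (hX : X.PosDef) :
    ∃ κ > 0, ∀ x : r → ℝ, κ * (x ⬝ᵥ x) ≤ x ⬝ᵥ X *ᵥ x := by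
  classical
  rcases isEmpty_or_nonempty r with h | h
  · exact ⟨1, one_pos, fun x => by simp [dotProduct]⟩
  obtain ⟨x, hx, hmax⟩ := exists_rayleigh_max (1 : Matrix r r ℝ) hX
  have hpos : 0 < x ⬝ᵥ X *ᵥ x := PosDef.quad_pos hX (by rintro rfl; simp at hx)
  refine ⟨x ⬝ᵥ X *ᵥ x, hpos, fun y => ?_⟩
  have := hmax y
  rw [Matrix.one_mulVec, Matrix.one_mulVec, hx, one_div, inv_mul_eq_div, le_div_iff₀ hpos] at this
  linarith

theorem posSemidef_of_quad_nonneg {M : Matrix r r ℝ} (hM : Mᵀ = M)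
    (h : ∀ x : r → ℝ, 0 ≤ x ⬝ᵥ M *ᵥ x) : M.PosSemidef :=
  Matrix.PosSemidef.of_dotProduct_mulVec_nonneg (by
    rw [Matrix.IsHermitian, Matrix.conjTranspose_eq_transpose_of_trivial, hM]) fun x => by
    rw [star_trivial]; exact h x

theorem quad_vecMulVec (z x : r → ℝ) : x ⬝ᵥ vecMulVec z z *ᵥ x = (z ⬝ᵥ x) ^ 2 := by
  rw [vecMulVec_mulVec, dotProduct_smul, MulOpposite.smul_eq_mul_unop]
  rw [dotProduct_comm x z]
  simp [sq]

theorem posSemidef_smul_vecMulVec {b : ℝ} (hb : 0 ≤ b) (z : r → ℝ) :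
    (b • vecMulVec z z).PosSemidef := by
  refine posSemidef_of_quad_nonneg ?_ fun x => ?_
  · rw [transpose_smul, transpose_vecMulVec]
  · rw [smul_mulVec, dotProduct_smul, quad_vecMulVec, smul_eq_mul]; positivity

theorem trace_vecMulVec_mul (z : r → ℝ) (M : Matrix r r ℝ) :
    (vecMulVec z z * M).trace = z ⬝ᵥ M *ᵥ z := by
  rw [vecMulVec_mul, trace_vecMulVec, dotProduct_mulVec, dotProduct_comm]

/-- Spectral gap of the pencil `(P, X)` at a simple largest generalized eigenvalue `μ`, with unit
eigenvector `z`. -/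
theorem exists_spectral_gap {p : ℕ} {P X : Matrix (Fin p) (Fin p) ℝ} (hP : P.PosSemidef)
    (hX : X.PosDef) (hmax : HasUniqueMaxEigenvalue (X⁻¹ * P)) :
    ∃ (μ c : ℝ) (z : Fin p → ℝ), 0 < c ∧ z ⬝ᵥ z = 1 ∧ (μ • X - P) *ᵥ z = 0 ∧
      (∀ x, x ⬝ᵥ P *ᵥ x ≤ μ * (x ⬝ᵥ X *ᵥ x)) ∧
      ∀ x : Fin p → ℝ, c * ((x - (z ⬝ᵥ x) • z) ⬝ᵥ (x - (z ⬝ᵥ x) • z))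
        ≤ x ⬝ᵥ (μ • X - P) *ᵥ x := by
  obtain ⟨μ, hrank, htop⟩ := hmax
  have hXu : IsUnit X.det := hX.isUnit.map Matrix.detMonoidHom
  have hXt : Xᵀ = X := by
    have := hX.isHermitian
    rwa [Matrix.IsHermitian, Matrix.conjTranspose_eq_transpose_of_trivial] at this
  have hPt : Pᵀ = P := by
    have := hP.isHermitian
    rwa [Matrix.IsHermitian, Matrix.conjTranspose_eq_transpose_of_trivial] at this
  have hmem : ∀ (ν : ℝ) (x : Fin p → ℝ), (ν • X - P) *ᵥ x = 0 ↔
      x ∈ Module.End.eigenspace (Matrix.toLin' (X⁻¹ * P)) ν := by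
    intro ν x
    rw [Module.End.mem_eigenspace_iff, Matrix.toLin'_apply, sub_mulVec, sub_eq_zero, smul_mulVec,
      ← mulVec_mulVec]
    constructor
    · intro h
      rw [← h, mulVec_smul, mulVec_mulVec, Matrix.nonsing_inv_mul _ hXu, one_mulVec]
    · intro h
      rw [← mulVec_smul, ← h, mulVec_mulVec, Matrix.mul_nonsing_inv _ hXu, one_mulVec]
  obtain ⟨⟨v, hv⟩, hv0, hvspan⟩ := finrank_eq_one_iff'.1 hrank
  have hv0' : v ≠ 0 := fun h => hv0 (Subtype.ext h)
  obtain ⟨a, z, ha, hz, rfl⟩ := exists_smul_unit hv0'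
  have hMz : (μ • X - P) *ᵥ z = 0 := by
    have := (hmem μ _).2 hv
    rw [mulVec_smul] at this
    exact (smul_eq_zero.1 this).resolve_left ha
  have hker : ∀ x, (μ • X - P) *ᵥ x = 0 → ∃ t : ℝ, x = t • z := by
    intro x hx
    obtain ⟨t, ht⟩ := hvspan ⟨x, (hmem μ x).1 hx⟩
    refine ⟨t * a, ?_⟩
    have := congrArg Subtype.val ht
    simp only [SetLike.mk_smul_mk] at this
    rw [← this, smul_smul]
  have : Nonempty (Fin p) := by
    by_contra h
    rw [not_nonempty_iff] at h
    exact hv0' (funext fun i => h.elim i)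
  have hquad : ∀ (ν : ℝ) (x : Fin p → ℝ), x ⬝ᵥ (ν • X - P) *ᵥ x
      = ν * (x ⬝ᵥ X *ᵥ x) - x ⬝ᵥ P *ᵥ x := by
    intro ν x
    rw [sub_mulVec, smul_mulVec, dotProduct_sub, dotProduct_smul, smul_eq_mul]
  have htr : ∀ ν : ℝ, (ν • X - P)ᵀ = ν • X - P := fun ν => by
    rw [transpose_sub, transpose_smul, hXt, hPt]
  -- the maximum of the Rayleigh quotient is an eigenvalue, hence at most `μ`
  have hle : ∀ x, x ⬝ᵥ P *ᵥ x ≤ μ * (x ⬝ᵥ X *ᵥ x) := by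
    obtain ⟨x, hx, hxmax⟩ := exists_rayleigh_max P hX
    have hx0 : x ≠ 0 := by rintro rfl; simp at hx
    have hpos := PosDef.quad_pos hX hx0
    set ν := (x ⬝ᵥ P *ᵥ x) / (x ⬝ᵥ X *ᵥ x) with hν
    have hpsd : (ν • X - P).PosSemidef := posSemidef_of_quad_nonneg (htr ν) fun y => by
      rw [hquad]; linarith [hxmax y]
    have h0 : (ν • X - P) *ᵥ x = 0 := by
      refine (hpsd.dotProduct_mulVec_zero_iff x).1 ?_
      rw [star_trivial, hquad, hν, div_mul_cancel₀ _ hpos.ne', sub_self]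
    have hνμ : ν ≤ μ := htop ν (Module.End.hasEigenvalue_of_hasEigenvector
      ⟨(hmem ν x).1 h0, hx0⟩)
    intro y
    refine (hxmax y).trans ?_
    by_cases hy : y = 0
    · simp [hy]
    exact mul_le_mul_of_nonneg_right hνμ (PosDef.quad_pos hX hy).le
  have hpsd : (μ • X - P).PosSemidef := posSemidef_of_quad_nonneg (htr μ) fun y => by
    rw [hquad]; linarith [hle y]
  have hqN : ∀ x, x ⬝ᵥ (μ • X - P + vecMulVec z z) *ᵥ x
      = x ⬝ᵥ (μ • X - P) *ᵥ x + (z ⬝ᵥ x) ^ 2 := fun x => by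
    rw [add_mulVec, dotProduct_add, quad_vecMulVec]
  -- adding `z zᵀ` removes the kernel of `μ X - P`, which is spanned by `z`
  have hpd : (μ • X - P + vecMulVec z z).PosDef := by
    refine Matrix.PosDef.of_dotProduct_mulVec_pos ?_ fun x hx => ?_
    · rw [Matrix.IsHermitian, Matrix.conjTranspose_eq_transpose_of_trivial, transpose_add, htr,
        transpose_vecMulVec]
    · rw [star_trivial, hqN]
      have h1 := PosSemidef.quad_nonneg hpsd x
      refine lt_of_le_of_ne (by positivity) fun h => ?_
      have h2 : x ⬝ᵥ (μ • X - P) *ᵥ x = 0 := by nlinarith [sq_nonneg (z ⬝ᵥ x)]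
      have h3 : z ⬝ᵥ x = 0 := by
        have : (z ⬝ᵥ x) ^ 2 = 0 := by linarith
        exact pow_eq_zero_iff two_ne_zero |>.1 this
      obtain ⟨t, rfl⟩ := hker x ((hpsd.dotProduct_mulVec_zero_iff x).1 (by rwa [star_trivial]))
      rw [dotProduct_smul, hz, smul_eq_mul, mul_one] at h3
      exact hx (by rw [h3, zero_smul])
  obtain ⟨c, hc, hlow⟩ := PosDef.exists_lower_bound hpd
  refine ⟨μ, c, z, hc, hz, hMz, hle, fun x => ?_⟩
  have h1 := hlow (x - (z ⬝ᵥ x) • z)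
  have hzM : ∀ y, z ⬝ᵥ (μ • X - P) *ᵥ y = 0 := fun y => by
    rw [dotProduct_mulVec, ← mulVec_transpose, htr, hMz, zero_dotProduct]
  rw [hqN, dotProduct_sub z, dotProduct_smul, hz, smul_eq_mul, mul_one, sub_self, mulVec_sub,
    mulVec_smul, hMz, smul_zero, sub_zero] at h1
  have h2 : (x - (z ⬝ᵥ x) • z) ⬝ᵥ (μ • X - P) *ᵥ x = x ⬝ᵥ (μ • X - P) *ᵥ x := by
    rw [sub_dotProduct, smul_dotProduct, hzM, smul_zero, sub_zero]
  rw [h2] at h1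
  simpa using h1

theorem PosSemidef.exists_factor [DecidableEq r] {V : Matrix r r ℝ} (hV : V.PosSemidef) :
    ∃ B : Matrix r r ℝ, V = B * Bᵀ := by
  refine ⟨CFC.sqrt V, ?_⟩
  have h0 : (0 : Matrix r r ℝ) ≤ V := Matrix.nonneg_iff_posSemidef.2 hV
  have h1 : (CFC.sqrt V).PosSemidef := Matrix.nonneg_iff_posSemidef.1 (CFC.sqrt_nonneg V)
  have h2 := h1.isHermitian
  rw [Matrix.IsHermitian, Matrix.conjTranspose_eq_transpose_of_trivial] at h2
  rw [h2, CFC.sqrt_mul_sqrt_self V h0]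

theorem trace_mul_transpose_mul (B M : Matrix r r ℝ) :
    (B * Bᵀ * M).trace = ∑ l, (Bᵀ l) ⬝ᵥ M *ᵥ (Bᵀ l) := by
  rw [Matrix.mul_assoc, Matrix.trace_mul_comm, Matrix.trace]
  refine Finset.sum_congr rfl fun l _ => ?_
  rw [Matrix.diag_apply, Matrix.mul_assoc, Matrix.mul_apply]
  rfl

theorem abs_trace_mul_le {A B : Matrix r r ℝ} {α β : ℝ} (hα : ∀ i j, |A i j| ≤ α)
    (hβ : ∀ i j, |B i j| ≤ β) :
    |(A * B).trace| ≤ (Fintype.card r : ℝ) ^ 2 * (α * β) := by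
  have h1 : |(A * B).trace| ≤ ∑ _i : r, ∑ _j : r, α * β := by
    simp only [Matrix.trace, Matrix.diag_apply, Matrix.mul_apply]
    refine (Finset.abs_sum_le_sum_abs _ _).trans (Finset.sum_le_sum fun i _ => ?_)
    refine (Finset.abs_sum_le_sum_abs _ _).trans (Finset.sum_le_sum fun j _ => ?_)
    rw [abs_mul]
    exact mul_le_mul (hα i j) (hβ j i) (abs_nonneg _) ((abs_nonneg _).trans (hα i j))
  refine h1.trans (le_of_eq ?_)
  simp only [Finset.sum_const, Finset.card_univ, nsmul_eq_mul]
  ring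

theorem abs_apply_le_one {z : r → ℝ} (hz : z ⬝ᵥ z = 1) (i : r) : |z i| ≤ 1 := by
  have h1 : z i * z i ≤ z ⬝ᵥ z :=
    Finset.single_le_sum (f := fun i => z i * z i) (fun j _ => mul_self_nonneg _)
      (Finset.mem_univ i)
  rw [hz] at h1
  exact abs_le_one_iff_mul_self_le_one.2 h1

theorem abs_vecMulVec_le_one {z : r → ℝ} (hz : z ⬝ᵥ z = 1) (i j : r) :
    |vecMulVec z z i j| ≤ 1 := by
  rw [vecMulVec_apply, abs_mul]
  exact mul_le_one₀ (abs_apply_le_one hz i) (abs_nonneg _) (abs_apply_le_one hz j)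

/-- The entries of a positive semidefinite matrix are bounded by its trace. -/
theorem PosSemidef.abs_apply_le_trace {V : Matrix r r ℝ} (hV : V.PosSemidef) (i j : r) :
    |V i j| ≤ V.trace := by
  classical
  obtain ⟨B, rfl⟩ := PosSemidef.exists_factor hV
  have htr : (B * Bᵀ).trace = ∑ a, ∑ l, B a l ^ 2 := by
    simp [Matrix.trace, Matrix.mul_apply, sq]
  have hi : ∀ i, ∑ l, B i l ^ 2 ≤ ∑ a, ∑ l, B a l ^ 2 := fun i =>
    Finset.single_le_sum (f := fun a => ∑ l, B a l ^ 2)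
      (fun a _ => Finset.sum_nonneg fun l _ => sq_nonneg _) (Finset.mem_univ i)
  rw [htr, Matrix.mul_apply]
  simp only [Matrix.transpose_apply]
  have h1 : |∑ l, B i l * B j l| ≤ ∑ l, (B i l ^ 2 + B j l ^ 2) / 2 := by
    refine (Finset.abs_sum_le_sum_abs _ _).trans (Finset.sum_le_sum fun l _ => ?_)
    rw [abs_mul, ← sq_abs (B i l), ← sq_abs (B j l)]
    nlinarith [sq_nonneg (|B i l| - |B j l|)]
  rw [← Finset.sum_div, Finset.sum_add_distrib] at h1
  linarith [hi i, hi j]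

theorem PosSemidef.mul_trace_le {V X : Matrix r r ℝ} {κ : ℝ} (hV : V.PosSemidef)
    (hX : ∀ x : r → ℝ, κ * (x ⬝ᵥ x) ≤ x ⬝ᵥ X *ᵥ x) : κ * V.trace ≤ (V * X).trace := by
  classical
  obtain ⟨B, rfl⟩ := PosSemidef.exists_factor hV
  have h1 := trace_mul_transpose_mul B 1
  rw [Matrix.mul_one] at h1
  rw [trace_mul_transpose_mul, h1, Finset.mul_sum]
  refine Finset.sum_le_sum fun l _ => ?_
  rw [Matrix.one_mulVec]
  exact hX _

/-- A positive semidefinite matrix `V` for which `tr (V M)` is small is close to a multiple of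
`z zᵀ`, when the quadratic form of `M` controls the component orthogonal to `z`. -/
theorem PosSemidef.sq_sub_vecMulVec_le {V M : Matrix r r ℝ} {z : r → ℝ} {c : ℝ}
    (hV : V.PosSemidef) (hz : z ⬝ᵥ z = 1) (hc : 0 ≤ c)
    (hM : ∀ x : r → ℝ, c * ((x - (z ⬝ᵥ x) • z) ⬝ᵥ (x - (z ⬝ᵥ x) • z)) ≤ x ⬝ᵥ M *ᵥ x) (i j : r) :
    c * (V i j - (z ⬝ᵥ V *ᵥ z) * vecMulVec z z i j) ^ 2 ≤ 9 * V.trace * (V * M).trace := by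
  classical
  obtain ⟨B, rfl⟩ := PosSemidef.exists_factor hV
  -- split every column of the factor `B` into its component `t z` along `z` and the rest `y`;
  -- then `c ∑ |y|² ≤ tr (V M)`, and every term of `V - (∑ t²) z zᵀ` contains some `y`
  set t : r → ℝ := fun l => z ⬝ᵥ Bᵀ l with ht
  set y : r → r → ℝ := fun l => Bᵀ l - t l • z with hy
  set F : ℝ := ∑ l, y l ⬝ᵥ y l with hF
  set a : ℝ := ∑ l, t l ^ 2 with ha
  have hzy : ∀ l, z ⬝ᵥ y l = 0 := fun l => by
    simp only [hy, dotProduct_sub, dotProduct_smul, hz, ht, smul_eq_mul, mul_one, sub_self]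
  have hB : ∀ l, Bᵀ l = y l + t l • z := fun l => by simp [hy]
  have hBi : ∀ i l, B i l = y l i + t l * z i := fun i l => by
    have := congrFun (hB l) i
    simpa using this
  have hzV : z ⬝ᵥ (B * Bᵀ) *ᵥ z = a := by
    rw [← mulVec_mulVec, dotProduct_mulVec, ← mulVec_transpose, dotProduct]
    refine Finset.sum_congr rfl fun l _ => ?_
    rw [sq, mulVec, dotProduct_comm]
  have htr : (B * Bᵀ).trace = F + a := by
    have h1 := trace_mul_transpose_mul B 1
    rw [Matrix.mul_one] at h1
    rw [h1, hF, ha, ← Finset.sum_add_distrib]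
    refine Finset.sum_congr rfl fun l _ => ?_
    rw [Matrix.one_mulVec, hB l, add_dotProduct, dotProduct_add, dotProduct_add, smul_dotProduct,
      smul_dotProduct, dotProduct_smul, dotProduct_smul, hz, hzy, dotProduct_comm (y l) z, hzy]
    simp [sq]
  have hyF : ∀ i, ∑ l, y l i ^ 2 ≤ F := fun i => by
    refine Finset.sum_le_sum fun l _ => ?_
    rw [sq]
    exact Finset.single_le_sum (f := fun i => y l i * y l i) (fun j _ => mul_self_nonneg _)
      (Finset.mem_univ i)
  have hF0 : 0 ≤ F := (Finset.sum_nonneg fun l _ => sq_nonneg _).trans (hyF i)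
  have ha0 : 0 ≤ a := Finset.sum_nonneg fun l _ => sq_nonneg _
  have hcF : c * F ≤ (B * Bᵀ * M).trace := by
    rw [trace_mul_transpose_mul, hF, Finset.mul_sum]
    exact Finset.sum_le_sum fun l _ => hM _
  have hexp : (B * Bᵀ) i j - a * vecMulVec z z i j
      = ∑ l, y l i * y l j + (∑ l, t l * y l i) * z j + (∑ l, t l * y l j) * z i := by
    rw [Matrix.mul_apply, ha, vecMulVec_apply, Finset.sum_mul, Finset.sum_mul, Finset.sum_mul,
      ← Finset.sum_sub_distrib, ← Finset.sum_add_distrib, ← Finset.sum_add_distrib]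
    refine Finset.sum_congr rfl fun l _ => ?_
    rw [Matrix.transpose_apply, hBi, hBi]; ring
  have hcs1 : (∑ l, y l i * y l j) ^ 2 ≤ F * F :=
    (Finset.sum_mul_sq_le_sq_mul_sq _ _ _).trans (mul_le_mul (hyF i) (hyF j)
      (Finset.sum_nonneg fun l _ => sq_nonneg _) hF0)
  have hcs2 : ∀ i, (∑ l, t l * y l i) ^ 2 ≤ a * F := fun i =>
    (Finset.sum_mul_sq_le_sq_mul_sq _ _ _).trans (mul_le_mul_of_nonneg_left (hyF i) ha0)
  have hz1 : ∀ i, z i ^ 2 ≤ 1 := fun i => by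
    have := abs_apply_le_one hz i
    rw [← sq_abs]; nlinarith [abs_nonneg (z i)]
  have hcs3 : ∀ i j, ((∑ l, t l * y l i) * z j) ^ 2 ≤ a * F := fun i j => by
    rw [mul_pow]
    calc _ ≤ (∑ l, t l * y l i) ^ 2 * 1 := mul_le_mul_of_nonneg_left (hz1 j) (sq_nonneg _)
      _ ≤ _ := by rw [mul_one]; exact hcs2 i
  have hsq : ((B * Bᵀ) i j - a * vecMulVec z z i j) ^ 2 ≤ 9 * ((F + a) * F) := by
    rw [hexp]
    have h3 : ∀ u v w : ℝ, (u + v + w) ^ 2 ≤ 3 * (u ^ 2 + v ^ 2 + w ^ 2) := fun u v w => by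
      nlinarith [sq_nonneg (u - v), sq_nonneg (v - w), sq_nonneg (u - w)]
    refine (h3 _ _ _).trans ?_
    have := hcs3 i j
    have := hcs3 j i
    nlinarith [mul_nonneg ha0 hF0, mul_nonneg hF0 hF0]
  rw [hzV, htr]
  calc c * ((B * Bᵀ) i j - a * vecMulVec z z i j) ^ 2 ≤ c * (9 * ((F + a) * F)) :=
        mul_le_mul_of_nonneg_left hsq hc
    _ = 9 * (F + a) * (c * F) := by ring
    _ ≤ _ := mul_le_mul_of_nonneg_left hcF (by positivity)

/-- The solution `(δ / zᵀ X z) z zᵀ` of the semidefinite program defining the optimal covariance. -/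
theorem isArgmax_vecMulVec {p : ℕ} {P X : Matrix (Fin p) (Fin p) ℝ} {μ c δ : ℝ} {z : Fin p → ℝ}
    (hδ : 0 ≤ δ) (hμ : 0 ≤ μ) (hc : 0 ≤ c) (hzX : 0 < z ⬝ᵥ X *ᵥ z)
    (hMz : (μ • X - P) *ᵥ z = 0)
    (hM : ∀ x : Fin p → ℝ, c * ((x - (z ⬝ᵥ x) • z) ⬝ᵥ (x - (z ⬝ᵥ x) • z))
        ≤ x ⬝ᵥ (μ • X - P) *ᵥ x) :
    IsArgmax P X δ ((δ / (z ⬝ᵥ X *ᵥ z)) • vecMulVec z z) := by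
  have hzP : z ⬝ᵥ P *ᵥ z = μ * (z ⬝ᵥ X *ᵥ z) := by
    have : z ⬝ᵥ (μ • X - P) *ᵥ z = 0 := by rw [hMz, dotProduct_zero]
    rw [sub_mulVec, smul_mulVec, dotProduct_sub, dotProduct_smul, smul_eq_mul] at this
    linarith
  have htr : ∀ N : Matrix (Fin p) (Fin p) ℝ, ((δ / (z ⬝ᵥ X *ᵥ z)) • vecMulVec z z * N).trace
      = δ / (z ⬝ᵥ X *ᵥ z) * (z ⬝ᵥ N *ᵥ z) := fun N => by
    rw [Matrix.smul_mul, trace_smul, trace_vecMulVec_mul, smul_eq_mul]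
  refine ⟨⟨posSemidef_smul_vecMulVec (by positivity) z, ?_⟩, fun V hV hVX => ?_⟩
  · rw [htr, div_mul_cancel₀ _ hzX.ne']
  · rw [htr, hzP]
    have h1 : (V * P).trace = μ * (V * X).trace - (V * (μ • X - P)).trace := by
      rw [Matrix.mul_sub, Matrix.mul_smul, trace_sub, trace_smul, smul_eq_mul]; ring
    have h2 : 0 ≤ (V * (μ • X - P)).trace := by
      have := PosSemidef.mul_trace_le (κ := 0) hV (X := μ • X - P) (fun x => by
        rw [zero_mul]
        refine le_trans (mul_nonneg hc ?_) (hM x)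
        exact Finset.sum_nonneg fun i _ => mul_self_nonneg _)
      rwa [zero_mul] at this
    have h3 : μ * (V * X).trace ≤ μ * δ := mul_le_mul_of_nonneg_left hVX hμ
    have h4 : δ / (z ⬝ᵥ X *ᵥ z) * (μ * (z ⬝ᵥ X *ᵥ z)) = μ * δ := by field_simp
    rw [h4, h1]
    linarith

/-- The solutions of the problems with data `(P', X')` near `(P, X)` are close to `U`, at a rate
linear in the perturbation `e` of the data. It is not part of the notion that `U` itself solves the
problem with data `(P, X)`. -/
def IsLipschitzOptimum {p : ℕ} (P X : Matrix (Fin p) (Fin p) ℝ) (δ : ℝ)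
    (U : Matrix (Fin p) (Fin p) ℝ) : Prop :=
  ∃ C e₀ : ℝ, 0 < e₀ ∧ ∀ (P' X' V : Matrix (Fin p) (Fin p) ℝ) (e : ℝ), e ≤ e₀ →
    (∀ i j, |(P' - P) i j| ≤ e) → (∀ i j, |(X' - X) i j| ≤ e) → IsArgmax P' X' δ V →
    ∀ i j, |(V - U) i j| ≤ C * e

set_option maxHeartbeats 400000 in
/-- The maximizer of `tr (V P')` over `V ≥ 0`, `tr (V X') ≤ δ` is a Lipschitz function of the data
`(P', X')` near a pencil `(P, X)` with a spectral gap. With `D = V - b z zᵀ`, where `b z zᵀ` is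
feasible with equality, optimality gives `tr (V (μ X - P)) ≤ |tr (D E)|` for the perturbation `E`,
while the gap bounds `‖D‖²` by a multiple of `tr (V (μ X - P))`. -/
theorem IsArgmax.lipschitz {p : ℕ} {P X : Matrix (Fin p) (Fin p) ℝ} {μ c κ δ : ℝ} {z : Fin p → ℝ}
    (hδ : 0 < δ) (hμ : 0 < μ) (hc : 0 < c) (hκ : 0 < κ) (hz : z ⬝ᵥ z = 1)
    (hXκ : ∀ x : Fin p → ℝ, κ * (x ⬝ᵥ x) ≤ x ⬝ᵥ X *ᵥ x)
    (hMz : (μ • X - P) *ᵥ z = 0)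
    (hM : ∀ x : Fin p → ℝ, c * ((x - (z ⬝ᵥ x) • z) ⬝ᵥ (x - (z ⬝ᵥ x) • z))
        ≤ x ⬝ᵥ (μ • X - P) *ᵥ x) :
    IsLipschitzOptimum P X δ ((δ / (z ⬝ᵥ X *ᵥ z)) • vecMulVec z z) := by
  unfold IsLipschitzOptimum
  set d : ℝ := (p : ℝ) ^ 2 with hd
  have hd0 : 0 ≤ d := sq_nonneg _
  set x₀ : ℝ := z ⬝ᵥ X *ᵥ z with hx₀
  have hx₀κ : κ ≤ x₀ := by have := hXκ z; rwa [hz, mul_one] at this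
  have hx₀pos : 0 < x₀ := hκ.trans_le hx₀κ
  have hzP : z ⬝ᵥ P *ᵥ z = μ * x₀ := by
    have : z ⬝ᵥ (μ • X - P) *ᵥ z = 0 := by rw [hMz, dotProduct_zero]
    rw [sub_mulVec, smul_mulVec, dotProduct_sub, dotProduct_smul, smul_eq_mul] at this
    linarith
  -- `T` bounds the trace of a maximizer, `Xm` the entries of `X'`, and `L` converts a bound on the
  -- component of `V` off `z zᵀ` into one on `D`
  set T : ℝ := 2 * δ / κ with hT
  set Xm : ℝ := ∑ i, ∑ j, |X i j| + 1 with hXm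
  set L : ℝ := 1 + 2 / κ * (d * Xm) with hL
  have hXm0 : 0 ≤ Xm := by
    have : 0 ≤ ∑ i, ∑ j, |X i j| :=
      Finset.sum_nonneg fun i _ => Finset.sum_nonneg fun j _ => abs_nonneg _
    linarith
  have hT0 : 0 < T := by positivity
  have hL0 : 0 < L := by positivity
  set Ch : ℝ := 9 * T / c * ((1 + μ) * (d * L)) with hCh
  refine ⟨L * Ch + δ * d * (2 / κ ^ 2), min 1 (min (κ / (2 * (d + 1))) (μ * κ / (2 * (d + 1)))),
    by positivity, ?_⟩
  intro P' X' V e he hP' hX' hV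
  obtain ⟨⟨hVpsd, hVfeas⟩, hVmax⟩ := hV
  have he1 : e ≤ 1 := he.trans (min_le_left _ _)
  have he2 : d * e ≤ κ / 2 := by
    have h1 : e ≤ κ / (2 * (d + 1)) := he.trans ((min_le_right _ _).trans (min_le_left _ _))
    calc d * e ≤ d * (κ / (2 * (d + 1))) := by gcongr
      _ = (d / (d + 1)) * (κ / 2) := by field_simp
      _ ≤ 1 * (κ / 2) := by
        gcongr
        rw [div_le_one (by positivity)]; linarith
      _ = κ / 2 := one_mul _
  have he3 : d * e < μ * κ := by
    have h1 : e ≤ μ * κ / (2 * (d + 1)) := he.trans ((min_le_right _ _).trans (min_le_right _ _))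
    calc d * e ≤ d * (μ * κ / (2 * (d + 1))) := by gcongr
      _ = (d / (d + 1)) * (μ * κ / 2) := by field_simp
      _ ≤ 1 * (μ * κ / 2) := by
        gcongr
        rw [div_le_one (by positivity)]; linarith
      _ < μ * κ := by have := mul_pos hμ hκ; linarith
  rcases Nat.eq_zero_or_pos p with rfl | hp
  · intro i; exact i.elim0
  have he0 : 0 ≤ e := (abs_nonneg _).trans (hP' ⟨0, hp⟩ ⟨0, hp⟩)
  have hcard : ((Fintype.card (Fin p) : ℕ) : ℝ) ^ 2 = d := by simp [hd]
  have htrace : ∀ {A B : Matrix (Fin p) (Fin p) ℝ} {α β : ℝ}, (∀ i j, |A i j| ≤ α) →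
      (∀ i j, |B i j| ≤ β) → |(A * B).trace| ≤ d * (α * β) := fun hα hβ => by
    have := abs_trace_mul_le hα hβ
    rwa [hcard] at this
  have hzE : ∀ {E : Matrix (Fin p) (Fin p) ℝ}, (∀ i j, |E i j| ≤ e) → |z ⬝ᵥ E *ᵥ z| ≤ d * e :=
    fun {E} hE => by
    have := htrace (A := vecMulVec z z) (abs_vecMulVec_le_one hz) hE
    rwa [trace_vecMulVec_mul, one_mul] at this
  -- boundedness of the maximizer
  have hVT : V.trace ≤ T := by
    have h1 := PosSemidef.mul_trace_le hVpsd hXκ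
    have h2 := htrace (PosSemidef.abs_apply_le_trace hVpsd) hX'
    rw [Matrix.mul_sub, trace_sub] at h2
    have h3 := (abs_le.1 h2).1
    have h4 : 0 ≤ V.trace := hVpsd.trace_nonneg
    have h5 : d * (V.trace * e) ≤ κ / 2 * V.trace := by nlinarith
    rw [hT, le_div_iff₀ hκ]
    linarith
  -- the comparison matrix `b z zᵀ`
  set x' : ℝ := z ⬝ᵥ X' *ᵥ z with hx'
  have hxx : |x' - x₀| ≤ d * e := by
    have := hzE hX'
    rwa [sub_mulVec, dotProduct_sub] at this
  have hx'κ : κ / 2 ≤ x' := by have := (abs_le.1 hxx).1; linarith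
  have hx'pos : 0 < x' := by linarith
  set b : ℝ := δ / x' with hb
  have hb0 : 0 ≤ b := by positivity
  have hbtr : ∀ N : Matrix (Fin p) (Fin p) ℝ, (b • vecMulVec z z * N).trace
      = b * (z ⬝ᵥ N *ᵥ z) := fun N => by
    rw [Matrix.smul_mul, trace_smul, trace_vecMulVec_mul, smul_eq_mul]
  have hbx : b * x' = δ := div_mul_cancel₀ _ hx'pos.ne'
  have hopt := hVmax (b • vecMulVec z z) (posSemidef_smul_vecMulVec hb0 z)
    (by rw [hbtr, ← hx', hbx])
  have hzP' : 0 < z ⬝ᵥ P' *ᵥ z := by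
    have h1 := hzE hP'
    rw [sub_mulVec, dotProduct_sub, hzP] at h1
    have h2 := (abs_le.1 h1).1
    have h3 : μ * κ ≤ μ * x₀ := by gcongr
    linarith
  -- the constraint is active at a maximizer
  have hactive : (V * X').trace = δ := by
    refine le_antisymm hVfeas (le_of_not_gt fun hlt => ?_)
    have h1 := hVmax (V + ((δ - (V * X').trace) / x') • vecMulVec z z)
      (hVpsd.add (posSemidef_smul_vecMulVec (div_nonneg (by linarith) hx'pos.le) z)) (by
        rw [Matrix.add_mul, trace_add, Matrix.smul_mul, trace_smul, trace_vecMulVec_mul,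
          smul_eq_mul, ← hx', div_mul_cancel₀ _ hx'pos.ne']
        linarith)
    rw [Matrix.add_mul, trace_add, Matrix.smul_mul, trace_smul, trace_vecMulVec_mul,
      smul_eq_mul] at h1
    have h2 : 0 < (δ - (V * X').trace) / x' * (z ⬝ᵥ P' *ᵥ z) :=
      mul_pos (div_pos (by linarith) hx'pos) hzP'
    linarith
  set M := μ • X - P with hMdef
  set D := V - b • vecMulVec z z with hD
  have hDX' : (D * X').trace = 0 := by
    rw [hD, Matrix.sub_mul, trace_sub, hbtr, ← hx', hbx, hactive, sub_self]
  have hDM : (D * M).trace = (V * M).trace := by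
    rw [hD, Matrix.sub_mul, trace_sub, hbtr, hMz, dotProduct_zero, mul_zero, sub_zero]
  have hDP' : 0 ≤ (D * P').trace := by
    rw [hD, Matrix.sub_mul, trace_sub]
    linarith
  -- `h` bounds the component of `V` off `z zᵀ`
  set h : ℝ := √(9 * T / c * (V * M).trace) with hh
  have hVM0 : 0 ≤ (V * M).trace := by
    have := PosSemidef.mul_trace_le (κ := 0) hVpsd (X := M) (fun x => by
      rw [zero_mul]
      refine le_trans (mul_nonneg hc.le ?_) (hM x)
      exact Finset.sum_nonneg fun i _ => mul_self_nonneg _)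
    rwa [zero_mul] at this
  have hh0 : 0 ≤ h := Real.sqrt_nonneg _
  have hhsq : h ^ 2 = 9 * T / c * (V * M).trace := Real.sq_sqrt (by positivity)
  set a : ℝ := z ⬝ᵥ V *ᵥ z with ha
  have hoff : ∀ i j, |(V - a • vecMulVec z z) i j| ≤ h := by
    intro i j
    have h1 := PosSemidef.sq_sub_vecMulVec_le hVpsd hz hc.le hM i j
    refine Real.abs_le_sqrt ?_
    have h2 : (V i j - a * vecMulVec z z i j) ^ 2 ≤ 9 * V.trace * (V * M).trace / c := by
      rw [le_div_iff₀ hc]; linarith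
    rw [Matrix.sub_apply, Matrix.smul_apply, smul_eq_mul]
    refine h2.trans ?_
    rw [div_mul_eq_mul_div]
    gcongr
  have hX'm : ∀ i j, |X' i j| ≤ Xm := fun i j => by
    have h1 : |X i j| ≤ ∑ i, ∑ j, |X i j| :=
      (Finset.single_le_sum (f := fun j => |X i j|) (fun j _ => abs_nonneg _)
        (Finset.mem_univ j)).trans
      (Finset.single_le_sum (f := fun i => ∑ j, |X i j|)
        (fun i _ => Finset.sum_nonneg fun j _ => abs_nonneg _) (Finset.mem_univ i))
    have h2 := hX' i j
    have h3 : |X' i j| ≤ |X i j| + |(X' - X) i j| := by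
      have := abs_add_le (X i j) ((X' - X) i j)
      simpa using this
    linarith
  have hab : |a - b| ≤ 2 / κ * (d * Xm) * h := by
    have h1 : (a - b) * x' = -((V - a • vecMulVec z z) * X').trace := by
      have h2 : ((V - a • vecMulVec z z) * X').trace = δ - a * x' := by
        rw [Matrix.sub_mul, trace_sub, Matrix.smul_mul, trace_smul, trace_vecMulVec_mul,
          smul_eq_mul, hactive]
      rw [h2, sub_mul, hbx]; ring
    have h3 := htrace hoff hX'm
    rw [← abs_neg, ← h1, abs_mul, abs_of_pos hx'pos] at h3
    have h4 : |a - b| * (κ / 2) ≤ d * (h * Xm) :=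
      (mul_le_mul_of_nonneg_left hx'κ (abs_nonneg _)).trans h3
    calc |a - b| = 2 / κ * (|a - b| * (κ / 2)) := by field_simp
      _ ≤ 2 / κ * (d * (h * Xm)) := by gcongr
      _ = _ := by ring
  have hDh : ∀ i j, |D i j| ≤ L * h := by
    intro i j
    have h1 : D i j = (V - a • vecMulVec z z) i j + (a - b) * vecMulVec z z i j := by
      simp only [hD, Matrix.sub_apply, Matrix.smul_apply, smul_eq_mul]; ring
    rw [h1]
    refine (abs_add_le _ _).trans ?_
    have h2 : |(a - b) * vecMulVec z z i j| ≤ |a - b| * 1 := by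
      rw [abs_mul]
      exact mul_le_mul_of_nonneg_left (abs_vecMulVec_le_one hz i j) (abs_nonneg _)
    have := hoff i j
    rw [hL]
    linarith
  -- optimality: up to the perturbation, `tr (D M)` is `-tr (D P') ≤ 0`
  have hVMle : (V * M).trace ≤ (1 + μ) * (d * (L * h * e)) := by
    have h1 : (V * M).trace = -μ * (D * (X' - X)).trace + (D * (P' - P)).trace
        - (D * P').trace := by
      rw [← hDM, hMdef]
      simp only [Matrix.mul_sub, Matrix.mul_smul, trace_sub, trace_smul, smul_eq_mul, hDX']
      ring
    have h2 := htrace hDh hX'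
    have h3 := htrace hDh hP'
    have h4 := (abs_le.1 h2).1
    have h5 := (abs_le.1 h3).2
    have h6 := mul_le_mul_of_nonneg_left h4 hμ.le
    have h7 : (1 + μ) * (d * (L * h * e)) = d * (L * h * e) - μ * -(d * (L * h * e)) := by ring
    rw [h1, h7]
    linarith
  -- hence `h² ≤ Ch e h`
  have hhe : h ≤ Ch * e := by
    rcases hh0.eq_or_lt with h0 | h0
    · rw [← h0]; positivity
    · have h1 : h ^ 2 ≤ Ch * e * h := by
        rw [hhsq]
        calc 9 * T / c * (V * M).trace ≤ 9 * T / c * ((1 + μ) * (d * (L * h * e))) := by gcongr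
          _ = Ch * e * h := by rw [hCh]; ring
      rw [sq] at h1
      exact le_of_mul_le_mul_right h1 h0
  have hbb : |b - δ / x₀| ≤ δ * d * (2 / κ ^ 2) * e := by
    have h1 : b - δ / x₀ = δ * (x₀ - x') / (x' * x₀) := by
      rw [hb]; field_simp
    rw [h1, abs_div, abs_mul, abs_of_pos hδ, abs_sub_comm, abs_of_pos (mul_pos hx'pos hx₀pos),
      div_le_iff₀ (mul_pos hx'pos hx₀pos)]
    have h2 : κ / 2 * κ ≤ x' * x₀ := mul_le_mul hx'κ hx₀κ hκ.le hx'pos.le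
    calc δ * |x' - x₀| ≤ δ * (d * e) := by gcongr
      _ = δ * d * (2 / κ ^ 2) * e * (κ / 2 * κ) := by field_simp
      _ ≤ _ := by gcongr
  intro i j
  have h1 : (V - (δ / x₀) • vecMulVec z z) i j = D i j + (b - δ / x₀) * vecMulVec z z i j := by
    simp only [hD, Matrix.sub_apply, Matrix.smul_apply, smul_eq_mul]; ring
  rw [h1]
  refine (abs_add_le _ _).trans ?_
  have h2 : |(b - δ / x₀) * vecMulVec z z i j| ≤ |b - δ / x₀| * 1 := by
    rw [abs_mul]
    exact mul_le_mul_of_nonneg_left (abs_vecMulVec_le_one hz i j) (abs_nonneg _)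
  have h3 : L * h ≤ L * (Ch * e) := by gcongr
  have h4 := hDh i j
  linarith

end Optimal

/-! ### The modes of the system -/

section Modes

theorem toC_apply {r s : Type*} (M : Matrix r s ℝ) (i : r) (j : s) : toC M i j = (M i j : ℂ) := rfl

theorem toC_mul {r s t : Type*} [Fintype s] (M : Matrix r s ℝ) (N : Matrix s t ℝ) :
    toC (M * N) = toC M * toC N :=
  Matrix.map_mul (f := Complex.ofRealHom)

theorem toC_one {r : Type*} [DecidableEq r] : toC (1 : Matrix r r ℝ) = 1 :=
  Matrix.map_one _ Complex.ofReal_zero Complex.ofReal_one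

theorem toC_pow {r : Type*} [Fintype r] [DecidableEq r] (M : Matrix r r ℝ) (k : ℕ) :
    toC (M ^ k) = toC M ^ k := by
  induction k with
  | zero => rw [pow_zero, pow_zero, toC_one]
  | succ k ih => rw [pow_succ, pow_succ, toC_mul, ih]

theorem isUnit_det_of_rank_eq_card {r : Type*} [Fintype r] [DecidableEq r] {M : Matrix r r ℝ}
    (h : M.rank = Fintype.card r) : IsUnit M.det := by
  rw [← Matrix.isUnit_iff_isUnit_det, ← Matrix.mulVec_surjective_iff_isUnit]
  have h1 : LinearMap.range M.mulVecLin = ⊤ := by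
    apply Submodule.eq_top_of_finrank_eq
    rw [Module.finrank_fintype_fun_eq_card]
    exact h
  exact LinearMap.range_eq_top.1 h1

/-- A real matrix of full column rank has a left inverse. -/
theorem exists_left_inverse_of_rank {r s : Type*} [Fintype r] [Fintype s] [DecidableEq s]
    {M : Matrix r s ℝ} (h : M.rank = Fintype.card s) : ∃ L : Matrix s r ℝ, L * M = 1 := by
  have h1 : IsUnit (Mᵀ * M).det :=
    isUnit_det_of_rank_eq_card (by rw [Matrix.rank_transpose_mul_self, h])
  exact ⟨(Mᵀ * M)⁻¹ * Mᵀ, by rw [Matrix.mul_assoc, Matrix.nonsing_inv_mul _ h1]⟩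

variable {n m p : ℕ}

/-- The spectral decomposition of the system matrix: its distinct eigenvalues `ev i` and the
associated spectral projections `E i`. -/
structure IsModal (A : Matrix (Fin n) (Fin n) ℝ) (ev : Fin (numEigenvalues A) → ℂ)
    (E : Fin (numEigenvalues A) → Matrix (Fin n) (Fin n) ℂ) : Prop where
  injective : Function.Injective ev
  mem_spectrum : ∀ i, ev i ∈ spectrum ℂ (toC A)
  mul_proj : ∀ i, toC A * E i = ev i • E i
  proj_mul : ∀ i, E i * toC A = ev i • E i
  sum_proj : ∑ i, E i = 1
  proj_ne_zero : ∀ i, E i ≠ 0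

/-- A diagonalizable matrix has a spectral decomposition: in a basis of eigenvectors, the projection
of an eigenvalue is the diagonal indicator matrix of its occurrences. -/
theorem exists_isModal {A : Matrix (Fin n) (Fin n) ℝ} (hA : Diagonalizable A) :
    ∃ ev E, IsModal A ev E := by
  classical
  obtain ⟨T, hT, hdiag⟩ := hA
  set d : Fin n → ℂ := fun a => (T⁻¹ * toC A * T) a a with hd
  have hD : T⁻¹ * toC A * T = diagonal d := by
    rw [← hdiag.diagonal_diag]; rfl
  have hAT : toC A * T = T * diagonal d := by
    rw [← hD, Matrix.mul_assoc, ← Matrix.mul_assoc, Matrix.mul_nonsing_inv _ hT, Matrix.one_mul]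
  have hTA : T⁻¹ * toC A = diagonal d * T⁻¹ := by
    rw [← hD, Matrix.mul_assoc, Matrix.mul_nonsing_inv _ hT, Matrix.mul_one]
  have hspec : spectrum ℂ (toC A) = Set.range d := by
    rw [← spectrum_diagonal, ← hD]
    have hTu : IsUnit T := (Matrix.isUnit_iff_isUnit_det T).2 hT
    obtain ⟨u, rfl⟩ := hTu
    rw [← Matrix.coe_units_inv, spectrum.units_conjugate']
  have hcard : Nat.card (spectrum ℂ (toC A)) = numEigenvalues A := by
    rw [numEigenvalues, Nat.card_coe_set_eq]
  have hfin : Finite (spectrum ℂ (toC A)) := by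
    rw [hspec]; exact Set.finite_range d
  set e := (Finite.equivFinOfCardEq hcard).symm with he
  set E : Fin (numEigenvalues A) → Matrix (Fin n) (Fin n) ℂ := fun i =>
    T * diagonal (fun a => if d a = (e i : ℂ) then 1 else 0) * T⁻¹ with hE
  have hdd : ∀ i, diagonal d * diagonal (fun a => if d a = (e i : ℂ) then (1 : ℂ) else 0)
      = (e i : ℂ) • diagonal (fun a => if d a = (e i : ℂ) then (1 : ℂ) else 0) := by
    intro i
    rw [diagonal_mul_diagonal, ← diagonal_smul]
    congr 1
    funext a
    by_cases h : d a = (e i : ℂ) <;> simp [h]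
  refine ⟨fun i => e i, E, ?_, fun i => (e i).2, fun i => ?_, fun i => ?_, ?_, fun i h0 => ?_⟩
  · exact Subtype.val_injective.comp e.injective
  · simp only [hE]
    rw [← Matrix.mul_assoc, ← Matrix.mul_assoc, hAT, Matrix.mul_assoc T, hdd, Matrix.mul_smul,
      Matrix.smul_mul]
  · simp only [hE]
    rw [Matrix.mul_assoc, hTA, ← Matrix.mul_assoc, Matrix.mul_assoc T, diagonal_mul_diagonal]
    have := hdd i
    rw [diagonal_mul_diagonal] at this
    simp only [mul_comm] at this ⊢
    rw [this, Matrix.mul_smul, Matrix.smul_mul]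
  · simp only [hE]
    rw [← Finset.sum_mul, ← Finset.mul_sum]
    have : ∑ i, diagonal (fun a => if d a = (e i : ℂ) then (1 : ℂ) else 0)
        = (1 : Matrix (Fin n) (Fin n) ℂ) := by
      ext a b
      rw [Matrix.sum_apply]
      by_cases hab : a = b
      · subst hab
        simp only [diagonal_apply_eq, one_apply_eq]
        have hmem : d a ∈ spectrum ℂ (toC A) := by rw [hspec]; exact ⟨a, rfl⟩
        rw [Finset.sum_eq_single (e.symm ⟨d a, hmem⟩)]
        · simp
        · intro i _ hi
          rw [if_neg]
          intro h
          apply hi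
          rw [Equiv.eq_symm_apply]
          exact Subtype.ext h.symm
        · simp
      · simp [diagonal_apply_ne _ hab, one_apply_ne hab]
    rw [this, Matrix.mul_one, Matrix.mul_nonsing_inv _ hT]
  · have hmem : (e i : ℂ) ∈ Set.range d := hspec ▸ (e i).2
    obtain ⟨a, ha⟩ := hmem
    have h1 : T⁻¹ * E i * T = diagonal (fun a => if d a = (e i : ℂ) then (1 : ℂ) else 0) := by
      simp only [hE]
      rw [Matrix.mul_assoc, Matrix.mul_assoc _ T⁻¹, Matrix.nonsing_inv_mul _ hT, Matrix.mul_one,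
        ← Matrix.mul_assoc, Matrix.nonsing_inv_mul _ hT, Matrix.one_mul]
    rw [h0, Matrix.mul_zero, Matrix.zero_mul] at h1
    have := congrFun (congrFun h1 a) a
    simp [ha] at this

/-- The residues `C E_i B` of the transfer function. -/
def residue (S : LinSys n m p) (E : Fin (numEigenvalues S.A) → Matrix (Fin n) (Fin n) ℂ)
    (i : Fin (numEigenvalues S.A)) : Matrix (Fin m) (Fin p) ℂ := toC S.C * E i * toC S.B

namespace IsModal

variable {S : LinSys n m p} {ev : Fin (numEigenvalues S.A) → ℂ}
  {E : Fin (numEigenvalues S.A) → Matrix (Fin n) (Fin n) ℂ}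

theorem pow_mul_proj (h : IsModal S.A ev E) (k : ℕ) (i) :
    toC S.A ^ k * E i = ev i ^ k • E i := by
  induction k with
  | zero => simp
  | succ k ih => rw [pow_succ, Matrix.mul_assoc, h.mul_proj, Matrix.mul_smul, ih, smul_smul,
      pow_succ, mul_comm]

theorem proj_mul_pow (h : IsModal S.A ev E) (k : ℕ) (i) :
    E i * toC S.A ^ k = ev i ^ k • E i := by
  induction k with
  | zero => simp
  | succ k ih => rw [pow_succ', ← Matrix.mul_assoc, h.proj_mul, Matrix.smul_mul, ih, smul_smul,
      pow_succ, mul_comm]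

theorem toC_pow_eq (h : IsModal S.A ev E) (k : ℕ) : toC S.A ^ k = ∑ i, ev i ^ k • E i := by
  rw [← Matrix.mul_one (toC S.A ^ k), ← h.sum_proj, Finset.mul_sum]
  exact Finset.sum_congr rfl fun i _ => h.pow_mul_proj k i

theorem toC_H (h : IsModal S.A ev E) (k : ℕ) :
    toC (S.H k) = ∑ i, ev i ^ k • residue S E i := by
  rw [LinSys.H, toC_mul, toC_mul, toC_pow, h.toC_pow_eq, Matrix.mul_sum, Matrix.sum_mul]
  refine Finset.sum_congr rfl fun i _ => ?_
  rw [residue, Matrix.mul_smul, Matrix.smul_mul]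

theorem H_apply (h : IsModal S.A ev E) (k : ℕ) (a : Fin m) (b : Fin p) :
    (S.H k a b : ℂ) = ∑ i, ev i ^ k * residue S E i a b := by
  rw [← toC_apply, h.toC_H, Matrix.sum_apply]
  rfl

/-- Every mode of a controllable and observable system is excited and seen. -/
theorem residue_ne_zero (h : IsModal S.A ev E) (hobs : Observable S.A S.C)
    (hctr : Controllable S.A S.B) (i) : residue S E i ≠ 0 := by
  intro h0
  obtain ⟨L, hL⟩ := exists_left_inverse_of_rank (hobs.trans (Fintype.card_fin n).symm)
  rw [Controllable, ← Matrix.rank_transpose] at hctr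
  obtain ⟨L', hL'⟩ := exists_left_inverse_of_rank (hctr.trans (Fintype.card_fin n).symm)
  set O := Matrix.of fun (i : Fin n × Fin m) (j : Fin n) => (S.C * S.A ^ (i.1 : ℕ)) i.2 j with hO
  set K := Matrix.of fun (i : Fin n) (j : Fin n × Fin p) => (S.A ^ (j.1 : ℕ) * S.B) i j.2 with hK
  have hOEK : toC O * E i * toC K = 0 := by
    ext a b
    have h1 : (toC O * E i * toC K) a b
        = (toC (S.C * S.A ^ (a.1 : ℕ)) * E i * toC (S.A ^ (b.1 : ℕ) * S.B)) a.2 b.2 := by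
      simp only [Matrix.mul_apply, toC_apply, hO, hK, Matrix.of_apply]
    rw [h1, toC_mul, toC_mul, toC_pow, toC_pow, Matrix.mul_assoc (toC S.C), h.pow_mul_proj,
      Matrix.mul_smul, Matrix.smul_mul, ← Matrix.mul_assoc, Matrix.mul_assoc (toC S.C),
      h.proj_mul_pow, Matrix.mul_smul, Matrix.smul_mul]
    rw [residue] at h0
    rw [h0]
    simp
  have hK' : K * L'ᵀ = 1 := by
    have := congrArg Matrix.transpose hL'
    rwa [Matrix.transpose_mul, Matrix.transpose_transpose, Matrix.transpose_one] at this
  apply h.proj_ne_zero i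
  calc E i = toC (L * O) * E i * toC (K * L'ᵀ) := by
        rw [hL, hK', toC_one, Matrix.one_mul, Matrix.mul_one]
    _ = toC L * (toC O * E i * toC K) * toC L'ᵀ := by
        rw [toC_mul, toC_mul]; simp only [Matrix.mul_assoc]
    _ = 0 := by rw [hOEK, Matrix.mul_zero, Matrix.zero_mul]

/-- A linear relation between consecutive blocks of Markov parameters is satisfied by the
corresponding polynomial at every eigenvalue. -/
theorem eval_eq_zero_of_sum_H (h : IsModal S.A ev E) (hobs : Observable S.A S.C)
    (hctr : Controllable S.A S.B) {ι : Type*} (t : Finset ι) (c : ι → ℂ) (e : ι → ℕ)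
    (hc : ∀ s < numEigenvalues S.A, ∀ a b, ∑ i ∈ t, c i * (S.H (e i + s) a b : ℂ) = 0) (j) :
    ∑ i ∈ t, c i * ev j ^ e i = 0 := by
  obtain ⟨a, b, hab⟩ : ∃ a b, residue S E j a b ≠ 0 := by
    by_contra! hcon
    exact h.residue_ne_zero hobs hctr j (by ext a b; exact hcon a b)
  have h1 := Matrix.eq_zero_of_forall_pow_sum_mul_pow_eq_zero
    (v := fun j => (∑ i ∈ t, c i * ev j ^ e i) * residue S E j a b) h.injective (fun s => by
      rw [← hc s s.2 a b]
      simp only [h.H_apply, Finset.mul_sum, Finset.sum_mul]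
      rw [Finset.sum_comm]
      refine Finset.sum_congr rfl fun i _ => Finset.sum_congr rfl fun j _ => ?_
      rw [pow_add]; ring)
  exact (mul_eq_zero.1 (congrFun h1 j)).resolve_right hab

end IsModal

/-- The entries of the Gram matrix. -/
theorem trace_stack (q : ℕ) (G : ℕ → Matrix (Fin m) (Fin p) ℝ) (i j : ℕ) :
    ((stack q G i)ᵀ * stack q G j).trace
      = ∑ b, ∑ s : Fin (2 * q - 1) × Fin m, G (i + s.1) s.2 b * G (j + s.1) s.2 b := by
  simp only [Matrix.trace, Matrix.diag_apply, Matrix.mul_apply, Matrix.transpose_apply, stack,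
    Matrix.of_apply]

theorem numEigenvalues_pos {A : Matrix (Fin n) (Fin n) ℝ} (hn : 0 < n) : 0 < numEigenvalues A := by
  have : Nonempty (Fin n) := ⟨⟨0, hn⟩⟩
  rw [numEigenvalues, Set.ncard_pos (Matrix.finite_spectrum _)]
  exact spectrum.nonempty_of_isAlgClosed_of_finiteDimensional ℂ _

namespace IsModal

variable {S : LinSys n m p} {ev : Fin (numEigenvalues S.A) → ℂ}
  {E : Fin (numEigenvalues S.A) → Matrix (Fin n) (Fin n) ℂ}

/-- The Gram matrix is `F Fᵀ` for a matrix `F` of Markov parameters. A kernel vector consists of the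
coefficients of a polynomial of degree less than the number of eigenvalues which vanishes at all of
them, so it is zero. -/
theorem isUnit_gram (h : IsModal S.A ev E) (hobs : Observable S.A S.C)
    (hctr : Controllable S.A S.B) : IsUnit (gram (numEigenvalues S.A) S.H).det := by
  rw [← Matrix.isUnit_iff_isUnit_det, ← Matrix.mulVec_injective_iff_isUnit]
  intro c c' hcc
  rw [← sub_eq_zero]
  set v := c - c' with hv
  have hgv : gram (numEigenvalues S.A) S.H *ᵥ v = 0 := by
    rw [hv, mulVec_sub, sub_eq_zero]; exact hcc
  set F : Matrix (Fin (numEigenvalues S.A)) (Fin p × Fin (2 * numEigenvalues S.A - 1) × Fin m) ℝ :=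
    Matrix.of fun i s => S.H (i + s.2.1) s.2.2 s.1 with hF
  have hgF : gram (numEigenvalues S.A) S.H = F * Fᵀ := by
    ext i j
    simp only [gram, Matrix.of_apply, trace_stack, Matrix.mul_apply, hF, Matrix.transpose_apply]
    rw [Fintype.sum_prod_type]
  have hFv : Fᵀ *ᵥ v = 0 := by
    rw [← dotProduct_self_eq_zero, dotProduct_mulVec, vecMul_transpose, mulVec_mulVec, ← hgF, hgv,
      zero_dotProduct]
  have h1 := fun j => h.eval_eq_zero_of_sum_H hobs hctr Finset.univ (fun i => (v i : ℂ))
    (fun i => (i : ℕ)) (fun s hs a b => by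
      have h2 := congrFun hFv (b, ⟨s, by omega⟩, a)
      simp only [mulVec, dotProduct, Matrix.transpose_apply, hF, Matrix.of_apply,
        Pi.zero_apply] at h2
      have h3 := congrArg (fun x : ℝ => (x : ℂ)) h2
      simp only [Complex.ofReal_sum, Complex.ofReal_mul, Complex.ofReal_zero] at h3
      rw [← h3]
      exact Finset.sum_congr rfl fun i _ => mul_comm _ _) j
  have h4 := Matrix.eq_zero_of_forall_index_sum_mul_pow_eq_zero
    (v := fun i => (v i : ℂ)) h.injective h1
  funext i
  exact Complex.ofReal_eq_zero.1 (congrFun h4 i)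

/-- With the exact Markov parameters, the estimated polynomial vanishes at the eigenvalues: the
coefficients of the polynomial with these roots solve the same normal equations. -/
theorem eval_coeffEst (h : IsModal S.A ev E) (hobs : Observable S.A S.C)
    (hctr : Controllable S.A S.B) (j) :
    ev j ^ numEigenvalues S.A
      + ∑ i, (coeffEst (numEigenvalues S.A) S.H i : ℂ) * ev j ^ (i : ℕ) = 0 := by
  set α := coeffEst (numEigenvalues S.A) S.H with hα
  have hgu := h.isUnit_gram hobs hctr
  -- the coefficients `a` of the polynomial with roots `ev`
  obtain ⟨a, ha⟩ : ∃ a : Fin (numEigenvalues S.A) → ℂ,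
      ∀ j, ∑ i, a i * ev j ^ (i : ℕ) = -ev j ^ numEigenvalues S.A := by
    have hV : IsUnit (Matrix.vandermonde ev).det :=
      isUnit_iff_ne_zero.2 (Matrix.det_vandermonde_ne_zero_iff.2 h.injective)
    refine ⟨(Matrix.vandermonde ev)⁻¹ *ᵥ fun j => -ev j ^ numEigenvalues S.A, fun j => ?_⟩
    have := congrFun (show Matrix.vandermonde ev *ᵥ ((Matrix.vandermonde ev)⁻¹ *ᵥ
      fun j => -ev j ^ numEigenvalues S.A) = fun j => -ev j ^ numEigenvalues S.A by
        rw [mulVec_mulVec, Matrix.mul_nonsing_inv _ hV, one_mulVec]) j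
    rw [← this]
    exact Finset.sum_congr rfl fun i _ => mul_comm _ _
  have haH : ∀ s x y, ∑ i, a i * (S.H (i + s) x y : ℂ)
      = -(S.H (numEigenvalues S.A + s) x y : ℂ) := by
    intro s x y
    simp only [h.H_apply, Finset.mul_sum]
    rw [Finset.sum_comm, ← Finset.sum_neg_distrib]
    refine Finset.sum_congr rfl fun j _ => ?_
    rw [pow_add, ← neg_mul, ← neg_mul, ← ha j, Finset.sum_mul, Finset.sum_mul]
    exact Finset.sum_congr rfl fun i _ => by rw [pow_add]; ring
  -- the right-hand side of the normal equations
  set b : Fin (numEigenvalues S.A) → ℝ := fun i =>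
    -((stack (numEigenvalues S.A) S.H i)ᵀ
      * stack (numEigenvalues S.A) S.H (numEigenvalues S.A)).trace with hb
  have h1 : toC (gram (numEigenvalues S.A) S.H) *ᵥ a
      = fun i => ((b i : ℝ) : ℂ) := by
    funext i
    simp only [hb, mulVec, dotProduct, toC_apply, gram, Matrix.of_apply, trace_stack,
      Complex.ofReal_neg, Complex.ofReal_sum, Complex.ofReal_mul, Finset.sum_mul]
    rw [Finset.sum_comm, ← Finset.sum_neg_distrib]
    refine Finset.sum_congr rfl fun b _ => ?_
    rw [Finset.sum_comm, ← Finset.sum_neg_distrib]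
    refine Finset.sum_congr rfl fun s _ => ?_
    rw [← mul_neg, ← haH, Finset.mul_sum]
    exact Finset.sum_congr rfl fun j _ => by ring
  have h2 : toC (gram (numEigenvalues S.A) S.H) *ᵥ (fun i => (α i : ℂ))
      = fun i => ((b i : ℝ) : ℂ) := by
    have h3 : gram (numEigenvalues S.A) S.H *ᵥ α = b := by
      rw [hα, coeffEst, mulVec_neg, mulVec_mulVec, Matrix.mul_nonsing_inv _ hgu, one_mulVec]
      rfl
    funext i
    rw [← congrFun h3 i]
    simp [mulVec, dotProduct, toC_apply]
  have hcu : IsUnit (toC (gram (numEigenvalues S.A) S.H)).det := by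
    have : (toC (gram (numEigenvalues S.A) S.H)).det = ((gram (numEigenvalues S.A) S.H).det : ℂ) :=
      (RingHom.map_det Complex.ofRealHom _).symm
    rw [this]
    exact isUnit_iff_ne_zero.2 (Complex.ofReal_ne_zero.2 hgu.ne_zero)
  have h3 : (fun i => (α i : ℂ)) = a := by
    have := Matrix.mulVec_injective_iff_isUnit.2 ((Matrix.isUnit_iff_isUnit_det _).2 hcu)
    exact this (h2.trans h1.symm)
  have h4 : ∑ i, (α i : ℂ) * ev j ^ (i : ℕ) = -ev j ^ numEigenvalues S.A := by
    rw [← ha j, ← h3]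
  rw [h4, add_neg_cancel]

end IsModal

end Modes

/-! ### Convergence of the labelled roots -/

section Roots

theorem exists_separation {q : ℕ} {ev : Fin q → ℂ} (hev : Function.Injective ev) :
    ∃ d > 0, ∀ i j, i ≠ j → d ≤ ‖ev i - ev j‖ := by
  have h : ∀ᶠ d in 𝓝[>] (0 : ℝ), ∀ i j, i ≠ j → d ≤ ‖ev i - ev j‖ := by
    rw [eventually_all]; intro i
    rw [eventually_all]; intro j
    by_cases hij : i = j
    · exact Eventually.of_forall fun d h => (h hij).elim
    · have : 0 < ‖ev i - ev j‖ := norm_pos_iff.2 (sub_ne_zero.2 (hev.ne hij))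
      filter_upwards [Ioc_mem_nhdsGT this] with d hd _ using hd.2
  obtain ⟨d, hd, hpos⟩ := (h.and self_mem_nhdsWithin).exists
  exact ⟨d, hpos, hd⟩

/-- If monic polynomials with roots `lam k` become small at the distinct points `ev`, and the
labels of the roots are tracked in time, then after finitely many steps every labelled root stays
close to one and the same point of `ev`, at the rate at which the polynomials vanish there. -/
theorem exists_perm_growth_roots {q : ℕ} {ev : Fin q → ℂ} (hev : Function.Injective ev)
    {lam : ℕ → Fin q → ℂ} {v : ℕ → Fin q → ℂ} {c : ℝ} (hc : c < 0)
    (hprod : ∀ᶠ k in atTop, ∀ j, ∏ i, (ev j - lam k i) = v k j)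
    (hv : ∀ j, Growth c fun k => v k j)
    (htrack : ∀ᶠ k in atTop, ∀ s : ℝ, (∀ i j, i ≠ j → s ≤ ‖lam k i - lam k j‖) →
      (∃ σ : Equiv.Perm (Fin q), ∀ i, ‖lam (k + 1) (σ i) - lam k i‖ < s / 2) →
        ∀ i, ‖lam (k + 1) i - lam k i‖ < s / 2) :
    ∃ σ : Equiv.Perm (Fin q), ∀ i, Growth c fun k => lam k i - ev (σ i) := by
  obtain ⟨d, hd, hsep⟩ := exists_separation hev
  -- a small product of `q` factors has a small factor, so every `ev j` is close to a root
  have hclose : ∀ᶠ k in atTop, ∀ j, ∃ i, ‖ev j - lam k i‖ < d / 8 := by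
    rw [eventually_all]; intro j
    have hsmall := (hv j).tendsto_zero hc
    rw [tendsto_zero_iff_norm_tendsto_zero] at hsmall
    filter_upwards [hprod, hsmall.eventually (gt_mem_nhds (show 0 < (d / 8) ^ q by positivity))]
      with k hk1 hk2
    by_contra! hcon
    have h1 : ∏ _i : Fin q, d / 8 ≤ ∏ i, ‖ev j - lam k i‖ :=
      Finset.prod_le_prod (fun _ _ => by positivity) fun i _ => hcon i
    rw [← norm_prod, hk1 j] at h1
    simp only [Finset.prod_const, Finset.card_univ, Fintype.card_fin] at h1
    linarith
  -- the points `ev` being separated, different ones are close to different roots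
  have hperm : ∀ᶠ k in atTop, ∃ σ : Equiv.Perm (Fin q), ∀ i, ‖lam k i - ev (σ i)‖ < d / 8 := by
    filter_upwards [hclose] with k hk
    choose τ hτ using hk
    have hinj : Function.Injective τ := by
      intro j j' hjj
      by_contra hne
      have h1 := hsep j j' hne
      have h2 : ‖ev j - ev j'‖ ≤ ‖ev j - lam k (τ j)‖ + ‖ev j' - lam k (τ j)‖ := by
        rw [← norm_neg (ev j' - _), neg_sub]
        refine le_trans (le_of_eq ?_) (norm_add_le _ _)
        congr 1; ring
      have h3 := hτ j
      have h4 := hτ j'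
      rw [← hjj] at h4
      linarith
    set π := Equiv.ofBijective τ (Finite.injective_iff_bijective.1 hinj) with hπ
    refine ⟨π.symm, fun i => ?_⟩
    have h1 := hτ (π.symm i)
    have h2 : τ (π.symm i) = i := π.apply_symm_apply i
    rwa [h2, norm_sub_rev] at h1
  obtain ⟨K, hK⟩ := eventually_atTop.1 (hperm.and (htrack.and hprod))
  choose σ hσ using fun k : ℕ => (hK (K + k) (Nat.le_add_right _ _)).1
  -- the roots move by less than half their separation, so the labels are tracked and the matching
  -- of the labels to the points `ev` does not change
  have hstep : ∀ k, σ (k + 1) = σ k := by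
    intro k
    have h1 := (hK (K + k) (Nat.le_add_right _ _)).2.1 (3 * d / 4) (fun i j hij => by
      have h2 := hsep (σ k i) (σ k j) ((σ k).injective.ne hij)
      have h3 : ‖ev (σ k i) - ev (σ k j)‖ ≤ ‖lam (K + k) i - lam (K + k) j‖
          + ‖lam (K + k) i - ev (σ k i)‖ + ‖lam (K + k) j - ev (σ k j)‖ := by
        rw [← norm_neg (lam (K + k) i - ev (σ k i))]
        refine le_trans (le_of_eq ?_) (norm_add₃_le)
        congr 1; ring
      have h4 := hσ k i
      have h5 := hσ k j
      linarith) ⟨(σ k).trans (σ (k + 1)).symm, fun i => by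
        have h2 := hσ (k + 1) ((σ (k + 1)).symm (σ k i))
        rw [Equiv.apply_symm_apply] at h2
        have h3 := hσ k i
        have h4 : ‖lam (K + k + 1) ((σ (k + 1)).symm (σ k i)) - lam (K + k) i‖
            ≤ ‖lam (K + (k + 1)) ((σ (k + 1)).symm (σ k i)) - ev (σ k i)‖
              + ‖lam (K + k) i - ev (σ k i)‖ := by
          rw [← norm_neg (lam (K + k) i - ev (σ k i))]
          refine le_trans (le_of_eq ?_) (norm_add_le _ _)
          congr 1
          rw [← add_assoc]
          ring
        rw [Equiv.trans_apply]
        linarith⟩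
    ext i : 1
    by_contra hne
    have h2 := hsep _ _ hne
    have h3 := h1 i
    have h4 := hσ k i
    have h5 := hσ (k + 1) i
    have h6 : ‖ev (σ (k + 1) i) - ev (σ k i)‖ ≤ ‖lam (K + k + 1) i - lam (K + k) i‖
        + ‖lam (K + (k + 1)) i - ev (σ (k + 1) i)‖ + ‖lam (K + k) i - ev (σ k i)‖ := by
      rw [← norm_neg (lam (K + (k + 1)) i - ev (σ (k + 1) i))]
      refine le_trans (le_of_eq ?_) (norm_add₃_le)
      congr 1
      rw [← add_assoc]
      ring
    linarith
  have hconst : ∀ k, σ k = σ 0 := fun k => by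
    induction k with
    | zero => rfl
    | succ k ih => rw [hstep, ih]
  refine ⟨σ 0, fun i => (hv (σ 0 i)).of_isBigO ?_⟩
  -- all the other factors of the product stay away from zero
  refine Asymptotics.IsBigO.of_bound ((d / 2) ^ (q - 1))⁻¹ (eventually_atTop.2 ⟨K, fun k hk => ?_⟩)
  obtain ⟨l, rfl⟩ := Nat.exists_eq_add_of_le hk
  have hk1 := (hK (K + l) hk).2.2 (σ 0 i)
  have hlow : ∀ i' ∈ Finset.univ.erase i, d / 2 ≤ ‖ev (σ 0 i) - lam (K + l) i'‖ := by
    intro i' hi'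
    have h1 := hσ l i'
    rw [hconst] at h1
    have h2 := hsep (σ 0 i) (σ 0 i') ((σ 0).injective.ne (Finset.ne_of_mem_erase hi').symm)
    have h3 : ‖ev (σ 0 i) - ev (σ 0 i')‖ ≤ ‖ev (σ 0 i) - lam (K + l) i'‖
        + ‖lam (K + l) i' - ev (σ 0 i')‖ := by
      refine le_trans (le_of_eq ?_) (norm_add_le _ _)
      congr 1; ring
    linarith
  have h1 := Finset.prod_le_prod (fun _ _ => by positivity) hlow
  rw [Finset.prod_const, Finset.card_erase_of_mem (Finset.mem_univ i), Finset.card_univ,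
    Fintype.card_fin] at h1
  have h2 : ‖v (K + l) (σ 0 i)‖ = ‖ev (σ 0 i) - lam (K + l) i‖
      * ∏ i' ∈ Finset.univ.erase i, ‖ev (σ 0 i) - lam (K + l) i'‖ := by
    rw [← hk1, norm_prod]
    exact (Finset.mul_prod_erase _ (fun i' => ‖ev (σ 0 i) - lam (K + l) i'‖)
      (Finset.mem_univ i)).symm
  rw [inv_mul_eq_div, le_div_iff₀ (by positivity), norm_sub_rev, h2]
  exact mul_le_mul_of_nonneg_left h1 (norm_nonneg _)

variable {n m p : ℕ}

theorem polyEst_monic (q : ℕ) (G : ℕ → Matrix (Fin m) (Fin p) ℝ) :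
    (polyEst q G).Monic := by
  refine Polynomial.monic_X_pow_add ?_
  rw [Polynomial.degree_lt_iff_coeff_zero]
  intro k hk
  rw [Polynomial.finsetSum_coeff]
  refine Finset.sum_eq_zero fun i _ => ?_
  rw [Polynomial.coeff_C_mul_X_pow, if_neg (by omega)]

theorem prod_sub_roots {q : ℕ} {G : ℕ → Matrix (Fin m) (Fin p) ℝ} {lam : Fin q → ℂ}
    (h : Multiset.map lam Finset.univ.val = (polyEst q G).roots) (z : ℂ) :
    ∏ i, (z - lam i) = z ^ q + ∑ i : Fin q, (coeffEst q G i : ℂ) * z ^ (i : ℕ) := by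
  have h1 := (IsAlgClosed.splits (polyEst q G)).eq_prod_roots_of_monic (polyEst_monic q G)
  have h2 := congrArg (Polynomial.eval z) h1
  rw [← h, Multiset.map_map, Polynomial.eval_multiset_prod, Multiset.map_map] at h2
  have h3 : ∏ i, (z - lam i) = Polynomial.eval z (polyEst q G) := by
    rw [h2, Finset.prod]
    congr 1
    refine Multiset.map_congr rfl fun i _ => by simp
  rw [h3, polyEst]
  simp [Polynomial.eval_finsetSum]

end Roots

/-! ### Convergence of the estimated residues -/

section Residues

theorem pow_sub_pow_growth {c : ℝ} (hc : c < 0) {f : ℕ → ℂ} {a : ℂ}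
    (h : Growth c fun k => f k - a) (r : ℕ) : Growth c fun k => f k ^ r - a ^ r := by
  induction r with
  | zero => simpa using Growth.zero
  | succ r ih => simpa only [pow_succ] using ih.mul_sub_mul hc.le h

/-- For a matrix of full column rank, the Moore–Penrose inverse is the usual left inverse. -/
theorem pinv_eq_inv_mul {r s : Type*} [Fintype r] [Fintype s] [DecidableEq s]
    {A : Matrix r s ℂ} (hA : IsUnit (Aᴴ * A).det) : pinv A = (Aᴴ * A)⁻¹ * Aᴴ := by
  have h1 := gram_mul_inv_mul_gram A
  rw [pinv]
  congr 1
  calc cfc (fun x : ℝ => x⁻¹) (Aᴴ * A)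
      = (Aᴴ * A)⁻¹ * ((Aᴴ * A) * cfc (fun x : ℝ => x⁻¹) (Aᴴ * A) * (Aᴴ * A)) * (Aᴴ * A)⁻¹ := by
        rw [Matrix.mul_assoc, Matrix.mul_assoc, Matrix.mul_nonsing_inv _ hA, Matrix.mul_one,
          ← Matrix.mul_assoc, Matrix.nonsing_inv_mul _ hA, Matrix.one_mul]
    _ = (Aᴴ * A)⁻¹ := by
        rw [h1, Matrix.nonsing_inv_mul _ hA, Matrix.one_mul]

open scoped ComplexOrder in
theorem isUnit_gram_vander {q m : ℕ} {lam : Fin q → ℂ} (h : Function.Injective lam) :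
    IsUnit ((vander lam ⊗ₖ (1 : Matrix (Fin m) (Fin m) ℂ))ᴴ
      * (vander lam ⊗ₖ (1 : Matrix (Fin m) (Fin m) ℂ))).det := by
  have h1 : IsUnit ((vander lam)ᴴ * vander lam).det := by
    rw [← Matrix.isUnit_iff_isUnit_det, ← Matrix.mulVec_injective_iff_isUnit]
    intro x y hxy
    rw [← sub_eq_zero]
    have h2 : ((vander lam)ᴴ * vander lam) *ᵥ (x - y) = 0 := by
      rw [mulVec_sub, sub_eq_zero]; exact hxy
    have h3 := (Matrix.conjTranspose_mul_self_mulVec_eq_zero _ _).1 h2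
    refine Matrix.eq_zero_of_forall_pow_sum_mul_pow_eq_zero h fun r => ?_
    have h4 := congrFun h3 ⟨r, by omega⟩
    simp only [mulVec, dotProduct, vander, Matrix.of_apply, Pi.zero_apply] at h4
    rw [← h4]
    exact Finset.sum_congr rfl fun i _ => mul_comm _ _
  rw [Matrix.conjTranspose_kronecker, ← Matrix.mul_kronecker_mul, Matrix.conjTranspose_one,
    Matrix.mul_one, Matrix.det_kronecker, Matrix.det_one, one_pow, mul_one]
  exact h1.pow _

variable {n m p : ℕ}

/-- Convergence of the least squares fit of the residues: with `L_k = V_k ⊗ I` and `L_k⁺ L_k = 1`,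
the error of the fit is `L_k⁺` applied to the residual of the exact residues. -/
theorem growth_omegaEst {q : ℕ} {c : ℝ} (hc : c < 0) {lam : ℕ → Fin q → ℂ} {ev : Fin q → ℂ}
    (hev : Function.Injective ev) (hlam : ∀ i, Growth c fun k => lam k i - ev i)
    {G : ℕ → ℕ → Matrix (Fin m) (Fin p) ℝ} {H : ℕ → Matrix (Fin m) (Fin p) ℝ}
    (hG : ∀ τ, MGrowth c fun k => G k τ - H τ) {Om : Fin q → Matrix (Fin m) (Fin p) ℂ}
    (hH : ∀ τ a b, (H τ a b : ℂ) = ∑ i, ev i ^ τ * Om i a b) (i : Fin q) :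
    MGrowth c fun k => omegaEst (lam k) (G k) i - Om i := by
  set L : (Fin q → ℂ) → Matrix (Fin (3 * q - 1) × Fin m) (Fin q × Fin m) ℂ := fun l =>
    vander l ⊗ₖ (1 : Matrix (Fin m) (Fin m) ℂ) with hL
  have hLa : ∀ l r a i b, L l (r, a) (i, b)
      = l i ^ (r : ℕ) * (1 : Matrix (Fin m) (Fin m) ℂ) a b := fun _ _ _ _ _ => rfl
  have hLg : MGrowth c fun k => L (lam k) - L ev := by
    rintro ⟨r, a⟩ ⟨j, b⟩
    have h1 := (pow_sub_pow_growth hc (hlam j) (r : ℕ)).mul_const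
      ((1 : Matrix (Fin m) (Fin m) ℂ) a b)
    refine h1.congr' (Eventually.of_forall fun k => ?_)
    simp only [hLa, Matrix.sub_apply]
    ring
  have hLb : MGrowth 0 fun k => L (lam k) := fun a b =>
    Growth.of_tendsto ((hLg a b).tendsto hc)
  have hLHg : MGrowth c fun k => (L (lam k))ᴴ - (L ev)ᴴ := fun a b => by
    have := (hLg b a).star
    refine this.congr' (Eventually.of_forall fun k => ?_)
    simp
  have hLHb : MGrowth 0 fun k => (L (lam k))ᴴ := fun a b =>
    Growth.of_tendsto ((hLHg a b).tendsto hc)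
  have hgramg : MGrowth c fun k => (L (lam k))ᴴ * L (lam k) - (L ev)ᴴ * L ev := by
    have h1 := (hLHg.mul_right_bdd hLb).add ((MGrowth.const (L ev)ᴴ).mul_left_bdd hLg)
    refine h1.congr' (Eventually.of_forall fun k => ?_)
    simp only [Matrix.sub_mul, Matrix.mul_sub]
    abel
  have hlim : ∀ a b, Tendsto (fun k => ((L (lam k))ᴴ * L (lam k)) a b) atTop
      (𝓝 (((L ev)ᴴ * L ev) a b)) := fun a b => (hgramg a b).tendsto hc
  have hu : IsUnit ((L ev)ᴴ * L ev).det := isUnit_gram_vander hev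
  have hpb : MGrowth 0 fun k => ((L (lam k))ᴴ * L (lam k))⁻¹ * (L (lam k))ᴴ :=
    (MGrowth.inv_bdd hlim hu).mul_left_bdd hLHb
  set Gs : (ℕ → Matrix (Fin m) (Fin p) ℝ) → Matrix (Fin (3 * q - 1) × Fin m) (Fin p) ℂ := fun G =>
    Matrix.of fun c b => ((G c.1 c.2 b : ℝ) : ℂ) with hGs
  set Os : Matrix (Fin q × Fin m) (Fin p) ℂ := Matrix.of fun c b => Om c.1 c.2 b with hOs
  have hGg : MGrowth c fun k => Gs (G k) - Gs H := fun a b => by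
    have := Growth.ofReal_iff.2 (hG a.1 a.2 b)
    refine this.congr' (Eventually.of_forall fun k => ?_)
    simp [hGs]
  have hLO : L ev * Os = Gs H := by
    ext ⟨r, a⟩ b
    simp only [hGs, Matrix.of_apply, hH, Matrix.mul_apply, hOs]
    rw [Fintype.sum_prod_type]
    simp only [hLa]
    refine Finset.sum_congr rfl fun i _ => ?_
    rw [Finset.sum_eq_single a]
    · simp
    · intro a' _ ha'
      rw [Matrix.one_apply_ne ha'.symm, mul_zero, zero_mul]
    · simp
  have hres : MGrowth c fun k => ((L (lam k))ᴴ * L (lam k))⁻¹ * (L (lam k))ᴴ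
      * ((Gs (G k) - Gs H) + -(L (lam k) - L ev) * Os) :=
    hpb.mul_left_bdd (hGg.add (hLg.neg.mul_right_bdd (MGrowth.const Os)))
  intro a b
  refine (hres (i, a) b).congr' ?_
  filter_upwards [MGrowth.eventually_isUnit_det hlim hu] with k hk
  have h1 : (Gs (G k) - Gs H) + -(L (lam k) - L ev) * Os = Gs (G k) - L (lam k) * Os := by
    rw [neg_sub, Matrix.sub_mul, hLO]; abel
  have h2 : ((L (lam k))ᴴ * L (lam k))⁻¹ * (L (lam k))ᴴ * (Gs (G k) - L (lam k) * Os)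
      = pinv (L (lam k)) * Gs (G k) - Os := by
    rw [pinv_eq_inv_mul hk, Matrix.mul_sub]
    congr 1
    rw [← Matrix.mul_assoc, Matrix.mul_assoc _ _ (L (lam k)), Matrix.nonsing_inv_mul _ hk,
      Matrix.one_mul]
  rw [h1, h2]
  rfl

end Residues

/-! ### Convergence of the estimated noise covariance -/

section NoiseCov

variable {n m p : ℕ}

/-- A real vector seen as a complex one. -/
def vecC {r : Type*} (x : r → ℝ) : r → ℂ := fun a => (x a : ℂ)

theorem toC_mulVec_vecC {r s : Type*} [Fintype s] (M : Matrix r s ℝ) (x : s → ℝ) :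
    toC M *ᵥ vecC x = vecC (M *ᵥ x) := by
  funext a
  simp [mulVec, dotProduct, vecC, toC_apply]

theorem vecC_add {r : Type*} (x y : r → ℝ) : vecC (x + y) = vecC x + vecC y := by
  funext a; simp [vecC]

/-- Superposition: the state is the response to the watermark plus the noise part. -/
theorem LinSys.state_eq_add (S : LinSys n m p) (xi : Fin n → ℝ) (φ : ℕ → Fin p → ℝ)
    (w : ℕ → Fin n → ℝ) (k : ℕ) : S.state xi φ w k = S.state 0 φ 0 k + S.state xi 0 w k := by
  induction k with
  | zero => simp only [LinSys.state, Pi.zero_apply, mulVec_zero]; abel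
  | succ k ih =>
    simp only [LinSys.state, ih, mulVec_add, Pi.zero_apply, mulVec_zero]; abel

variable {S : LinSys n m p} {ev : Fin (numEigenvalues S.A) → ℂ}
  {E : Fin (numEigenvalues S.A) → Matrix (Fin n) (Fin n) ℂ}

/-- Growth of the states: in modal coordinates they solve stable scalar recursions. -/
theorem IsModal.growth_mode (h : IsModal S.A ev E) (hlt : ∀ i, ‖ev i‖ < 1) {c : ℝ}
    {x : ℕ → Fin n → ℝ} {f : ℕ → Fin n → ℝ} (hx : ∀ k, x (k + 1) = S.A *ᵥ x k + f k)
    (hf : ∀ a, Growth c fun k => f k a) (a : Fin n) : Growth c fun k => x k a := by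
  have hmode : ∀ i a, Growth c fun k => (E i *ᵥ vecC (x k)) a := by
    intro i a
    refine Growth.of_recursion (l := fun _ => ev i) (f := fun k => (E i *ᵥ vecC (f k)) a)
      (norm_nonneg _) (hlt i) (Eventually.of_forall fun _ => le_rfl)
      (Eventually.of_forall fun k => ?_) ?_
    · rw [hx, vecC_add, mulVec_add, ← toC_mulVec_vecC, mulVec_mulVec, h.proj_mul, smul_mulVec]
      rfl
    · simp only [mulVec, dotProduct]
      exact Growth.sum _ fun b _ => (Growth.ofReal_iff.2 (hf b)).const_mul _
  have hsum : ∀ k, ∑ i, (E i *ᵥ vecC (x k)) a = (x k a : ℂ) := fun k => by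
    have h1 : (∑ i, E i) *ᵥ vecC (x k) = vecC (x k) := by rw [h.sum_proj, one_mulVec]
    have h2 := congrFun h1 a
    rw [Matrix.sum_mulVec, Finset.sum_apply] at h2
    exact h2
  rw [← Growth.ofReal_iff]
  refine (Growth.sum Finset.univ fun i _ => hmode i a).congr' (Eventually.of_forall hsum)

theorem IsModal.growth_state (h : IsModal S.A ev E) (hlt : ∀ i, ‖ev i‖ < 1) {c : ℝ}
    {xi : Fin n → ℝ} {φ : ℕ → Fin p → ℝ} {w : ℕ → Fin n → ℝ} (hφ : ∀ b, Growth c fun k => φ k b)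
    (hw : ∀ a, Growth c fun k => w k a) (a : Fin n) :
    Growth c fun k => S.state xi φ w k a := by
  refine h.growth_mode hlt (f := fun k => S.B *ᵥ φ (k + 1) + w (k + 1))
    (fun k => by rw [LinSys.state, add_assoc]) (fun a => ?_) a
  simp only [Pi.add_apply, mulVec, dotProduct]
  exact (Growth.sum _ fun b _ => ((hφ b).shift 1).const_mul _).add ((hw a).shift 1)

/-- The estimate of the watermark response tracks the true response at the rate at which the
estimated modes converge. -/
theorem IsModal.growth_phiHat_sub (h : IsModal S.A ev E) (hlt : ∀ i, ‖ev i‖ < 1) {c : ℝ}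
    (hc : c < 0) {φ : ℕ → Fin p → ℝ} (hφ : ∀ b, Growth 0 fun k => φ k b)
    {lam : ℕ → Fin (numEigenvalues S.A) → ℂ}
    {Om : ℕ → Fin (numEigenvalues S.A) → Matrix (Fin m) (Fin p) ℂ}
    {σ : Equiv.Perm (Fin (numEigenvalues S.A))}
    (hlam : ∀ i, Growth c fun k => lam k i - ev (σ i))
    (hOm : ∀ i, MGrowth c fun k => Om k i - residue S E (σ i)) (a : Fin m) :
    Growth c fun k => phiHat lam Om φ k a - (S.C *ᵥ S.state 0 φ 0 k) a := by
  -- the exact modal components `z` of the response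
  set z : ℕ → Fin (numEigenvalues S.A) → Fin m → ℂ := fun k i =>
    (toC S.C * E i) *ᵥ vecC (S.state 0 φ 0 k) with hz
  have hzrec : ∀ k i, z (k + 1) i = ev i • z k i + residue S E i *ᵥ vecC (φ (k + 1)) := by
    intro k i
    simp only [hz, LinSys.state, Pi.zero_apply, add_zero]
    rw [vecC_add, mulVec_add, ← toC_mulVec_vecC, ← toC_mulVec_vecC, mulVec_mulVec, mulVec_mulVec,
      Matrix.mul_assoc, h.proj_mul, Matrix.mul_smul, smul_mulVec, residue]
  have hzg : ∀ i a, Growth 0 fun k => z k i a := by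
    intro i a
    simp only [hz, mulVec, dotProduct]
    refine Growth.sum _ fun b _ => (Growth.ofReal_iff.2 ?_).const_mul _
    exact h.growth_state hlt hφ (fun _ => Growth.const _) b
  have hzsum : ∀ k, ∑ i, z k i a = ((S.C *ᵥ S.state 0 φ 0 k) a : ℂ) := by
    intro k
    have h1 : (toC S.C * ∑ i, E i) *ᵥ vecC (S.state 0 φ 0 k) = vecC (S.C *ᵥ S.state 0 φ 0 k) := by
      rw [h.sum_proj, Matrix.mul_one, toC_mulVec_vecC]
    have h2 := congrFun h1 a
    rw [Matrix.mul_sum, Matrix.sum_mulVec, Finset.sum_apply] at h2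
    exact h2
  obtain ⟨ρ, hρ0, hρ1, hρ⟩ : ∃ ρ : ℝ, 0 ≤ ρ ∧ ρ < 1 ∧ ∀ i, ∀ᶠ k in atTop, ‖lam k i‖ ≤ ρ := by
    have h1 : ∀ᶠ ρ in 𝓝[<] (1 : ℝ), ∀ i, ‖ev (σ i)‖ < ρ := by
      rw [eventually_all]; intro i
      filter_upwards [Ioo_mem_nhdsLT (hlt (σ i))] with ρ hρ using hρ.1
    obtain ⟨ρ, h2, h3, h4⟩ := (h1.and ((Ioo_mem_nhdsLT (zero_lt_one (α := ℝ))))).exists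
    exact ⟨ρ, h3.le, h4, fun i => (((hlam i).tendsto hc).norm.eventually
      (gt_mem_nhds (h2 i))).mono fun k hk => hk.le⟩
  have herr : ∀ i, Growth c fun k => phiHatPart lam Om φ k i a - z k (σ i) a := by
    intro i
    refine Growth.of_recursion (l := fun k => lam (k + 1) i)
      (f := fun k => (lam (k + 1) i - ev (σ i)) * z k (σ i) a
        + ((Om (k + 1) i - residue S E (σ i)) *ᵥ vecC (φ (k + 1))) a) hρ0 hρ1
      ((tendsto_add_atTop_nat 1).eventually (hρ i)) (Eventually.of_forall fun k => ?_) ?_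
    · rw [hzrec, phiHatPart, sub_mulVec,
        show (fun b => ((φ (k + 1) b : ℝ) : ℂ)) = vecC (φ (k + 1)) from rfl]
      simp only [Pi.add_apply, Pi.smul_apply, Pi.sub_apply, smul_eq_mul]
      ring
    · refine (((hlam i).shift 1).mul_right_bdd (hzg _ _)).add ?_
      simp only [mulVec, dotProduct]
      exact Growth.sum _ fun b _ => ((hOm i a b).shift 1).mul_right_bdd
        (Growth.ofReal_iff.2 ((hφ b).shift 1))
  refine (Growth.sum Finset.univ fun i _ => herr i).re.congr' (Eventually.of_forall fun k => ?_)
  simp only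
  rw [Finset.sum_sub_distrib, Equiv.sum_comp σ fun i => z k i a, hzsum, Complex.sub_re,
    Complex.ofReal_re]
  rfl

/-- Convergence of an empirical covariance computed from perturbed samples. -/
theorem growth_noiseCovEst {c : ℝ} (hc : c < 0) (hc' : -(1 / 2) ≤ c) {y φh θ : ℕ → Fin m → ℝ}
    {W : Matrix (Fin m) (Fin m) ℝ} (hθ : ∀ a, Growth 0 fun k => θ k a)
    (hd : ∀ a, Growth c fun k => (y k - φh k) a - θ k a)
    (hcov : ∀ a b, Growth (1 / 2) fun k => ∑ t ∈ Finset.range k, (θ t a * θ t b - W a b)) :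
    MGrowth c fun k => noiseCovEst y φh k - W := by
  intro a b
  set e : ℕ → Fin m → ℝ := fun k a => (y k - φh k) a - θ k a with he
  have h1 : Growth c fun k => ((k : ℝ) + 1)⁻¹
      * ∑ t ∈ Finset.range (k + 1), (θ t a * θ t b - W a b) := by
    have := Growth.inv_natCast.mul ((hcov a b).shift 1)
    exact this.mono (by linarith)
  have h2 : Growth c fun k => ((k : ℝ) + 1)⁻¹
      * ∑ t ∈ Finset.range (k + 1), (e t a * θ t b + θ t a * e t b + e t a * e t b) := by
    have h3 : Growth c fun t => e t a * θ t b + θ t a * e t b + e t a * e t b :=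
      (((hd a).mul_right_bdd (hθ b)).add ((hθ a).mul_left_bdd (hd b))).add
        (((hd a).mono hc.le).mul_left_bdd (hd b))
    have := Growth.inv_natCast.mul ((h3.sum_range (by linarith) hc).shift 1)
    exact this.mono (by linarith)
  refine (h1.add h2).congr' (Eventually.of_forall fun k => ?_)
  have hk : ((k : ℝ) + 1) ≠ 0 := by positivity
  have h4 : ((k : ℝ) + 1)⁻¹ * ∑ t ∈ Finset.range (k + 1), W a b = W a b := by
    rw [Finset.sum_const, Finset.card_range, nsmul_eq_mul]
    push_cast
    rw [← mul_assoc, inv_mul_cancel₀ hk, one_mul]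
  calc _ = ((k : ℝ) + 1)⁻¹ * ∑ t ∈ Finset.range (k + 1),
        ((y t a - φh t a) * (y t b - φh t b) - W a b) := by
        simp only
        rw [← mul_add, ← Finset.sum_add_distrib]
        congr 1
        refine Finset.sum_congr rfl fun t _ => ?_
        simp only [he, Pi.sub_apply]
        ring
    _ = _ := by
        rw [Finset.sum_sub_distrib, mul_sub, h4]
        simp only [noiseCovEst, Matrix.sub_apply, Matrix.smul_apply, Matrix.sum_apply, smul_eq_mul,
          vecMulVec_apply, Pi.sub_apply]

end NoiseCov

/-! ### The quadratic functionals of the Markov parameters -/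

section Functionals

variable {n m p : ℕ}

/-- The products of entries of the Markov parameters are summable, with sums `K`. -/
def HasCorr (H : ℕ → Matrix (Fin m) (Fin p) ℝ) (K : Fin m → Fin p → Fin m → Fin p → ℝ) : Prop :=
  ∀ a b a' b', HasSum (fun τ => H τ a b * H τ a' b') (K a b a' b')

namespace HasCorr

variable {H : ℕ → Matrix (Fin m) (Fin p) ℝ} {K : Fin m → Fin p → Fin m → Fin p → ℝ}

theorem symm (h : HasCorr H K) (a b a' b') : K a b a' b' = K a' b' a b :=
  (h a b a' b').unique (by simpa only [mul_comm] using h a' b' a b)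

theorem hasSum_transpose_mul_mul (h : HasCorr H K) (M : Matrix (Fin m) (Fin m) ℝ) :
    HasSum (fun τ => (H τ)ᵀ * M * H τ)
      (Matrix.of fun i j => ∑ d, ∑ c, K c i d j * M c d) := by
  refine Pi.hasSum.2 fun i => Pi.hasSum.2 fun j => ?_
  simp only [Matrix.mul_apply, Matrix.transpose_apply, Matrix.of_apply, Finset.sum_mul]
  refine hasSum_sum fun d _ => hasSum_sum fun c _ => ?_
  refine ((h c i d j).mul_right (M c d)).congr_fun fun τ => ?_
  ring

theorem hasSum_mul_mul_transpose (h : HasCorr H K) (U : Matrix (Fin p) (Fin p) ℝ) :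
    HasSum (fun τ => H τ * U * (H τ)ᵀ)
      (Matrix.of fun i j => ∑ d, ∑ c, K i c j d * U c d) := by
  refine Pi.hasSum.2 fun i => Pi.hasSum.2 fun j => ?_
  simp only [Matrix.mul_apply, Matrix.transpose_apply, Matrix.of_apply, Finset.sum_mul]
  refine hasSum_sum fun d _ => hasSum_sum fun c _ => ?_
  refine ((h i c j d).mul_right (U c d)).congr_fun fun τ => ?_
  ring

theorem Pmat_apply (h : HasCorr H K) (W : Matrix (Fin m) (Fin m) ℝ) (i j : Fin p) :
    Pmat H W i j = ∑ d, ∑ c, K c i d j * W⁻¹ c d := by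
  rw [Pmat, (h.hasSum_transpose_mul_mul W⁻¹).tsum_eq, Matrix.of_apply]

theorem Xmat_apply (h : HasCorr H K) (X : Matrix (Fin m ⊕ Fin p) (Fin m ⊕ Fin p) ℝ) (i j : Fin p) :
    Xmat H X i j = ∑ d, ∑ c, K c i d j * X.toBlocks₁₁ c d + ((H 0)ᵀ * X.toBlocks₁₂) i j
      + (X.toBlocks₂₁ * H 0) i j + X.toBlocks₂₂ i j := by
  rw [Xmat, (h.hasSum_transpose_mul_mul X.toBlocks₁₁).tsum_eq]
  rfl

/-- The adjointness of `U ↦ ∑ H_τ U H_τᵀ` and `M ↦ ∑ H_τᵀ M H_τ` for the trace pairing. -/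
theorem trace_mul_sum (h : HasCorr H K) (U : Matrix (Fin p) (Fin p) ℝ)
    (M : Matrix (Fin m) (Fin m) ℝ) :
    ((∑' τ, H τ * U * (H τ)ᵀ) * M).trace = (U * ∑' τ, (H τ)ᵀ * M * H τ).trace := by
  rw [(h.hasSum_mul_mul_transpose U).tsum_eq, (h.hasSum_transpose_mul_mul M).tsum_eq]
  have h1 := (h.hasSum_mul_mul_transpose U).map
    (AddMonoidHom.mk' (fun N : Matrix (Fin m) (Fin m) ℝ => (N * M).trace) fun a b => by
      simp [Matrix.add_mul])
    (by simp only [AddMonoidHom.mk'_apply]; fun_prop)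
  have h2 := (h.hasSum_transpose_mul_mul M).map
    (AddMonoidHom.mk' (fun N : Matrix (Fin p) (Fin p) ℝ => (U * N).trace) fun a b => by
      simp [Matrix.mul_add])
    (by simp only [AddMonoidHom.mk'_apply]; fun_prop)
  refine h1.unique (h2.congr_fun fun τ => ?_)
  simp only [Function.comp_apply, AddMonoidHom.mk'_apply]
  rw [Matrix.mul_assoc, Matrix.mul_assoc, Matrix.trace_mul_comm]
  simp only [Matrix.mul_assoc]

theorem quad_sum (h : HasCorr H K) (M : Matrix (Fin m) (Fin m) ℝ) (z : Fin p → ℝ) :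
    HasSum (fun τ => (H τ *ᵥ z) ⬝ᵥ M *ᵥ (H τ *ᵥ z)) (z ⬝ᵥ (∑' τ, (H τ)ᵀ * M * H τ) *ᵥ z) := by
  rw [(h.hasSum_transpose_mul_mul M).tsum_eq]
  have h2 := (h.hasSum_transpose_mul_mul M).map
    (AddMonoidHom.mk' (fun N : Matrix (Fin p) (Fin p) ℝ => z ⬝ᵥ N *ᵥ z) fun a b => by
      simp [Matrix.add_mulVec, dotProduct_add])
    (by simp only [AddMonoidHom.mk'_apply]; fun_prop)
  refine h2.congr_fun fun τ => ?_
  simp only [Function.comp_apply, AddMonoidHom.mk'_apply]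
  rw [← mulVec_mulVec, ← mulVec_mulVec, dotProduct_mulVec z, vecMul_transpose]

theorem transpose_sum (h : HasCorr H K) {M : Matrix (Fin m) (Fin m) ℝ} (hM : Mᵀ = M) :
    (∑' τ, (H τ)ᵀ * M * H τ)ᵀ = ∑' τ, (H τ)ᵀ * M * H τ := by
  rw [(h.hasSum_transpose_mul_mul M).tsum_eq]
  ext i j
  simp only [Matrix.transpose_apply, Matrix.of_apply]
  rw [Finset.sum_comm]
  refine Finset.sum_congr rfl fun c _ => Finset.sum_congr rfl fun d _ => ?_
  rw [h.symm]
  congr 1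
  exact congrFun (congrFun hM d) c

theorem posSemidef_Pmat (h : HasCorr H K) {W : Matrix (Fin m) (Fin m) ℝ} (hW : W.PosDef) :
    (Pmat H W).PosSemidef := by
  have hWi := hW.inv
  have hWt : (W⁻¹)ᵀ = W⁻¹ := by
    have := hWi.isHermitian
    rwa [Matrix.IsHermitian, Matrix.conjTranspose_eq_transpose_of_trivial] at this
  refine posSemidef_of_quad_nonneg (h.transpose_sum hWt) fun z => ?_
  exact (h.quad_sum W⁻¹ z).nonneg fun τ => PosSemidef.quad_nonneg hWi.posSemidef _

/-- The lower bound of `X` is inherited by `𝒳`: the term `τ = 0` completes the block quadratic form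
of `X` at `(H_0 z, z)`, and the others are nonnegative. -/
theorem quad_Xmat_lower (h : HasCorr H K) {X : Matrix (Fin m ⊕ Fin p) (Fin m ⊕ Fin p) ℝ}
    {κ : ℝ} (hκ : 0 ≤ κ) (hX : ∀ x, κ * (x ⬝ᵥ x) ≤ x ⬝ᵥ X *ᵥ x) (z : Fin p → ℝ) :
    κ * (z ⬝ᵥ z) ≤ z ⬝ᵥ Xmat H X *ᵥ z := by
  have hblock : ∀ (u : Fin m → ℝ) (v : Fin p → ℝ), Sum.elim u v ⬝ᵥ X *ᵥ Sum.elim u v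
      = u ⬝ᵥ X.toBlocks₁₁ *ᵥ u + u ⬝ᵥ X.toBlocks₁₂ *ᵥ v + v ⬝ᵥ X.toBlocks₂₁ *ᵥ u
        + v ⬝ᵥ X.toBlocks₂₂ *ᵥ v := by
    intro u v
    conv_lhs => rw [← Matrix.fromBlocks_toBlocks X, Matrix.fromBlocks_mulVec]
    rw [sumElim_dotProduct_sumElim]
    simp only [Sum.elim_comp_inl, Sum.elim_comp_inr, dotProduct_add]
    ring
  have hnn : ∀ u : Fin m → ℝ, 0 ≤ u ⬝ᵥ X.toBlocks₁₁ *ᵥ u := by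
    intro u
    have h1 := hX (Sum.elim u 0)
    rw [hblock] at h1
    simp only [mulVec_zero, dotProduct_zero, zero_dotProduct, add_zero] at h1
    refine le_trans (mul_nonneg hκ ?_) h1
    exact Finset.sum_nonneg fun i _ => mul_self_nonneg _
  have h0 := le_hasSum (h.quad_sum X.toBlocks₁₁ z) 0 fun τ _ => hnn _
  have h1 := hX (Sum.elim (H 0 *ᵥ z) z)
  rw [hblock] at h1
  have h2 : z ⬝ᵥ Xmat H X *ᵥ z = z ⬝ᵥ (∑' τ, (H τ)ᵀ * X.toBlocks₁₁ * H τ) *ᵥ z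
      + (H 0 *ᵥ z) ⬝ᵥ X.toBlocks₁₂ *ᵥ z + z ⬝ᵥ X.toBlocks₂₁ *ᵥ (H 0 *ᵥ z)
      + z ⬝ᵥ X.toBlocks₂₂ *ᵥ z := by
    rw [Xmat]
    simp only [add_mulVec, dotProduct_add]
    rw [← mulVec_mulVec, ← mulVec_mulVec, dotProduct_mulVec z (H 0)ᵀ, vecMul_transpose]
  have h3 : Sum.elim (H 0 *ᵥ z) z ⬝ᵥ Sum.elim (H 0 *ᵥ z) z
      = (H 0 *ᵥ z) ⬝ᵥ (H 0 *ᵥ z) + z ⬝ᵥ z := sumElim_dotProduct_sumElim _ _ _ _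
  have h4 : 0 ≤ (H 0 *ᵥ z) ⬝ᵥ (H 0 *ᵥ z) := Finset.sum_nonneg fun i _ => mul_self_nonneg _
  rw [h3] at h1
  rw [h2]
  have h5 := mul_nonneg hκ h4
  linarith

theorem transpose_Xmat (h : HasCorr H K) {X : Matrix (Fin m ⊕ Fin p) (Fin m ⊕ Fin p) ℝ}
    (hX : Xᵀ = X) : (Xmat H X)ᵀ = Xmat H X := by
  have h11 : (X.toBlocks₁₁)ᵀ = X.toBlocks₁₁ := by
    ext i j; exact congrFun (congrFun hX (Sum.inl i)) (Sum.inl j)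
  have h22 : (X.toBlocks₂₂)ᵀ = X.toBlocks₂₂ := by
    ext i j; exact congrFun (congrFun hX (Sum.inr i)) (Sum.inr j)
  have h12 : (X.toBlocks₁₂)ᵀ = X.toBlocks₂₁ := by
    ext i j; exact congrFun (congrFun hX (Sum.inr i)) (Sum.inl j)
  rw [Xmat, transpose_add, transpose_add, transpose_add, h.transpose_sum h11, h22,
    transpose_mul, transpose_mul, transpose_transpose, h12, ← h12, transpose_transpose]
  abel

end HasCorr

/-! ### Fitted models -/

theorem fittedH_apply {q : ℕ} (lam : Fin q → ℂ) (Om : Fin q → Matrix (Fin m) (Fin p) ℂ) (τ : ℕ)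
    (a : Fin m) (b : Fin p) : fittedH lam Om τ a b = (∑ i, lam i ^ τ * Om i a b).re := by
  simp [fittedH, Matrix.sum_apply]

/-- Two geometric series, from `Re a · Re b = Re (a b + a b̄) / 2`. -/
theorem hasSum_re_mul_re {x y u w : ℂ} (hx : ‖x‖ < 1) (hy : ‖y‖ < 1) :
    HasSum (fun τ : ℕ => (x ^ τ * u).re * (y ^ τ * w).re)
      ((u * w * (1 - x * y)⁻¹ + u * star w * (1 - x * star y)⁻¹).re / 2) := by
  have hxy : ‖x * y‖ < 1 := by
    rw [norm_mul]; exact mul_lt_one_of_nonneg_of_lt_one_left (norm_nonneg _) hx hy.le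
  have hxy' : ‖x * star y‖ < 1 := by
    rw [norm_mul, norm_star]; exact mul_lt_one_of_nonneg_of_lt_one_left (norm_nonneg _) hx hy.le
  have h1 := ((hasSum_geometric_of_norm_lt_one hxy).mul_left (u * w)).add
    ((hasSum_geometric_of_norm_lt_one hxy').mul_left (u * star w))
  refine ((Complex.hasSum_re h1).div_const 2).congr_fun fun τ => ?_
  have h2 : (x ^ τ * u).re * (y ^ τ * w).re
      = ((x ^ τ * u) * (y ^ τ * w) + (x ^ τ * u) * star (y ^ τ * w)).re / 2 := by
    simp only [Complex.add_re, Complex.mul_re, Complex.star_def, Complex.conj_re, Complex.conj_im]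
    ring
  rw [h2, star_mul', star_pow, mul_pow, mul_pow]
  congr 2
  ring

/-- The correlations of a fitted model are rational functions of its poles and residues. -/
def fitCorr {q : ℕ} (lam : Fin q → ℂ) (Om : Fin q → Matrix (Fin m) (Fin p) ℂ)
    (a : Fin m) (b : Fin p) (a' : Fin m) (b' : Fin p) : ℝ :=
  ∑ i, ∑ j, (Om i a b * Om j a' b' * (1 - lam i * lam j)⁻¹
    + Om i a b * star (Om j a' b') * (1 - lam i * star (lam j))⁻¹).re / 2

theorem hasCorr_fittedH {q : ℕ} {lam : Fin q → ℂ} (hlam : ∀ i, ‖lam i‖ < 1)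
    (Om : Fin q → Matrix (Fin m) (Fin p) ℂ) : HasCorr (fittedH lam Om) (fitCorr lam Om) := by
  intro a b a' b'
  simp only [fittedH_apply, Complex.re_sum, Finset.sum_mul_sum]
  unfold fitCorr
  exact hasSum_sum fun i _ => hasSum_sum fun j _ => hasSum_re_mul_re (hlam i) (hlam j)

theorem growth_inv_sub_inv {c : ℝ} (hc : c < 0) {f : ℕ → ℂ} {x : ℂ} (hx : x ≠ 0)
    (hf : Growth c fun k => f k - x) : Growth c fun k => (f k)⁻¹ - x⁻¹ := by
  have hlim := hf.tendsto hc
  have h1 : Growth 0 fun k => (f k)⁻¹ := Growth.of_tendsto (hlim.inv₀ hx)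
  refine ((h1.mul_left_bdd hf.neg).mul_const x⁻¹).congr' ?_
  filter_upwards [hlim.eventually_ne hx] with k hk
  field_simp
  ring

theorem growth_fitCorr {q : ℕ} {c : ℝ} (hc : c < 0) {lam : ℕ → Fin q → ℂ} {ev : Fin q → ℂ}
    (hev : ∀ i, ‖ev i‖ < 1) (hlam : ∀ i, Growth c fun k => lam k i - ev i)
    {Om : ℕ → Fin q → Matrix (Fin m) (Fin p) ℂ} {R : Fin q → Matrix (Fin m) (Fin p) ℂ}
    (hOm : ∀ i, MGrowth c fun k => Om k i - R i) (a b a' b') :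
    Growth c fun k => fitCorr (lam k) (Om k) a b a' b' - fitCorr ev R a b a' b' := by
  simp only [fitCorr, ← Finset.sum_sub_distrib]
  refine Growth.sum _ fun i _ => Growth.sum _ fun j _ => ?_
  have hne : ∀ {x y : ℂ}, ‖x‖ < 1 → ‖y‖ < 1 → 1 - x * y ≠ 0 := fun {x y} hx hy h0 => by
    have h1 : ‖x * y‖ < 1 := by
      rw [norm_mul]; exact mul_lt_one_of_nonneg_of_lt_one_left (norm_nonneg _) hx hy.le
    rw [← sub_eq_zero.1 h0, norm_one] at h1
    exact lt_irrefl _ h1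
  have hinv : ∀ {f : ℕ → ℂ} {y : ℂ}, ‖y‖ < 1 → (Growth c fun k => f k - y) →
      Growth c fun k => (1 - lam k i * f k)⁻¹ - (1 - ev i * y)⁻¹ := fun {f y} hy hf => by
    refine growth_inv_sub_inv hc (hne (hev i) hy) ?_
    refine ((hlam i).mul_sub_mul hc.le hf).neg.congr' (Eventually.of_forall fun k => ?_)
    simp only; ring
  have hstar : ∀ {f : ℕ → ℂ} {y : ℂ}, (Growth c fun k => f k - y) →
      Growth c fun k => star (f k) - star y := fun {f y} hf => by
    simpa only [star_sub] using hf.star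
  have h1 := (((hOm i a b).mul_sub_mul hc.le (hOm j a' b')).mul_sub_mul hc.le
    (hinv (hev j) (hlam j)))
  have h2 := (((hOm i a b).mul_sub_mul hc.le (hstar (hOm j a' b'))).mul_sub_mul hc.le
    (hinv (y := star (ev j)) (by rw [norm_star]; exact hev j) (hstar (hlam j))))
  have h3 := ((h1.add h2).re).mul_const (1 / 2)
  refine h3.congr' (Eventually.of_forall fun k => ?_)
  simp only [Complex.add_re, Complex.sub_re]
  ring

theorem growth_Pmat {c : ℝ} (hc : c < 0) {H' : ℕ → ℕ → Matrix (Fin m) (Fin p) ℝ}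
    {H : ℕ → Matrix (Fin m) (Fin p) ℝ} {K' : ℕ → Fin m → Fin p → Fin m → Fin p → ℝ}
    {K : Fin m → Fin p → Fin m → Fin p → ℝ} (h' : ∀ᶠ k in atTop, HasCorr (H' k) (K' k))
    (h : HasCorr H K) (hK : ∀ a b a' b', Growth c fun k => K' k a b a' b' - K a b a' b')
    {W' : ℕ → Matrix (Fin m) (Fin m) ℝ} {W : Matrix (Fin m) (Fin m) ℝ} (hW : IsUnit W.det)
    (hWg : MGrowth c fun k => W' k - W) : MGrowth c fun k => Pmat (H' k) (W' k) - Pmat H W := by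
  intro i j
  have h1 : Growth c fun k => ∑ d, ∑ e, (K' k e i d j * (W' k)⁻¹ e d - K e i d j * W⁻¹ e d) :=
    Growth.sum _ fun d _ => Growth.sum _ fun e _ =>
      (hK e i d j).mul_sub_mul hc.le (MGrowth.inv_sub_inv hc hWg hW e d)
  refine h1.congr' ?_
  filter_upwards [h'] with k hk
  rw [Matrix.sub_apply, hk.Pmat_apply, h.Pmat_apply]
  simp only [Finset.sum_sub_distrib]

theorem growth_Xmat {c : ℝ} {H' : ℕ → ℕ → Matrix (Fin m) (Fin p) ℝ}
    {H : ℕ → Matrix (Fin m) (Fin p) ℝ} {K' : ℕ → Fin m → Fin p → Fin m → Fin p → ℝ}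
    {K : Fin m → Fin p → Fin m → Fin p → ℝ} (h' : ∀ᶠ k in atTop, HasCorr (H' k) (K' k))
    (h : HasCorr H K) (hK : ∀ a b a' b', Growth c fun k => K' k a b a' b' - K a b a' b')
    (h0 : MGrowth c fun k => H' k 0 - H 0) (X : Matrix (Fin m ⊕ Fin p) (Fin m ⊕ Fin p) ℝ) :
    MGrowth c fun k => Xmat (H' k) X - Xmat H X := by
  intro i j
  have h1 : Growth c fun k => ∑ d, ∑ e, (K' k e i d j - K e i d j) * X.toBlocks₁₁ e d :=
    Growth.sum _ fun d _ => Growth.sum _ fun e _ => (hK e i d j).mul_const _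
  have h2 := (h0.transpose.mul_right_bdd (MGrowth.const X.toBlocks₁₂)) i j
  have h3 := ((MGrowth.const X.toBlocks₂₁).mul_left_bdd h0) i j
  refine ((h1.add h2).add h3).congr' ?_
  filter_upwards [h'] with k hk
  rw [Matrix.sub_apply, hk.Xmat_apply, h.Xmat_apply]
  simp only [sub_mul, Finset.sum_sub_distrib, Matrix.transpose_sub, Matrix.sub_mul, Matrix.mul_sub,
    Matrix.sub_apply]
  ring

theorem growth_fittedH_zero {q : ℕ} {c : ℝ} (lam : ℕ → Fin q → ℂ) (ev : Fin q → ℂ)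
    {Om : ℕ → Fin q → Matrix (Fin m) (Fin p) ℂ} {R : Fin q → Matrix (Fin m) (Fin p) ℂ}
    (hOm : ∀ i, MGrowth c fun k => Om k i - R i) :
    MGrowth c fun k => fittedH (lam k) (Om k) 0 - fittedH ev R 0 := by
  intro a b
  refine (Growth.sum Finset.univ fun i _ => hOm i a b).re.congr' (Eventually.of_forall fun k => ?_)
  simp [fittedH_apply]

theorem IsModal.H_eq_fittedH {S : LinSys n m p} {ev : Fin (numEigenvalues S.A) → ℂ}
    {E : Fin (numEigenvalues S.A) → Matrix (Fin n) (Fin n) ℂ} (h : IsModal S.A ev E)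
    (σ : Equiv.Perm (Fin (numEigenvalues S.A))) :
    S.H = fittedH (fun i => ev (σ i)) (fun i => residue S E (σ i)) := by
  funext τ
  ext a b
  rw [fittedH_apply, Equiv.sum_comp σ fun i => ev i ^ τ * residue S E i a b, ← h.H_apply,
    Complex.ofReal_re]

/-- The semidefinite program for the optimal covariance, in terms of `𝒫` and `𝒳`. -/
theorem isOptimalCov_iff {S : LinSys n m p} {K : Fin m → Fin p → Fin m → Fin p → ℝ}
    (h : HasCorr S.H K) (W : Matrix (Fin m) (Fin m) ℝ)
    (X : Matrix (Fin m ⊕ Fin p) (Fin m ⊕ Fin p) ℝ) (δ : ℝ) (U : Matrix (Fin p) (Fin p) ℝ) :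
    S.IsOptimalCov W X δ U ↔ IsArgmax (Pmat S.H W) (Xmat S.H X) δ U := by
  have h1 : ∀ V, (S.respCov V * W⁻¹).trace = (V * Pmat S.H W).trace := fun V =>
    h.trace_mul_sum V W⁻¹
  have h2 : ∀ V, (X * S.jointCov V).trace = (V * Xmat S.H X).trace := by
    intro V
    have h3 := h.trace_mul_sum V X.toBlocks₁₁
    conv_lhs => rw [← Matrix.fromBlocks_toBlocks X]
    have htr : ∀ (M : Matrix (Fin m) (Fin m) ℝ) (N : Matrix (Fin m) (Fin p) ℝ)
        (N' : Matrix (Fin p) (Fin m) ℝ) (M' : Matrix (Fin p) (Fin p) ℝ),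
        (Matrix.fromBlocks M N N' M').trace = M.trace + M'.trace := fun M N N' M' => by
      simp [Matrix.trace, Fintype.sum_sum_type]
    rw [LinSys.jointCov, Matrix.fromBlocks_multiply, htr, Xmat]
    simp only [Matrix.mul_add, trace_add]
    rw [← h3, LinSys.respCov, Matrix.trace_mul_comm X.toBlocks₁₁,
      Matrix.trace_mul_comm X.toBlocks₂₂, Matrix.trace_mul_comm X.toBlocks₁₂,
      ← Matrix.mul_assoc X.toBlocks₂₁, Matrix.trace_mul_comm (X.toBlocks₂₁ * S.H 0),
      Matrix.mul_assoc V (S.H 0)ᵀ]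
    ring
  simp only [LinSys.IsOptimalCov, IsArgmax, h1, h2]

end Functionals

/-! ### The optimal covariance -/

section Optimum

variable {n m p : ℕ} {S : LinSys n m p} {ev : Fin (numEigenvalues S.A) → ℂ}
  {E : Fin (numEigenvalues S.A) → Matrix (Fin n) (Fin n) ℂ}

theorem PosDef.transpose_eq {r : Type*} [Fintype r] {X : Matrix r r ℝ} (hX : X.PosDef) :
    Xᵀ = X := by
  have := hX.isHermitian
  rwa [Matrix.IsHermitian, Matrix.conjTranspose_eq_transpose_of_trivial] at this

theorem HasCorr.posDef_Xmat {H : ℕ → Matrix (Fin m) (Fin p) ℝ}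
    {K : Fin m → Fin p → Fin m → Fin p → ℝ} (h : HasCorr H K)
    {X : Matrix (Fin m ⊕ Fin p) (Fin m ⊕ Fin p) ℝ} (hX : X.PosDef) : (Xmat H X).PosDef := by
  obtain ⟨κ, hκ, hlow⟩ := PosDef.exists_lower_bound hX
  refine Matrix.PosDef.of_dotProduct_mulVec_pos ?_ fun x hx => ?_
  · rw [Matrix.IsHermitian, Matrix.conjTranspose_eq_transpose_of_trivial,
      h.transpose_Xmat (PosDef.transpose_eq hX)]
  · rw [star_trivial]
    refine lt_of_lt_of_le (mul_pos hκ ?_) (h.quad_Xmat_lower hκ.le hlow x)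
    have h1 : 0 ≤ x ⬝ᵥ x := Finset.sum_nonneg fun j _ => mul_self_nonneg _
    exact lt_of_le_of_ne h1 fun h => hx (dotProduct_self_eq_zero.1 h.symm)

theorem IsModal.hasCorr (h : IsModal S.A ev E) (hlt : ∀ i, ‖ev i‖ < 1) :
    HasCorr S.H (fitCorr ev (residue S E)) := by
  have := hasCorr_fittedH hlt (residue S E)
  have h1 := h.H_eq_fittedH (Equiv.refl _)
  simp only [Equiv.refl_apply] at h1
  rwa [← h1] at this

theorem IsModal.exists_quad_Pmat_pos (h : IsModal S.A ev E) (hn : 0 < n)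
    (hlt : ∀ i, ‖ev i‖ < 1) (hobs : Observable S.A S.C) (hctr : Controllable S.A S.B)
    {W : Matrix (Fin m) (Fin m) ℝ} (hW : W.PosDef) : ∃ x, 0 < x ⬝ᵥ Pmat S.H W *ᵥ x := by
  obtain ⟨τ, a, b, hab⟩ : ∃ τ a b, S.H τ a b ≠ 0 := by
    by_contra! hcon
    have := h.eval_eq_zero_of_sum_H hobs hctr {()} (fun _ => 1) (fun _ => 0)
      (fun s _ a b => by simp [hcon]) ⟨0, numEigenvalues_pos hn⟩
    simp at this
  refine ⟨Pi.single b 1, ?_⟩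
  have hWi := hW.inv
  have hsum := (h.hasCorr hlt).quad_sum W⁻¹ (Pi.single b 1)
  have h1 := le_hasSum hsum τ fun _ _ => PosSemidef.quad_nonneg hWi.posSemidef _
  refine lt_of_lt_of_le (PosDef.quad_pos hWi fun h0 => hab ?_) h1
  have := congrFun h0 a
  simpa using this

/-- The optimal covariance exists, and it is approached at a linear rate by the solutions of
perturbed problems. -/
theorem IsModal.exists_optimum (h : IsModal S.A ev E) (hn : 0 < n) (hlt : ∀ i, ‖ev i‖ < 1)
    (hobs : Observable S.A S.C) (hctr : Controllable S.A S.B)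
    {W : Matrix (Fin m) (Fin m) ℝ} (hW : W.PosDef)
    {X : Matrix (Fin m ⊕ Fin p) (Fin m ⊕ Fin p) ℝ} (hX : X.PosDef)
    (hmax : HasUniqueMaxEigenvalue ((Xmat S.H X)⁻¹ * Pmat S.H W)) {δ : ℝ} (hδ : 0 < δ) :
    ∃ U, IsArgmax (Pmat S.H W) (Xmat S.H X) δ U ∧
      IsLipschitzOptimum (Pmat S.H W) (Xmat S.H X) δ U := by
  have hcorr := h.hasCorr hlt
  have hXp := hcorr.posDef_Xmat hX
  obtain ⟨μ, c, z, hc, hz, hMz, hle, hgap⟩ :=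
    exists_spectral_gap (hcorr.posSemidef_Pmat hW) hXp hmax
  have hμ : 0 < μ := by
    obtain ⟨x, hx⟩ := h.exists_quad_Pmat_pos hn hlt hobs hctr hW
    have h1 := hx.trans_le (hle x)
    have h2 := PosSemidef.quad_nonneg hXp.posSemidef x
    exact pos_of_mul_pos_left h1 h2
  obtain ⟨κ, hκ, hlow⟩ := PosDef.exists_lower_bound hXp
  have hzX : 0 < z ⬝ᵥ Xmat S.H X *ᵥ z := PosDef.quad_pos hXp (by rintro rfl; simp at hz)
  exact ⟨_, isArgmax_vecMulVec hδ.le hμ.le hc.le hzX hMz hgap,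
    IsArgmax.lipschitz hδ hμ hc hκ hz hlow hMz hgap⟩

/-- The solution of the unperturbed problem is unique, by the Lipschitz bound without
perturbation. -/
theorem IsLipschitzOptimum.eq {P X : Matrix (Fin p) (Fin p) ℝ} {δ : ℝ}
    {U V : Matrix (Fin p) (Fin p) ℝ} (h : IsLipschitzOptimum P X δ U)
    (hV : IsArgmax P X δ V) : V = U := by
  obtain ⟨C, e₀, he₀, hlip⟩ := h
  ext i j
  have := hlip P X V 0 he₀.le (by simp) (by simp) hV i j
  rw [mul_zero, abs_nonpos_iff, Matrix.sub_apply, sub_eq_zero] at this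
  exact this

end Optimum

/-! ### Convergence along a trajectory -/

section Path

variable {n m p : ℕ}

theorem growth_trace_stack {c : ℝ} (hc : c ≤ 0) (q : ℕ) {G : ℕ → ℕ → Matrix (Fin m) (Fin p) ℝ}
    {H : ℕ → Matrix (Fin m) (Fin p) ℝ} (hG : ∀ τ, MGrowth c fun k => G k τ - H τ) (i j : ℕ) :
    Growth c fun k => ((stack q (G k) i)ᵀ * stack q (G k) j).trace
      - ((stack q H i)ᵀ * stack q H j).trace := by
  simp only [trace_stack, ← Finset.sum_sub_distrib]
  exact Growth.sum _ fun b _ => Growth.sum _ fun s _ => (hG _ _ _).mul_sub_mul hc (hG _ _ _)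

theorem growth_coeffEst {c : ℝ} (hc : c < 0) (q : ℕ) {G : ℕ → ℕ → Matrix (Fin m) (Fin p) ℝ}
    {H : ℕ → Matrix (Fin m) (Fin p) ℝ} (hG : ∀ τ, MGrowth c fun k => G k τ - H τ)
    (hH : IsUnit (gram q H).det) (i : Fin q) :
    Growth c fun k => coeffEst q (G k) i - coeffEst q H i := by
  have h1 : MGrowth c fun k => gram q (G k) - gram q H := fun i j =>
    growth_trace_stack hc.le q hG i j
  have h2 := MGrowth.inv_sub_inv hc h1 hH
  have h3 := Growth.sum Finset.univ fun j _ =>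
    ((h2 i j).mul_sub_mul hc.le (growth_trace_stack hc.le q hG j q)).neg
  refine h3.congr' (Eventually.of_forall fun k => ?_)
  simp only [coeffEst, Pi.neg_apply, mulVec, dotProduct]
  rw [Finset.sum_neg_distrib, Finset.sum_sub_distrib]
  ring

variable {S : LinSys n m p} {ev : Fin (numEigenvalues S.A) → ℂ}
  {E : Fin (numEigenvalues S.A) → Matrix (Fin n) (Fin n) ℂ}

/-- Along a trajectory on which the estimated Markov parameters and the empirical noise covariance
converge at rate `k ^ c`, the chosen covariances converge at the same rate. -/
theorem IsModal.growth_argmax (h : IsModal S.A ev E) (hlt : ∀ i, ‖ev i‖ < 1)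
    (hobs : Observable S.A S.C) (hctr : Controllable S.A S.B)
    {W : Matrix (Fin m) (Fin m) ℝ} (hW : W.PosDef)
    {X : Matrix (Fin m ⊕ Fin p) (Fin m ⊕ Fin p) ℝ} {δ β : ℝ}
    {Uopt : Matrix (Fin p) (Fin p) ℝ}
    (hlip : IsLipschitzOptimum (Pmat S.H W) (Xmat S.H X) δ Uopt)
    {xi : Fin n → ℝ} {w : ℕ → Fin n → ℝ} {v : ℕ → Fin m → ℝ} {ζ : ℕ → Fin p → ℝ}
    {lam : ℕ → Fin (numEigenvalues S.A) → ℂ} {Ust : ℕ → Matrix (Fin p) (Fin p) ℝ}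
    {φ : ℕ → Fin p → ℝ} {y : ℕ → Fin m → ℝ}
    (hrun : IsRun S X δ β xi w v ζ lam Ust φ y) {c : ℝ} (hc : c < 0) (hc' : -(1 / 2) ≤ c)
    (hG : ∀ τ, MGrowth c fun k => markovEst y φ (appliedCov δ β Ust) k τ - S.H τ)
    (hφ : ∀ b, Growth 0 fun k => φ k b)
    (hθ : ∀ a, Growth 0 fun k => (S.C *ᵥ S.state xi 0 w k + v k) a)
    (hcov : ∀ a b, Growth (1 / 2) fun k => ∑ t ∈ Finset.range k,
      ((S.C *ᵥ S.state xi 0 w t + v t) a * (S.C *ᵥ S.state xi 0 w t + v t) b - W a b)) :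
    MGrowth c fun k => Ust k - Uopt := by
  set U := appliedCov δ β Ust with hU
  have hgu := h.isUnit_gram hobs hctr
  have hgram : MGrowth c fun k => gram (numEigenvalues S.A) (markovEst y φ U k)
      - gram (numEigenvalues S.A) S.H := fun i j => growth_trace_stack hc.le _ hG i j
  have hdef : ∀ᶠ k in atTop, PolyDefined (numEigenvalues S.A) y φ U k :=
    (eventually_ge_atTop _).and
      (MGrowth.eventually_isUnit_det (fun i j => (hgram i j).tendsto hc) hgu)
  -- the roots
  obtain ⟨σ, hσ⟩ : ∃ σ : Equiv.Perm (Fin (numEigenvalues S.A)),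
      ∀ i, Growth c fun k => lam k i - ev (σ i) := by
    refine exists_perm_growth_roots h.injective hc (v := fun k j => ∑ i,
      ((coeffEst (numEigenvalues S.A) (markovEst y φ U k) i
        - coeffEst (numEigenvalues S.A) S.H i : ℝ) : ℂ) * ev j ^ (i : ℕ)) ?_ (fun j => ?_) ?_
    · filter_upwards [hdef] with k hk j
      rw [prod_sub_roots (hrun.labelling.roots k hk), ← sub_zero (ev j ^ _ + _),
        ← h.eval_coeffEst hobs hctr j, add_sub_add_left_eq_sub, ← Finset.sum_sub_distrib]
      refine Finset.sum_congr rfl fun i _ => ?_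
      push_cast
      ring
    · exact Growth.sum _ fun i _ =>
        (Growth.ofReal_iff.2 (growth_coeffEst hc _ hG hgu i)).mul_const _
    · filter_upwards [hdef, (tendsto_add_atTop_nat 1).eventually hdef] with k hk hk'
      exact hrun.labelling.tracking k hk hk'
  have hlt' : ∀ i, ‖ev (σ i)‖ < 1 := fun i => hlt _
  -- the residues
  have hOm : ∀ i, MGrowth c fun k => omegaSeq y φ U lam k i - residue S E (σ i) := fun i =>
    growth_omegaEst hc (ev := fun i => ev (σ i)) (h.injective.comp σ.injective) hσ hG
      (Om := fun i => residue S E (σ i)) (fun τ a b => by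
        rw [Equiv.sum_comp σ fun i => ev i ^ τ * residue S E i a b, h.H_apply]) i
  -- the noise covariance
  have hWg : MGrowth c fun k => noiseCovSeq y φ U lam k - W := by
    refine growth_noiseCovEst hc hc' hθ (fun a => ?_) hcov
    refine (h.growth_phiHat_sub hlt hc hφ hσ hOm a).neg.congr' (Eventually.of_forall fun k => ?_)
    have h1 : y k = S.C *ᵥ S.state 0 φ 0 k + (S.C *ᵥ S.state xi 0 w k + v k) := by
      rw [hrun.output_eq, LinSys.output, S.state_eq_add, mulVec_add, add_assoc]
    simp only [h1, Pi.sub_apply, Pi.add_apply]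
    ring
  have hWu : IsUnit W.det := hW.isUnit.map Matrix.detMonoidHom
  have hlam1 : ∀ᶠ k in atTop, ∀ i, ‖lam k i‖ < 1 := by
    rw [eventually_all]; intro i
    exact ((hσ i).tendsto hc).norm.eventually (gt_mem_nhds (hlt' i))
  have hupd : ∀ᶠ k in atTop, UpdatesAt y φ U lam k := by
    filter_upwards [hdef, hlam1,
      MGrowth.eventually_isUnit_det (fun i j => (hWg i j).tendsto hc) hWu] with k hk1 hk2 hk3
    refine ⟨hk1, fun z hz => ?_, hk3⟩
    rw [← hrun.labelling.roots k hk1, Multiset.mem_map] at hz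
    obtain ⟨i, -, rfl⟩ := hz
    exact hk2 i
  -- the functionals
  have hHσ := h.H_eq_fittedH σ
  have hcorr' : ∀ᶠ k in atTop, HasCorr (fittedH (lam k) (omegaSeq y φ U lam k))
      (fitCorr (lam k) (omegaSeq y φ U lam k)) := hlam1.mono fun k hk => hasCorr_fittedH hk _
  have hcorr : HasCorr S.H (fitCorr (fun i => ev (σ i)) (fun i => residue S E (σ i))) := by
    rw [hHσ]; exact hasCorr_fittedH hlt' _
  have hKg := growth_fitCorr hc hlt' hσ hOm
  have hPg := growth_Pmat hc hcorr' hcorr hKg hWu hWg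
  have hXg := growth_Xmat hcorr' hcorr hKg (by
    have := growth_fittedH_zero (c := c) lam (fun i => ev (σ i)) hOm
    rwa [← hHσ] at this) X
  -- `e k` bounds the errors of both functionals
  obtain ⟨C, e₀, he₀, hlip⟩ := hlip
  set e : ℕ → ℝ := fun k => ∑ i, ∑ j,
    (‖(Pmat (fittedH (lam k) (omegaSeq y φ U lam k)) (noiseCovSeq y φ U lam k)
      - Pmat S.H W) i j‖ + ‖(Xmat (fittedH (lam k) (omegaSeq y φ U lam k)) X
      - Xmat S.H X) i j‖) with he
  have heg : Growth c e := Growth.sum _ fun i _ => Growth.sum _ fun j _ =>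
    (Growth.norm_growth.2 (hPg i j)).add (Growth.norm_growth.2 (hXg i j))
  have hele : ∀ k i j, ‖(Pmat (fittedH (lam k) (omegaSeq y φ U lam k)) (noiseCovSeq y φ U lam k)
      - Pmat S.H W) i j‖ + ‖(Xmat (fittedH (lam k) (omegaSeq y φ U lam k)) X
      - Xmat S.H X) i j‖ ≤ e k := fun k i j => by
    refine le_trans ?_ (Finset.single_le_sum (f := fun i => ∑ j,
      (‖(Pmat (fittedH (lam k) (omegaSeq y φ U lam k)) (noiseCovSeq y φ U lam k)
      - Pmat S.H W) i j‖ + ‖(Xmat (fittedH (lam k) (omegaSeq y φ U lam k)) X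
      - Xmat S.H X) i j‖)) (fun i _ => Finset.sum_nonneg fun j _ => by positivity)
      (Finset.mem_univ i))
    exact Finset.single_le_sum (f := fun j =>
      (‖(Pmat (fittedH (lam k) (omegaSeq y φ U lam k)) (noiseCovSeq y φ U lam k)
      - Pmat S.H W) i j‖ + ‖(Xmat (fittedH (lam k) (omegaSeq y φ U lam k)) X
      - Xmat S.H X) i j‖)) (fun j _ => by positivity) (Finset.mem_univ j)
  -- eventually the algorithm updates at every step, and the maximizer chosen at time `k + 1` is
  -- that of the model fitted at time `k`
  intro i j
  refine Growth.of_shift 1 (heg.of_isBigO (Asymptotics.IsBigO.of_bound |C| ?_))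
  filter_upwards [hupd, (heg.tendsto_zero hc).eventually (gt_mem_nhds he₀)] with k hk hek
  have hest : estimates X y φ U lam (k + 1)
      = (Pmat (fittedH (lam k) (omegaSeq y φ U lam k)) (noiseCovSeq y φ U lam k),
        Xmat (fittedH (lam k) (omegaSeq y φ U lam k)) X) := by
    rw [estimates, if_pos hk]
  have harg := hrun.argmax (k + 1)
  rw [← hU, hest] at harg
  have h1 := hlip _ _ _ (e k) hek.le
    (fun i j => (le_add_of_nonneg_right (norm_nonneg _)).trans (hele k i j))
    (fun i j => (le_add_of_nonneg_left (norm_nonneg _)).trans (hele k i j)) harg i j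
  have he0 : 0 ≤ e k := Finset.sum_nonneg fun i _ => Finset.sum_nonneg fun j _ => by positivity
  rw [Real.norm_eq_abs, Real.norm_of_nonneg he0]
  exact h1.trans (mul_le_mul_of_nonneg_right (le_abs_self C) he0)

/-- The covariances chosen by the algorithm are bounded: every estimate of `𝒳` is bounded below
by the smallest eigenvalue of `X`. -/
theorem IsRun.trace_le {X : Matrix (Fin m ⊕ Fin p) (Fin m ⊕ Fin p) ℝ} {δ β : ℝ}
    {xi : Fin n → ℝ} {w : ℕ → Fin n → ℝ} {v : ℕ → Fin m → ℝ} {ζ : ℕ → Fin p → ℝ}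
    {lam : ℕ → Fin (numEigenvalues S.A) → ℂ} {Ust : ℕ → Matrix (Fin p) (Fin p) ℝ}
    {φ : ℕ → Fin p → ℝ} {y : ℕ → Fin m → ℝ} (hrun : IsRun S X δ β xi w v ζ lam Ust φ y)
    {κ : ℝ} (hκ : 0 < κ) (hX : ∀ x, κ * (x ⬝ᵥ x) ≤ x ⬝ᵥ X *ᵥ x) (k : ℕ) :
    (Ust k).trace ≤ δ / κ := by
  have hlow : ∀ k x, κ * (x ⬝ᵥ x)
      ≤ x ⬝ᵥ (estimates X y φ (appliedCov δ β Ust) lam k).2 *ᵥ x := by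
    intro k
    induction k with
    | zero =>
      intro x
      have h0 : HasCorr (0 : ℕ → Matrix (Fin m) (Fin p) ℝ) (fun _ _ _ _ => 0) := fun _ _ _ _ => by
        simp [hasSum_zero]
      have := h0.quad_Xmat_lower hκ.le hX x
      simpa [Xmat, estimates] using this
    | succ k ih =>
      intro x
      rw [estimates]
      split_ifs with hk
      · refine (hasCorr_fittedH (fun i => hk.2.1 _ ?_) _).quad_Xmat_lower hκ.le hX x
        rw [← hrun.labelling.roots k hk.1]
        exact Multiset.mem_map_of_mem _ (Finset.mem_univ i)
      · exact ih x
  have h1 := PosSemidef.mul_trace_le (hrun.argmax k).1.1 (hlow k)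
  rw [le_div_iff₀ hκ, mul_comm]
  exact h1.trans (hrun.argmax k).1.2

end Path

/-! ### The random inputs -/

section Inputs

variable {Ω : Type*} [mΩ : MeasurableSpace Ω] {μ : Measure Ω}

/-- Random variables with uniformly bounded moments of all orders. -/
structure HasMoments (μ : Measure Ω) (Z : ℕ → Ω → ℝ) : Prop where
  measurable : ∀ k, Measurable (Z k)
  bound : ∀ r : ℕ, ∃ C, ∀ k, Integrable (fun ω => |Z k ω| ^ r) μ ∧ ∫ ω, |Z k ω| ^ r ∂μ ≤ C

namespace HasMoments

variable {Y Z : ℕ → Ω → ℝ}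

theorem of_le [IsProbabilityMeasure μ] (hY : ∀ k, Measurable (Y k))
    (h : ∀ r : ℕ, ∃ (F : ℕ → Ω → ℝ) (C : ℝ), (∀ k, Integrable (F k) μ) ∧
      (∀ k, ∫ ω, F k ω ∂μ ≤ C) ∧ ∀ k ω, |Y k ω| ^ r ≤ F k ω) : HasMoments μ Y := by
  refine ⟨hY, fun r => ?_⟩
  obtain ⟨F, C, hF, hC, hle⟩ := h r
  refine ⟨C, fun k => ?_⟩
  have hi : Integrable (fun ω => |Y k ω| ^ r) μ :=
    (hF k).mono' ((continuous_abs.measurable.comp (hY k)).pow_const r).aestronglyMeasurable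
      (Eventually.of_forall fun ω => by
        rw [Real.norm_of_nonneg (by positivity)]; exact hle k ω)
  exact ⟨hi, (integral_mono hi (hF k) (hle k)).trans (hC k)⟩

theorem mul [IsProbabilityMeasure μ] (hY : HasMoments μ Y) (hZ : HasMoments μ Z) :
    HasMoments μ fun k ω => Y k ω * Z k ω := by
  refine of_le (fun k => (hY.measurable k).mul (hZ.measurable k)) fun r => ?_
  obtain ⟨C, hC⟩ := hY.bound (2 * r)
  obtain ⟨D, hD⟩ := hZ.bound (2 * r)
  refine ⟨fun k ω => |Y k ω| ^ (2 * r) + |Z k ω| ^ (2 * r), C + D,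
    fun k => (hC k).1.add (hD k).1, fun k => ?_, fun k ω => ?_⟩
  · rw [integral_add (hC k).1 (hD k).1]
    exact add_le_add (hC k).2 (hD k).2
  · beta_reduce
    rw [abs_mul, mul_pow, pow_mul', pow_mul']
    nlinarith [sq_nonneg (|Y k ω| ^ r - |Z k ω| ^ r), pow_nonneg (abs_nonneg (Y k ω)) r,
      pow_nonneg (abs_nonneg (Z k ω)) r]

theorem sub_const [IsProbabilityMeasure μ] (hY : HasMoments μ Y) (a : ℝ) :
    HasMoments μ fun k ω => Y k ω - a := by
  refine of_le (fun k => (hY.measurable k).sub_const a) fun r => ?_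
  obtain ⟨C, hC⟩ := hY.bound r
  refine ⟨fun k ω => 2 ^ (r - 1) * (|Y k ω| ^ r + |a| ^ r), 2 ^ (r - 1) * (C + |a| ^ r),
    fun k => ((hC k).1.add (integrable_const _)).const_mul _, fun k => ?_, fun k ω => ?_⟩
  · rw [integral_const_mul, integral_add (hC k).1 (integrable_const _)]
    have := (hC k).2
    simp only [integral_const, probReal_univ, one_smul]
    gcongr
  · have h1 : |Y k ω - a| ≤ |Y k ω| + |a| := abs_sub _ _
    exact (pow_le_pow_left₀ (abs_nonneg _) h1 r).trans
      (add_pow_le (abs_nonneg _) (abs_nonneg _) r)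

theorem sq_bound (hY : HasMoments μ Y) :
    ∃ C, ∀ k, MemLp (Y k) 2 μ ∧ ∫ ω, Y k ω ^ 2 ∂μ ≤ C := by
  obtain ⟨C, hC⟩ := hY.bound 2
  simp only [sq_abs] at hC
  exact ⟨C, fun k => ⟨(memLp_two_iff_integrable_sq (hY.measurable k).aestronglyMeasurable).2
    (hC k).1, (hC k).2⟩⟩

theorem integrable (hY : HasMoments μ Y) (k : ℕ) : Integrable (Y k) μ := by
  obtain ⟨C, hC⟩ := hY.bound 1
  have := (hC k).1
  simp only [pow_one] at this
  exact (integrable_norm_iff (hY.measurable k).aestronglyMeasurable).1 this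

theorem ae_growth [IsProbabilityMeasure μ] (hY : HasMoments μ Y) :
    ∀ᵐ ω ∂μ, Growth 0 fun k => Y k ω := ae_growth_zero_of_moments hY.bound

end HasMoments

section Gaussian

variable {d : ℕ} {Q : Matrix (Fin d) (Fin d) ℝ} {Z : ℕ → Ω → Fin d → ℝ}

theorem IsCentredGaussian.hasMoments (h : ∀ k, IsCentredGaussian μ (Z k) Q) (i : Fin d) :
    HasMoments μ fun k ω => Z k ω i := by
  refine ⟨fun k => (measurable_pi_apply i).comp (h k).1, fun r => ?_⟩
  have hg : MemLp (fun x : EuclideanSpace ℝ (Fin d) => x i) r (multivariateGaussian 0 Q) :=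
    (IsGaussian.memLp_id (multivariateGaussian 0 Q) r (by simp)).of_le
      (by fun_prop) (Eventually.of_forall fun x => PiLp.norm_apply_le x i)
  have hgi : Integrable (fun x : EuclideanSpace ℝ (Fin d) => |x i| ^ r)
      (multivariateGaussian 0 Q) := hg.integrable_norm_pow'
  refine ⟨∫ x : EuclideanSpace ℝ (Fin d), |x i| ^ r ∂multivariateGaussian 0 Q, fun k => ⟨?_, ?_⟩⟩
  · have h1 := hgi
    rw [← (h k).2.map_eq] at h1
    exact (integrable_map_measure h1.aestronglyMeasurable (h k).2.aemeasurable).1 h1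
  · exact le_of_eq ((h k).2.integral_comp (f := fun x : EuclideanSpace ℝ (Fin d) => |x i| ^ r)
      hgi.aestronglyMeasurable)

theorem IsCentredGaussian.integral_apply {Z : Ω → Fin d → ℝ} (h : IsCentredGaussian μ Z Q)
    (i : Fin d) : ∫ ω, Z ω i ∂μ = 0 := by
  have h1 := h.2.integral_comp (f := fun x : EuclideanSpace ℝ (Fin d) => x i)
    (by fun_prop)
  refine h1.trans ?_
  have h2 := integral_id_multivariateGaussian (μ := (0 : EuclideanSpace ℝ (Fin d))) (S := Q)
  have h3 := (EuclideanSpace.proj (𝕜 := ℝ) i).integral_comp_comm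
    ((IsGaussian.memLp_id (multivariateGaussian (0 : EuclideanSpace ℝ (Fin d)) Q) 1
      (by simp)).integrable le_rfl)
  simp only [id] at h3
  rw [h2] at h3
  simpa using h3

theorem IsCentredGaussian.integral_mul {Z : Ω → Fin d → ℝ} (h : IsCentredGaussian μ Z Q)
    (hQ : Q.PosSemidef) (i j : Fin d) : ∫ ω, Z ω i * Z ω j ∂μ = Q i j := by
  have h1 := h.2.integral_comp (f := fun x : EuclideanSpace ℝ (Fin d) => x i * x j)
    (by fun_prop)
  refine h1.trans ?_
  have h2 := covariance_eval_multivariateGaussian (μ := (0 : EuclideanSpace ℝ (Fin d))) hQ i j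
  have h0 : ∀ i, ∫ x : EuclideanSpace ℝ (Fin d), x i ∂multivariateGaussian 0 Q = 0 := fun i => by
    have h4 := h.2.integral_comp (f := fun x : EuclideanSpace ℝ (Fin d) => x i)
      (by fun_prop)
    rw [← h4]
    exact h.integral_apply i
  rw [covariance] at h2
  rw [← h2]
  simp only [h0, sub_zero]

end Gaussian

/-! ### Innovations -/

/-- Centred random variables, bounded in `L²`, each independent of the past. -/
structure IsInnovation (ℱ : Filtration ℕ mΩ) (μ : Measure Ω) (g : ℕ → Ω → ℝ) : Prop where
  measurable : ∀ k, Measurable[ℱ (k + 1)] (g k)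
  indep : ∀ k, Indep (MeasurableSpace.comap (g k) inferInstance) (ℱ k) μ
  mean : ∀ k, ∫ ω, g k ω ∂μ = 0
  bound : ∃ C, ∀ k, MemLp (g k) 2 μ ∧ ∫ ω, g k ω ^ 2 ∂μ ≤ C

/-- Martingale transforms: sums of the innovations `g_{s + r}` weighted by the past of time `s + r`
cancel up to a square root. -/
theorem IsInnovation.ae_growth [IsProbabilityMeasure μ] {ℱ : Filtration ℕ mΩ} {g : ℕ → Ω → ℝ}
    (hg : IsInnovation ℱ μ g) (r : ℕ) {a : ℕ → Ω → ℝ} {c : ℝ} (hc : 0 ≤ c)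
    (ha : ∀ s, Measurable[ℱ (s + r)] (a s)) (hac : ∀ᵐ ω ∂μ, Growth c fun s => a s ω) :
    ∀ᵐ ω ∂μ, Growth (c + 1 / 2) fun k => ∑ s ∈ Finset.range k, a s ω * g (s + r) ω := by
  obtain ⟨C, hC⟩ := hg.bound
  refine ae_growth_sum_mul (g := fun s => g (s + r)) ⟨fun s => ℱ (s + r),
    fun s t hst => ℱ.mono (Nat.add_le_add_right hst r), fun s => ℱ.le _⟩ hc ha hac (fun k => ?_)
    (fun k => hg.indep (k + r)) (fun k => (hC _).1) (fun k => hg.mean _) (fun k => (hC _).2)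
  have := hg.measurable (k + r)
  rwa [show k + r + 1 = k + 1 + r by omega] at this

variable {n m p : ℕ} {Sig Q : Matrix (Fin n) (Fin n) ℝ} {R : Matrix (Fin m) (Fin m) ℝ}
  {xi : Ω → Fin n → ℝ} {w : ℕ → Ω → Fin n → ℝ} {v : ℕ → Ω → Fin m → ℝ} {ζ : ℕ → Ω → Fin p → ℝ}

/-- The σ-algebra of the inputs at time `k`. -/
@[reducible] def presentSigma (w : ℕ → Ω → Fin n → ℝ) (v : ℕ → Ω → Fin m → ℝ)
    (ζ : ℕ → Ω → Fin p → ℝ) (k : ℕ) : MeasurableSpace Ω :=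
  MeasurableSpace.comap (w k) inferInstance ⊔ MeasurableSpace.comap (v k) inferInstance ⊔
    MeasurableSpace.comap (ζ k) inferInstance

omit mΩ in
theorem presentSigma_le_pastSigma {k l : ℕ} (h : k < l) :
    presentSigma w v ζ k ≤ pastSigma xi w v ζ l :=
  le_sup_of_le_right (le_iSup (fun t : Fin l => presentSigma w v ζ t) ⟨k, h⟩)

omit mΩ in
theorem pastSigma_mono : Monotone (pastSigma xi w v ζ) := fun _ _ hkl =>
  sup_le le_sup_left (iSup_le fun t => presentSigma_le_pastSigma (t.2.trans_le hkl))

namespace GaussianInputs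

variable (hin : GaussianInputs μ Sig Q R xi w v ζ)
include hin

theorem inputSigma_le (i) : inputSigma xi w v ζ i ≤ mΩ := by
  rcases i with _ | _ | _ | k
  · exact hin.init.1.comap_le
  · exact (hin.process _).1.comap_le
  · exact (hin.sensor _).1.comap_le
  · exact (hin.excitation _).1.comap_le

theorem presentSigma_le (k : ℕ) : presentSigma w v ζ k ≤ mΩ :=
  sup_le (sup_le (hin.process _).1.comap_le (hin.sensor _).1.comap_le)
    (hin.excitation _).1.comap_le

theorem pastSigma_le (k : ℕ) : pastSigma xi w v ζ k ≤ mΩ :=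
  sup_le hin.init.1.comap_le (iSup_le fun t => hin.presentSigma_le t)

/-- The filtration of the past. -/
def past : Filtration ℕ mΩ := ⟨pastSigma xi w v ζ, pastSigma_mono, hin.pastSigma_le⟩

/-- The inputs at time `k` are independent of the past. -/
theorem indep_present_past (k : ℕ) :
    Indep (presentSigma w v ζ k) (pastSigma xi w v ζ k) μ := by
  set P : Set (Unit ⊕ ℕ ⊕ ℕ ⊕ ℕ) := {.inr (.inl k), .inr (.inr (.inl k)), .inr (.inr (.inr k))}
    with hP
  have h1 := indep_iSup_of_disjoint hin.inputSigma_le hin.indep (S := P) (T := Pᶜ)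
    disjoint_compl_right
  have hle : ∀ (T : Set (Unit ⊕ ℕ ⊕ ℕ ⊕ ℕ)) (i), i ∈ T →
      inputSigma xi w v ζ i ≤ ⨆ i ∈ T, inputSigma xi w v ζ i := fun T i hi =>
    le_iSup₂_of_le i hi le_rfl
  refine indep_of_indep_of_le_left (indep_of_indep_of_le_right h1 ?_) ?_
  · refine sup_le (hle _ (.inl ()) (by simp [hP])) (iSup_le fun t => ?_)
    have ht : (t : ℕ) ≠ k := t.2.ne
    exact sup_le (sup_le (hle _ (.inr (.inl t)) (by simp [hP, ht]))
      (hle _ (.inr (.inr (.inl t))) (by simp [hP, ht])))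
      (hle _ (.inr (.inr (.inr t))) (by simp [hP, ht]))
  · exact sup_le (sup_le (hle _ (.inr (.inl k)) (by simp [hP]))
      (hle _ (.inr (.inr (.inl k))) (by simp [hP])))
      (hle _ (.inr (.inr (.inr k))) (by simp [hP]))

theorem isInnovation {g : ℕ → Ω → ℝ} (hg : ∀ k, Measurable[presentSigma w v ζ k] (g k))
    (hm : HasMoments μ g) (h0 : ∀ k, ∫ ω, g k ω ∂μ = 0) : IsInnovation hin.past μ g :=
  ⟨fun k => (hg k).mono (presentSigma_le_pastSigma (Nat.lt_succ_self k)) le_rfl,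
    fun k => indep_of_indep_of_le_left (hin.indep_present_past k) (hg k).comap_le, h0, hm.sq_bound⟩

omit mΩ hin in
theorem measurable_w (k : ℕ) (i : Fin n) :
    Measurable[presentSigma w v ζ k] fun ω => w k ω i :=
  ((measurable_pi_apply i).comp (comap_measurable (w k))).mono
    (le_sup_of_le_left le_sup_left) le_rfl

omit mΩ hin in
theorem measurable_v (k : ℕ) (i : Fin m) :
    Measurable[presentSigma w v ζ k] fun ω => v k ω i :=
  ((measurable_pi_apply i).comp (comap_measurable (v k))).mono
    (le_sup_of_le_left le_sup_right) le_rfl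

omit mΩ hin in
theorem measurable_ζ (k : ℕ) (i : Fin p) :
    Measurable[presentSigma w v ζ k] fun ω => ζ k ω i :=
  ((measurable_pi_apply i).comp (comap_measurable (ζ k))).mono le_sup_right le_rfl

theorem moments_w (i : Fin n) : HasMoments μ fun k ω => w k ω i :=
  IsCentredGaussian.hasMoments hin.process i

theorem moments_v (i : Fin m) : HasMoments μ fun k ω => v k ω i :=
  IsCentredGaussian.hasMoments hin.sensor i

theorem moments_ζ (i : Fin p) : HasMoments μ fun k ω => ζ k ω i :=
  IsCentredGaussian.hasMoments hin.excitation i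

theorem innov_w (i : Fin n) : IsInnovation hin.past μ fun k ω => w k ω i :=
  hin.isInnovation (fun k => measurable_w k i) (hin.moments_w i)
    fun k => (hin.process k).integral_apply i

theorem innov_v (i : Fin m) : IsInnovation hin.past μ fun k ω => v k ω i :=
  hin.isInnovation (fun k => measurable_v k i) (hin.moments_v i)
    fun k => (hin.sensor k).integral_apply i

theorem innov_ζ (i : Fin p) : IsInnovation hin.past μ fun k ω => ζ k ω i :=
  hin.isInnovation (fun k => measurable_ζ k i) (hin.moments_ζ i)
    fun k => (hin.excitation k).integral_apply i

/-- Products of coordinates of different inputs are centred, by independence. -/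
theorem integral_mul_eq_zero {i j : Unit ⊕ ℕ ⊕ ℕ ⊕ ℕ} (hij : i ≠ j) {f g : Ω → ℝ}
    (hf : Measurable[inputSigma xi w v ζ i] f) (hg : Measurable[inputSigma xi w v ζ j] g)
    (h0 : ∫ ω, f ω ∂μ = 0) : ∫ ω, f ω * g ω ∂μ = 0 := by
  have hi : IndepFun f g μ := by
    rw [IndepFun_iff_Indep]
    exact indep_of_indep_of_le_left (indep_of_indep_of_le_right (hin.indep.indep hij) hg.comap_le)
      hf.comap_le
  have := hi.integral_mul_eq_mul_integral
    (hf.mono (hin.inputSigma_le i) le_rfl).aestronglyMeasurable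
    (hg.mono (hin.inputSigma_le j) le_rfl).aestronglyMeasurable
  rw [h0, zero_mul] at this
  exact this

variable [IsProbabilityMeasure μ]

theorem innov_ww (hQ : Q.PosSemidef) (i j : Fin n) :
    IsInnovation hin.past μ fun k ω => w k ω i * w k ω j - Q i j :=
  hin.isInnovation (fun k => ((measurable_w k i).mul (measurable_w k j)).sub_const _)
    (((hin.moments_w i).mul (hin.moments_w j)).sub_const _) fun k => by
      rw [integral_sub (((hin.moments_w i).mul (hin.moments_w j)).integrable k)
        (integrable_const _), (hin.process k).integral_mul hQ]
      simp

theorem innov_vv (hR : R.PosSemidef) (i j : Fin m) :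
    IsInnovation hin.past μ fun k ω => v k ω i * v k ω j - R i j :=
  hin.isInnovation (fun k => ((measurable_v k i).mul (measurable_v k j)).sub_const _)
    (((hin.moments_v i).mul (hin.moments_v j)).sub_const _) fun k => by
      rw [integral_sub (((hin.moments_v i).mul (hin.moments_v j)).integrable k)
        (integrable_const _), (hin.sensor k).integral_mul hR]
      simp

theorem innov_ζζ (i j : Fin p) : IsInnovation hin.past μ
    fun k ω => ζ k ω i * ζ k ω j - (1 : Matrix (Fin p) (Fin p) ℝ) i j :=
  hin.isInnovation (fun k => ((measurable_ζ k i).mul (measurable_ζ k j)).sub_const _)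
    (((hin.moments_ζ i).mul (hin.moments_ζ j)).sub_const _) fun k => by
      rw [integral_sub (((hin.moments_ζ i).mul (hin.moments_ζ j)).integrable k)
        (integrable_const _), (hin.excitation k).integral_mul Matrix.PosSemidef.one]
      simp

theorem innov_wζ (i : Fin n) (j : Fin p) :
    IsInnovation hin.past μ fun k ω => w k ω i * ζ k ω j :=
  hin.isInnovation (fun k => (measurable_w k i).mul (measurable_ζ k j))
    ((hin.moments_w i).mul (hin.moments_ζ j)) fun k =>
      hin.integral_mul_eq_zero (i := .inr (.inl k)) (j := .inr (.inr (.inr k))) (by simp)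
        ((measurable_pi_apply i).comp (comap_measurable (w k)))
        ((measurable_pi_apply j).comp (comap_measurable (ζ k)))
        ((hin.process k).integral_apply i)

theorem innov_vζ (i : Fin m) (j : Fin p) :
    IsInnovation hin.past μ fun k ω => v k ω i * ζ k ω j :=
  hin.isInnovation (fun k => (measurable_v k i).mul (measurable_ζ k j))
    ((hin.moments_v i).mul (hin.moments_ζ j)) fun k =>
      hin.integral_mul_eq_zero (i := .inr (.inr (.inl k))) (j := .inr (.inr (.inr k))) (by simp)
        ((measurable_pi_apply i).comp (comap_measurable (v k)))
        ((measurable_pi_apply j).comp (comap_measurable (ζ k)))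
        ((hin.sensor k).integral_apply i)

theorem innov_wv (i : Fin n) (j : Fin m) :
    IsInnovation hin.past μ fun k ω => w k ω i * v k ω j :=
  hin.isInnovation (fun k => (measurable_w k i).mul (measurable_v k j))
    ((hin.moments_w i).mul (hin.moments_v j)) fun k =>
      hin.integral_mul_eq_zero (i := .inr (.inl k)) (j := .inr (.inr (.inl k))) (by simp)
        ((measurable_pi_apply i).comp (comap_measurable (w k)))
        ((measurable_pi_apply j).comp (comap_measurable (v k)))
        ((hin.process k).integral_apply i)

end GaussianInputs

end Inputs

/-! ### Square roots of covariances -/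

section SqrtCov

variable {p : ℕ}

theorem isClosed_posSemidef :
    IsClosed {V : Fin p → Fin p → ℝ | (Matrix.of V).PosSemidef} := by
  have : {V : Fin p → Fin p → ℝ | (Matrix.of V).PosSemidef} =
      {V | (Matrix.of V)ᵀ = Matrix.of V} ∩
        ⋂ x : Fin p → ℝ, {V | 0 ≤ x ⬝ᵥ Matrix.of V *ᵥ x} := by
    ext V
    simp only [Set.mem_ofPred_eq, Set.mem_inter_iff, Set.mem_iInter]
    exact ⟨fun h => ⟨h.1, fun x => PosSemidef.quad_nonneg h x⟩,
      fun h => posSemidef_of_quad_nonneg h.1 h.2⟩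
  rw [this]
  refine IsClosed.inter (isClosed_eq ?_ ?_)
    (isClosed_iInter fun x => isClosed_le continuous_const ?_)
  · exact continuous_matrix fun i j => (continuous_apply i).comp (continuous_apply j)
  · exact continuous_matrix fun i j => (continuous_apply j).comp (continuous_apply i)
  · simp only [dotProduct, mulVec, Matrix.of_apply]
    fun_prop

/-- The square root of a positive semidefinite matrix depends measurably on the matrix: it inverts
the squaring map, which is continuous and injective on the closed set of positive semidefinite
matrices, hence a measurable embedding of this set. -/
theorem measurable_sqrt_apply {Ω : Type*} {mΩ : MeasurableSpace Ω}
    {U : Ω → Matrix (Fin p) (Fin p) ℝ} (hU : ∀ i j, Measurable fun ω => U ω i j)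
    (hpos : ∀ ω, (U ω).PosSemidef) (i j : Fin p) : Measurable fun ω => CFC.sqrt (U ω) i j := by
  set s : Set (Fin p → Fin p → ℝ) := {V | (Matrix.of V).PosSemidef} with hs
  set f : (Fin p → Fin p → ℝ) → Fin p → Fin p → ℝ := fun V => Matrix.of V * Matrix.of V with hf
  have hfc : Continuous f := by
    refine continuous_pi fun a => continuous_pi fun b => ?_
    simp only [hf, Matrix.mul_apply, Matrix.of_apply]
    fun_prop
  have hinj : Set.InjOn f s := by
    intro V hV V' hV' h
    have h1 : CFC.sqrt (Matrix.of V * Matrix.of V) = Matrix.of V :=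
      CFC.sqrt_mul_self _ (Matrix.nonneg_iff_posSemidef.2 hV)
    have h2 : CFC.sqrt (Matrix.of V' * Matrix.of V') = Matrix.of V' :=
      CFC.sqrt_mul_self _ (Matrix.nonneg_iff_posSemidef.2 hV')
    have h3 : (Matrix.of V * Matrix.of V) = Matrix.of V' * Matrix.of V' := h
    rw [h3, h2] at h1
    exact (Matrix.of.injective h1).symm
  have hms : MeasurableSet s := isClosed_posSemidef.measurableSet
  have hemb : MeasurableEmbedding (s.domRestrict f) :=
    hfc.continuousOn.measurableEmbedding hms hinj
  have hmem : ∀ ω, (fun a b => CFC.sqrt (U ω) a b) ∈ s := fun ω =>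
    Matrix.nonneg_iff_posSemidef.1 (CFC.sqrt_nonneg (U ω))
  have hg : Measurable fun ω => (⟨fun a b => CFC.sqrt (U ω) a b, hmem ω⟩ : s) := by
    refine hemb.measurable_comp_iff.1 ?_
    have : (fun ω => s.domRestrict f ⟨fun a b => CFC.sqrt (U ω) a b, hmem ω⟩) =
        fun ω a b => U ω a b := by
      funext ω
      exact CFC.sqrt_mul_sqrt_self (U ω) (Matrix.nonneg_iff_posSemidef.2 (hpos ω))
    change Measurable fun ω => s.domRestrict f ⟨fun a b => CFC.sqrt (U ω) a b, hmem ω⟩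
    rw [this]
    exact measurable_pi_lambda _ fun a => measurable_pi_lambda _ fun b => hU a b
  exact (measurable_pi_apply j).comp ((measurable_pi_apply i).comp
    (measurable_subtype_coe.comp hg))

theorem measurable_inv_apply {Ω : Type*} {mΩ : MeasurableSpace Ω}
    {U : Ω → Matrix (Fin p) (Fin p) ℝ} (hU : ∀ i j, Measurable fun ω => U ω i j)
    (i j : Fin p) : Measurable fun ω => (U ω)⁻¹ i j := by
  have hdet : ∀ {V : Ω → Matrix (Fin p) (Fin p) ℝ}, (∀ i j, Measurable fun ω => V ω i j) →
      Measurable fun ω => (V ω).det := fun {V} hV => by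
    simp only [Matrix.det_apply]
    exact Finset.measurable_sum _ fun σ _ =>
      (Finset.measurable_prod _ fun a _ => hV _ _).const_smul _
  have : (fun ω => (U ω)⁻¹ i j)
      = fun ω => (U ω).det⁻¹ * ((U ω).updateRow j (Pi.single i 1)).det := by
    funext ω
    rw [Matrix.inv_def, Matrix.smul_apply, Matrix.adjugate_apply, Ring.inverse_eq_inv', smul_eq_mul]
  rw [this]
  refine (hdet hU).inv.mul (hdet fun a b => ?_)
  by_cases h : a = j
  · subst h; simp
  · simp only [Matrix.updateRow_ne h]; exact hU a b

theorem measurable_mul_apply {Ω r s t : Type*} [Fintype s] {mΩ : MeasurableSpace Ω}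
    {U : Ω → Matrix r s ℝ} {V : Ω → Matrix s t ℝ} (hU : ∀ i j, Measurable fun ω => U ω i j)
    (hV : ∀ i j, Measurable fun ω => V ω i j) (i : r) (j : t) :
    Measurable fun ω => (U ω * V ω) i j := by
  simp only [Matrix.mul_apply]
  exact Finset.measurable_sum _ fun a _ => (hU i a).mul (hV a j)

theorem sq_apply_le_mul_transpose {r s : Type*} [Fintype s] (M : Matrix r s ℝ) (i : r) (j : s) :
    M i j ^ 2 ≤ (M * Mᵀ) i i := by
  simp only [Matrix.mul_apply, Matrix.transpose_apply, ← sq]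
  exact Finset.single_le_sum (f := fun j => M i j ^ 2) (fun _ _ => sq_nonneg _) (Finset.mem_univ j)

/-- The factors `U^{1/2}` and `U⁻¹ U^{1/2}` of a well-conditioned covariance. -/
theorem sqrt_factors {V : Matrix (Fin p) (Fin p) ℝ} (hV : V.PosSemidef) {e : ℝ} (he : 0 < e) :
    let U := V + e • (1 : Matrix (Fin p) (Fin p) ℝ)
    U.PosDef ∧ CFC.sqrt U * (U⁻¹ * CFC.sqrt U)ᵀ = 1 ∧ (∀ i j, CFC.sqrt U i j ^ 2 ≤ V.trace + e) ∧
      ∀ i j, (U⁻¹ * CFC.sqrt U) i j ^ 2 ≤ e⁻¹ := by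
  intro U
  have hU : U.PosDef := Matrix.PosDef.posSemidef_add hV (Matrix.PosDef.one.smul he)
  have hs : (CFC.sqrt U)ᵀ = CFC.sqrt U :=
    (Matrix.nonneg_iff_posSemidef.1 (CFC.sqrt_nonneg U)).1
  have hss : CFC.sqrt U * CFC.sqrt U = U :=
    CFC.sqrt_mul_sqrt_self U (Matrix.nonneg_iff_posSemidef.2 hU.posSemidef)
  have hdet : IsUnit U.det := (Matrix.isUnit_iff_isUnit_det U).1 hU.isUnit
  have hUt : Uᵀ = U := PosDef.transpose_eq hU
  have hit : (U⁻¹)ᵀ = U⁻¹ := by rw [Matrix.transpose_nonsing_inv, hUt]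
  refine ⟨hU, ?_, fun i j => ?_, fun i j => ?_⟩
  · rw [Matrix.transpose_mul, hs, hit, ← Matrix.mul_assoc, hss, Matrix.mul_nonsing_inv _ hdet]
  · refine (sq_apply_le_mul_transpose _ i j).trans ?_
    rw [hs, hss]
    have h1 : V i i ≤ V.trace := (le_abs_self _).trans (PosSemidef.abs_apply_le_trace hV i i)
    simp only [U, Matrix.add_apply, Matrix.smul_apply, Matrix.one_apply_eq, smul_eq_mul, mul_one]
    linarith
  · refine (sq_apply_le_mul_transpose _ i j).trans ?_
    have h1 : U⁻¹ * CFC.sqrt U * (U⁻¹ * CFC.sqrt U)ᵀ = U⁻¹ := by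
      rw [Matrix.transpose_mul, hs, hit, Matrix.mul_assoc, ← Matrix.mul_assoc (CFC.sqrt U), hss,
        Matrix.mul_nonsing_inv _ hdet, Matrix.mul_one]
    rw [h1]
    -- with `z = U⁻¹ eᵢ`: `zᵢ = zᵀ U z ≥ e |z|² ≥ e zᵢ²`
    set z : Fin p → ℝ := U⁻¹ *ᵥ Pi.single i 1 with hz
    have hzi : z i = U⁻¹ i i := by simp [hz]
    have hUz : U *ᵥ z = Pi.single i 1 := by
      rw [hz, Matrix.mulVec_mulVec, Matrix.mul_nonsing_inv _ hdet, Matrix.one_mulVec]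
    have h2 : z ⬝ᵥ U *ᵥ z = z i := by rw [hUz]; simp
    have h3 : z ⬝ᵥ U *ᵥ z = z ⬝ᵥ V *ᵥ z + e * (z ⬝ᵥ z) := by
      simp only [U, Matrix.add_mulVec, Matrix.smul_mulVec, Matrix.one_mulVec, dotProduct_add,
        dotProduct_smul, smul_eq_mul]
    have h4 : z i ^ 2 ≤ z ⬝ᵥ z := by
      simp only [dotProduct, ← sq]
      exact Finset.single_le_sum (f := fun j => z j ^ 2) (fun _ _ => sq_nonneg _)
        (Finset.mem_univ i)
    have h5 := PosSemidef.quad_nonneg hV z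
    have h6 : e * z i ^ 2 ≤ z i := by nlinarith
    rw [← hzi, ← one_div, le_div_iff₀ he]
    by_contra h
    push Not at h
    nlinarith [sq_nonneg (z i)]

end SqrtCov

/-! ### Correlation of the output with the watermark -/

section Correlation

variable {Ω : Type*} [mΩ : MeasurableSpace Ω] {μ : Measure Ω} {n m p : ℕ}

/-- The state before time `k`: the initial value for `k = 0`. -/
def LinSys.prior (S : LinSys n m p) (xi : Fin n → ℝ) (φ : ℕ → Fin p → ℝ) (w : ℕ → Fin n → ℝ) :
    ℕ → Fin n → ℝ
  | 0 => xi
  | k + 1 => S.state xi φ w k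

theorem LinSys.prior_succ (S : LinSys n m p) (xi : Fin n → ℝ) (φ : ℕ → Fin p → ℝ)
    (w : ℕ → Fin n → ℝ) (k : ℕ) :
    S.prior xi φ w (k + 1) = S.A *ᵥ S.prior xi φ w k + S.B *ᵥ φ k + w k := by
  cases k <;> rfl

theorem measurable_mulVec_apply {Ω r s : Type*} [Fintype s] {m₀ : MeasurableSpace Ω}
    {M : Ω → Matrix r s ℝ} {x : Ω → s → ℝ} (hM : ∀ i j, Measurable fun ω => M ω i j)
    (hx : ∀ j, Measurable fun ω => x ω j) (i : r) : Measurable fun ω => (M ω *ᵥ x ω) i := by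
  simp only [mulVec, dotProduct]
  exact Finset.measurable_sum _ fun j _ => (hM i j).mul (hx j)

theorem growth_mulVec {r s : Type*} [Fintype s] {c d : ℝ} {M : ℕ → Matrix r s ℝ} {x : ℕ → s → ℝ}
    (hM : MGrowth c M) (hx : ∀ j, Growth d fun k => x k j) (i : r) :
    Growth (c + d) fun k => (M k *ᵥ x k) i := by
  simp only [mulVec, dotProduct]
  exact Growth.sum _ fun j _ => (hM i j).mul (hx j)

theorem IsInnovation.ae_growth_sum [IsProbabilityMeasure μ] {ℱ : Filtration ℕ mΩ} {ι : Type*}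
    [Fintype ι] {g : ι → ℕ → Ω → ℝ} (hg : ∀ b, IsInnovation ℱ μ (g b)) (r : ℕ)
    {a : ι → ℕ → Ω → ℝ} {c : ℝ} (hc : 0 ≤ c) (ha : ∀ b s, Measurable[ℱ (s + r)] (a b s))
    (hac : ∀ᵐ ω ∂μ, ∀ b, Growth c fun s => a b s ω) :
    ∀ᵐ ω ∂μ, Growth (c + 1 / 2)
      fun k => ∑ s ∈ Finset.range k, ∑ b, a b s ω * g b (s + r) ω := by
  have h : ∀ b, ∀ᵐ ω ∂μ, Growth (c + 1 / 2)
      fun k => ∑ s ∈ Finset.range k, a b s ω * g b (s + r) ω := fun b =>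
    (hg b).ae_growth r hc (ha b) (hac.mono fun ω h => h b)
  filter_upwards [ae_all_iff.2 h] with ω hω
  refine (Growth.sum Finset.univ fun b _ => hω b).congr' (Eventually.of_forall fun k => ?_)
  exact Finset.sum_comm

variable {Sig Q : Matrix (Fin n) (Fin n) ℝ} {R : Matrix (Fin m) (Fin m) ℝ}
  {xi : Ω → Fin n → ℝ} {w : ℕ → Ω → Fin n → ℝ} {v : ℕ → Ω → Fin m → ℝ} {ζ : ℕ → Ω → Fin p → ℝ}

/-- Factors `L_k`, `N_k` determined by the past, with `L_k N_kᵀ = 1`, the `L_k` bounded up to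
subpolynomial factors and the `N_k` growing like `k ^ c`. The watermark is `L_k ζ_k`, and it is
correlated with the outputs through `N_k ζ_k`. -/
structure IsExcitation (xi : Ω → Fin n → ℝ) (w : ℕ → Ω → Fin n → ℝ) (v : ℕ → Ω → Fin m → ℝ)
    (ζ : ℕ → Ω → Fin p → ℝ) (c : ℝ) (L N : ℕ → Ω → Matrix (Fin p) (Fin p) ℝ) : Prop where
  measurable_left : ∀ k i j, Measurable[pastSigma xi w v ζ k] fun ω => L k ω i j
  measurable_right : ∀ k i j, Measurable[pastSigma xi w v ζ k] fun ω => N k ω i j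
  growth_left : ∀ ω, MGrowth 0 fun k => L k ω
  growth_right : ∀ ω, MGrowth c fun k => N k ω
  mul_transpose : ∀ k ω, L k ω * (N k ω)ᵀ = 1

variable {c : ℝ} {L N : ℕ → Ω → Matrix (Fin p) (Fin p) ℝ}
  {S : LinSys n m p} {ev : Fin (numEigenvalues S.A) → ℂ}
  {E : Fin (numEigenvalues S.A) → Matrix (Fin n) (Fin n) ℂ}

omit mΩ in
/-- The state before time `k` is determined by the past, for any watermark that is. -/
theorem measurable_prior (S : LinSys n m p) {φ : ℕ → Ω → Fin p → ℝ}
    (hφ : ∀ k b, Measurable[pastSigma xi w v ζ (k + 1)] fun ω => φ k ω b) (k : ℕ) (i : Fin n) :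
    Measurable[pastSigma xi w v ζ k] fun ω =>
      S.prior (xi ω) (fun k => φ k ω) (fun k => w k ω) k i := by
  induction k generalizing i with
  | zero =>
    exact ((measurable_pi_apply i).comp (comap_measurable xi)).mono le_sup_left le_rfl
  | succ k ih =>
    simp only [LinSys.prior_succ, Pi.add_apply]
    refine Measurable.add (Measurable.add ?_ ?_) ?_
    · exact measurable_mulVec_apply (M := fun _ => S.A) (fun _ _ => measurable_const)
        (fun j => (ih j).mono (pastSigma_mono (Nat.le_succ k)) le_rfl) i
    · exact measurable_mulVec_apply (M := fun _ => S.B) (x := fun ω => φ k ω)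
        (fun _ _ => measurable_const) (hφ k) i
    · exact (GaussianInputs.measurable_w k i).mono
        (presentSigma_le_pastSigma (Nat.lt_succ_self k)) le_rfl

namespace IsExcitation

omit mΩ in
theorem measurable_watermark (hex : IsExcitation xi w v ζ c L N) (k : ℕ) (b : Fin p) :
    Measurable[pastSigma xi w v ζ (k + 1)] fun ω => (L k ω *ᵥ ζ k ω) b :=
  measurable_mulVec_apply
    (fun a b => (hex.measurable_left k a b).mono (pastSigma_mono (Nat.le_succ k)) le_rfl)
    (fun b => (GaussianInputs.measurable_ζ k b).mono
      (presentSigma_le_pastSigma (Nat.lt_succ_self k)) le_rfl) b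

omit mΩ in
theorem measurable_probe (hex : IsExcitation xi w v ζ c L N) {s k : ℕ} (h : s < k) (j : Fin p) :
    Measurable[pastSigma xi w v ζ k] fun ω => (N s ω *ᵥ ζ s ω) j :=
  measurable_mulVec_apply
    (fun a b => (hex.measurable_right s a b).mono (pastSigma_mono h.le) le_rfl)
    (fun b => (GaussianInputs.measurable_ζ s b).mono (presentSigma_le_pastSigma h) le_rfl) j

variable [IsProbabilityMeasure μ]

theorem ae_growth_watermark (hex : IsExcitation xi w v ζ c L N)
    (hin : GaussianInputs μ Sig Q R xi w v ζ) :
    ∀ᵐ ω ∂μ, ∀ b, Growth 0 fun k => (L k ω *ᵥ ζ k ω) b := by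
  filter_upwards [ae_all_iff.2 fun b => (hin.moments_ζ b).ae_growth] with ω h b
  simpa using growth_mulVec (hex.growth_left ω) h b

theorem ae_growth_probe (hex : IsExcitation xi w v ζ c L N)
    (hin : GaussianInputs μ Sig Q R xi w v ζ) :
    ∀ᵐ ω ∂μ, ∀ b, Growth c fun k => (N k ω *ᵥ ζ k ω) b := by
  filter_upwards [ae_all_iff.2 fun b => (hin.moments_ζ b).ae_growth] with ω h b
  simpa using growth_mulVec (hex.growth_right ω) h b

theorem ae_growth_prior (hex : IsExcitation xi w v ζ c L N)
    (hin : GaussianInputs μ Sig Q R xi w v ζ) (h : IsModal S.A ev E) (hlt : ∀ i, ‖ev i‖ < 1) :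
    ∀ᵐ ω ∂μ, ∀ i, Growth 0 fun k =>
      S.prior (xi ω) (fun k => L k ω *ᵥ ζ k ω) (fun k => w k ω) k i := by
  filter_upwards [hex.ae_growth_watermark hin,
    ae_all_iff.2 fun i => (hin.moments_w i).ae_growth] with ω hφ hw i
  exact Growth.of_shift 1 (h.growth_state hlt hφ hw i)

/-- The correlation of the state with the watermark `τ` steps before is `A ^ τ B`, with a
square-root cancellation of the fluctuations. The recursion of the state reduces every lag to
martingale transforms of products of inputs. -/
theorem ae_growth_sum_state (hex : IsExcitation xi w v ζ c L N)
    (hin : GaussianInputs μ Sig Q R xi w v ζ) (h : IsModal S.A ev E) (hlt : ∀ i, ‖ev i‖ < 1)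
    (hc : 0 ≤ c) (τ : ℕ) :
    ∀ᵐ ω ∂μ, MGrowth (c + 1 / 2) fun K => ∑ s ∈ Finset.range K,
      (vecMulVec (S.state (xi ω) (fun k => L k ω *ᵥ ζ k ω) (fun k => w k ω) (s + τ))
        (N s ω *ᵥ ζ s ω) - S.A ^ τ * S.B) := by
  induction τ with
  | zero =>
    -- the contribution of the state before time `s`
    have h1 : ∀ i j, ∀ᵐ ω ∂μ, Growth (c + 1 / 2) fun K => ∑ s ∈ Finset.range K, ∑ b,
        ((S.A *ᵥ S.prior (xi ω) (fun k => L k ω *ᵥ ζ k ω) (fun k => w k ω) s) i * N s ω j b)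
          * ζ s ω b := by
      intro i j
      refine IsInnovation.ae_growth_sum (ℱ := hin.past) (g := fun b k ω => ζ k ω b)
        (fun b => hin.innov_ζ b) 0 (a := fun b s ω =>
          (S.A *ᵥ S.prior (xi ω) (fun k => L k ω *ᵥ ζ k ω) (fun k => w k ω) s) i * N s ω j b)
        hc (fun b s => ?_) ?_
      · exact (measurable_mulVec_apply (M := fun _ => S.A) (fun _ _ => measurable_const)
          (measurable_prior S hex.measurable_watermark s) i).mul (hex.measurable_right s j b)
      · filter_upwards [hex.ae_growth_prior hin h hlt] with ω hω b
        have := growth_mulVec (MGrowth.const S.A) hω i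
        rw [add_zero] at this
        exact this.mul_left_bdd (hex.growth_right ω j b)
    -- the contribution of the watermark at time `s`, with mean `B L Nᵀ = B`
    have h2 : ∀ i j, ∀ᵐ ω ∂μ, Growth (c + 1 / 2) fun K => ∑ s ∈ Finset.range K,
        ∑ x : Fin p × Fin p, ((S.B * L s ω) i x.1 * N s ω j x.2)
          * (ζ s ω x.1 * ζ s ω x.2 - (1 : Matrix (Fin p) (Fin p) ℝ) x.1 x.2) := by
      intro i j
      refine IsInnovation.ae_growth_sum (ℱ := hin.past)
        (g := fun (x : Fin p × Fin p) k ω =>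
          ζ k ω x.1 * ζ k ω x.2 - (1 : Matrix (Fin p) (Fin p) ℝ) x.1 x.2)
        (fun x => hin.innov_ζζ x.1 x.2) 0
        (a := fun x s ω => (S.B * L s ω) i x.1 * N s ω j x.2) hc (fun x s => ?_) ?_
      · exact (measurable_mul_apply (U := fun _ => S.B) (fun _ _ => measurable_const)
          (hex.measurable_left s) i x.1).mul (hex.measurable_right s j x.2)
      · refine Eventually.of_forall fun ω x => ?_
        exact ((MGrowth.const S.B).mul_left_bdd (hex.growth_left ω) i x.1).mul_left_bdd
          (hex.growth_right ω j x.2)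
    -- the contribution of the process noise
    have h3 : ∀ i j, ∀ᵐ ω ∂μ, Growth (c + 1 / 2) fun K => ∑ s ∈ Finset.range K, ∑ b,
        N s ω j b * (w s ω i * ζ s ω b) := by
      intro i j
      refine IsInnovation.ae_growth_sum (ℱ := hin.past) (g := fun b k ω => w k ω i * ζ k ω b)
        (fun b => hin.innov_wζ i b) 0 (a := fun b s ω => N s ω j b)
        hc (fun b s => hex.measurable_right s j b)
        (Eventually.of_forall fun ω b => hex.growth_right ω j b)
    filter_upwards [ae_all_iff.2 fun i => ae_all_iff.2 (h1 i),
      ae_all_iff.2 fun i => ae_all_iff.2 (h2 i),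
      ae_all_iff.2 fun i => ae_all_iff.2 (h3 i)] with ω h1 h2 h3 i j
    refine (((h1 i j).add (h2 i j)).add (h3 i j)).congr' (Eventually.of_forall fun K => ?_)
    simp only [Matrix.sum_apply, ← Finset.sum_add_distrib]
    refine Finset.sum_congr rfl fun s _ => ?_
    have hB : S.B i j = ∑ x : Fin p × Fin p, ((S.B * L s ω) i x.1 * N s ω j x.2)
        * (1 : Matrix (Fin p) (Fin p) ℝ) x.1 x.2 := by
      have : S.B = S.B * L s ω * (N s ω)ᵀ := by
        rw [Matrix.mul_assoc, hex.mul_transpose, Matrix.mul_one]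
      conv_lhs => rw [this]
      rw [Matrix.mul_apply]
      simp [Fintype.sum_prod_type, Matrix.one_apply]
    have hx : S.state (xi ω) (fun k => L k ω *ᵥ ζ k ω) (fun k => w k ω) s i
        = (S.A *ᵥ S.prior (xi ω) (fun k => L k ω *ᵥ ζ k ω) (fun k => w k ω) s) i
          + ∑ b, (S.B * L s ω) i b * ζ s ω b + w s ω i := by
      have := congrFun (S.prior_succ (xi ω) (fun k => L k ω *ᵥ ζ k ω) (fun k => w k ω) s) i
      simp only [Matrix.mulVec_mulVec, Pi.add_apply] at this
      exact this
    have hψ : (N s ω *ᵥ ζ s ω) j = ∑ b, N s ω j b * ζ s ω b := rfl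
    have e1 : ∀ x : ℝ, x * (N s ω *ᵥ ζ s ω) j = ∑ b, x * N s ω j b * ζ s ω b := fun x => by
      rw [hψ, Finset.mul_sum]
      exact Finset.sum_congr rfl fun b _ => by ring
    have e2 : (∑ b, (S.B * L s ω) i b * ζ s ω b) * (N s ω *ᵥ ζ s ω) j
        = ∑ x : Fin p × Fin p, (S.B * L s ω) i x.1 * N s ω j x.2 * (ζ s ω x.1 * ζ s ω x.2) := by
      rw [hψ, Finset.sum_mul_sum, Fintype.sum_prod_type]
      exact Finset.sum_congr rfl fun b _ => Finset.sum_congr rfl fun d _ => by ring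
    have e3 : ∑ b, N s ω j b * (w s ω i * ζ s ω b) = ∑ b, w s ω i * N s ω j b * ζ s ω b :=
      Finset.sum_congr rfl fun b _ => by ring
    simp only [add_zero, pow_zero, Matrix.one_mul, Matrix.sub_apply, vecMulVec_apply]
    rw [hx, add_mul, add_mul, e2, e1, e1, e3]
    conv_rhs => rw [hB]
    simp only [mul_sub, Finset.sum_sub_distrib]
    ring
  | succ τ ih =>
    -- the watermark and the process noise of the later time are innovations
    have h1 : ∀ i j, ∀ᵐ ω ∂μ, Growth (c + 1 / 2) fun K => ∑ s ∈ Finset.range K, ∑ b,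
        ((S.B * L (s + (τ + 1)) ω) i b * (N s ω *ᵥ ζ s ω) j) * ζ (s + (τ + 1)) ω b := by
      intro i j
      refine IsInnovation.ae_growth_sum (ℱ := hin.past) (g := fun b k ω => ζ k ω b)
        (fun b => hin.innov_ζ b) (τ + 1) (a := fun b s ω =>
          (S.B * L (s + (τ + 1)) ω) i b * (N s ω *ᵥ ζ s ω) j) hc (fun b s => ?_) ?_
      · exact (measurable_mul_apply (U := fun _ => S.B) (fun _ _ => measurable_const)
          (hex.measurable_left _) i b).mul
            (hex.measurable_probe (Nat.lt_add_of_pos_right (by omega)) j)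
      · filter_upwards [hex.ae_growth_probe hin] with ω hω b
        have := ((MGrowth.const S.B).mul_left_bdd (hex.growth_left ω) i b).shift (τ + 1)
        exact this.mul_left_bdd (hω j)
    have h2 : ∀ i j, ∀ᵐ ω ∂μ, Growth (c + 1 / 2) fun K => ∑ s ∈ Finset.range K,
        (N s ω *ᵥ ζ s ω) j * w (s + (τ + 1)) ω i := fun i j =>
      (hin.innov_w i).ae_growth (τ + 1) hc
        (fun s => hex.measurable_probe (Nat.lt_add_of_pos_right (by omega)) j)
        ((hex.ae_growth_probe hin).mono fun ω hω => hω j)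
    filter_upwards [ih, ae_all_iff.2 fun i => ae_all_iff.2 (h1 i),
      ae_all_iff.2 fun i => ae_all_iff.2 (h2 i)] with ω ih h1 h2 i j
    refine ((((MGrowth.const S.A).mul_left_bdd ih i j).add (h1 i j)).add (h2 i j)).congr'
      (Eventually.of_forall fun K => ?_)
    simp only [Matrix.mul_sum, Matrix.sum_apply, ← Finset.sum_add_distrib]
    refine Finset.sum_congr rfl fun s _ => ?_
    rw [← add_assoc s τ 1, LinSys.state, pow_succ', Matrix.mul_assoc, Matrix.mul_sub]
    simp only [Matrix.mul_vecMulVec, Matrix.sub_apply, vecMulVec_apply, Pi.add_apply,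
      Matrix.mulVec_mulVec, add_mul]
    have e1 : ((S.B * L (s + τ + 1) ω) *ᵥ ζ (s + τ + 1) ω) i * (N s ω *ᵥ ζ s ω) j =
        ∑ b, (S.B * L (s + τ + 1) ω) i b * (N s ω *ᵥ ζ s ω) j * ζ (s + τ + 1) ω b := by
      rw [mulVec, dotProduct, Finset.sum_mul]
      exact Finset.sum_congr rfl fun b _ => by ring
    rw [e1]
    ring

/-- The correlation of the output with the watermark `τ` steps before is the Markov parameter. -/
theorem ae_growth_sum_output (hex : IsExcitation xi w v ζ c L N)
    (hin : GaussianInputs μ Sig Q R xi w v ζ) (h : IsModal S.A ev E) (hlt : ∀ i, ‖ev i‖ < 1)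
    (hc : 0 ≤ c) (τ : ℕ) :
    ∀ᵐ ω ∂μ, MGrowth (c + 1 / 2) fun K => ∑ s ∈ Finset.range K,
      (vecMulVec (S.output (xi ω) (fun k => L k ω *ᵥ ζ k ω) (fun k => w k ω) (fun k => v k ω)
        (s + τ)) (N s ω *ᵥ ζ s ω) - S.H τ) := by
  -- for `τ = 0` the sensor noise and the watermark are simultaneous, for `τ > 0` the noise is later
  have h1 : ∀ i j, ∀ᵐ ω ∂μ, Growth (c + 1 / 2) fun K => ∑ s ∈ Finset.range K,
      (N s ω *ᵥ ζ s ω) j * v (s + τ) ω i := by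
    intro i j
    rcases Nat.eq_zero_or_pos τ with rfl | hτ
    · have := IsInnovation.ae_growth_sum (ℱ := hin.past) (g := fun b k ω => v k ω i * ζ k ω b)
        (fun b => hin.innov_vζ i b) 0 (a := fun b s ω => N s ω j b)
        hc (fun b s => hex.measurable_right s j b)
        (Eventually.of_forall fun ω b => hex.growth_right ω j b)
      filter_upwards [this] with ω hω
      refine hω.congr' (Eventually.of_forall fun K => ?_)
      refine Finset.sum_congr rfl fun s _ => ?_
      simp only [mulVec, dotProduct, Finset.sum_mul, add_zero]
      exact Finset.sum_congr rfl fun b _ => by ring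
    · exact (hin.innov_v i).ae_growth τ hc
        (fun s => hex.measurable_probe (Nat.lt_add_of_pos_right (by omega)) j)
        ((hex.ae_growth_probe hin).mono fun ω hω => hω j)
  filter_upwards [hex.ae_growth_sum_state hin h hlt hc τ,
    ae_all_iff.2 fun i => ae_all_iff.2 (h1 i)] with ω h0 h1 i j
  refine (((MGrowth.const S.C).mul_left_bdd h0 i j).add (h1 i j)).congr'
    (Eventually.of_forall fun K => ?_)
  simp only [Matrix.mul_sum, Matrix.sum_apply, ← Finset.sum_add_distrib]
  refine Finset.sum_congr rfl fun s _ => ?_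
  rw [LinSys.output, LinSys.H, Matrix.mul_assoc, Matrix.mul_sub]
  simp only [Matrix.mul_vecMulVec, Matrix.sub_apply, vecMulVec_apply, Pi.add_apply]
  ring

end IsExcitation

/-- The estimate of a Markov parameter is an average of correlations. -/
theorem growth_markovEst {y : ℕ → Fin m → ℝ} {φ : ℕ → Fin p → ℝ}
    {U : ℕ → Matrix (Fin p) (Fin p) ℝ} {H : Matrix (Fin m) (Fin p) ℝ} {d : ℝ} (τ : ℕ)
    (h : MGrowth d fun K => ∑ s ∈ Finset.range K,
      (vecMulVec (y (s + τ)) (φ s) * (U s)⁻¹ - H)) :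
    MGrowth (d - 1) fun k => markovEst y φ U k τ - H := by
  intro i j
  refine Growth.of_shift τ ?_
  have h1 := Growth.inv_natCast.mul ((h i j).shift 1)
  refine (h1.mono (by linarith)).congr' (Eventually.of_forall fun k => ?_)
  have hk : ((k : ℝ) + 1) ≠ 0 := by positivity
  have h2 : Finset.Icc τ (k + τ) = (Finset.range (k + 1)).image (· + τ) := by
    ext t
    simp only [Finset.mem_Icc, Finset.mem_image, Finset.mem_range]
    exact ⟨fun ht => ⟨t - τ, by omega, by omega⟩, fun ⟨s, hs, hst⟩ => by omega⟩
  have h3 : ((k : ℝ) + 1)⁻¹ * ∑ s ∈ Finset.range (k + 1), H i j = H i j := by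
    rw [Finset.sum_const, Finset.card_range, nsmul_eq_mul]
    push_cast
    rw [← mul_assoc, inv_mul_cancel₀ hk, one_mul]
  simp only [markovEst]
  rw [h2, Finset.sum_image (fun a _ b _ hab => by simpa using hab)]
  simp only [Finset.sum_sub_distrib, Matrix.sub_apply, Matrix.smul_apply, Matrix.sum_apply,
    smul_eq_mul, mul_sub, h3, Nat.add_sub_cancel, Nat.cast_add]
  congr 3
  ring

end Correlation

/-! ### Empirical covariance of the noise part of the output -/

section NoisePart

variable {Ω : Type*} [mΩ : MeasurableSpace Ω] {μ : Measure Ω} {n m p : ℕ}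
  {S : LinSys n m p} {ev : Fin (numEigenvalues S.A) → ℂ}
  {E : Fin (numEigenvalues S.A) → Matrix (Fin n) (Fin n) ℂ}

/-- Growth of the solutions of a perturbed Lyapunov recursion: in modal coordinates it decouples
into stable scalar recursions. -/
theorem IsModal.growth_lyapunov (h : IsModal S.A ev E) (hlt : ∀ i, ‖ev i‖ < 1) {c : ℝ}
    {D F : ℕ → Matrix (Fin n) (Fin n) ℝ} (hD : ∀ k, D (k + 1) = S.A * D k * (S.A)ᵀ + F k)
    (hF : MGrowth c F) : MGrowth c D := by
  have hmode : ∀ i j, MGrowth c fun k => E i * toC (D k) * (E j)ᵀ := by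
    intro i j a b
    have hr : ‖ev i * ev j‖ < 1 := by
      rw [norm_mul]
      exact mul_lt_one_of_nonneg_of_lt_one_left (norm_nonneg _) (hlt i) (hlt j).le
    refine Growth.of_recursion (l := fun _ => ev i * ev j)
      (f := fun k => (E i * toC (F k) * (E j)ᵀ) a b) (norm_nonneg _) hr
      (Eventually.of_forall fun _ => le_rfl) (Eventually.of_forall fun k => ?_) ?_
    · have h1 : E i * toC (D (k + 1)) * (E j)ᵀ
          = (ev i * ev j) • (E i * toC (D k) * (E j)ᵀ) + E i * toC (F k) * (E j)ᵀ := by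
        have h2 : toC (D (k + 1)) = toC S.A * toC (D k) * (toC S.A)ᵀ + toC (F k) := by
          rw [hD, show ∀ M M' : Matrix (Fin n) (Fin n) ℝ, toC (M + M') = toC M + toC M' from
            fun M M' => Matrix.map_add _ Complex.ofReal_add M M', toC_mul, toC_mul]
          rfl
        have h3 : (toC S.A)ᵀ * (E j)ᵀ = ev j • (E j)ᵀ := by
          rw [← Matrix.transpose_mul, h.proj_mul, Matrix.transpose_smul]
        rw [h2, Matrix.mul_add, Matrix.add_mul]
        congr 1
        calc E i * (toC S.A * toC (D k) * (toC S.A)ᵀ) * (E j)ᵀ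
            = (E i * toC S.A) * toC (D k) * ((toC S.A)ᵀ * (E j)ᵀ) := by
              simp only [Matrix.mul_assoc]
          _ = _ := by
              rw [h.proj_mul, h3, Matrix.smul_mul, Matrix.smul_mul, Matrix.mul_smul, smul_smul]
      beta_reduce
      rw [h1]
      rfl
    · have hEF : MGrowth c fun k => E i * toC (F k) :=
        (MGrowth.const (E i)).mul_left_bdd fun a b => Growth.ofReal_iff.2 (hF a b)
      exact hEF.mul_right_bdd (MGrowth.const _) a b
  intro a b
  rw [← Growth.ofReal_iff]
  refine (Growth.sum Finset.univ fun i _ => Growth.sum Finset.univ fun j _ =>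
    hmode i j a b).congr' (Eventually.of_forall fun k => ?_)
  have h1 : (∑ i, E i) * toC (D k) * (∑ j, E j)ᵀ = toC (D k) := by
    rw [h.sum_proj]; simp
  have h2 := congrFun (congrFun h1 a) b
  rw [Finset.sum_mul, Finset.sum_mul, Matrix.sum_apply] at h2
  refine Eq.trans (Finset.sum_congr rfl fun i _ => ?_) h2
  rw [Matrix.transpose_sum, Finset.mul_sum, Matrix.sum_apply]

variable {Sig Q : Matrix (Fin n) (Fin n) ℝ} {R : Matrix (Fin m) (Fin m) ℝ}
  {xi : Ω → Fin n → ℝ} {w : ℕ → Ω → Fin n → ℝ} {v : ℕ → Ω → Fin m → ℝ} {ζ : ℕ → Ω → Fin p → ℝ}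
  [IsProbabilityMeasure μ]

theorem ae_growth_noiseState (hin : GaussianInputs μ Sig Q R xi w v ζ) (h : IsModal S.A ev E)
    (hlt : ∀ i, ‖ev i‖ < 1) :
    ∀ᵐ ω ∂μ, ∀ i, Growth 0 fun k => S.prior (xi ω) 0 (fun k => w k ω) k i := by
  filter_upwards [ae_all_iff.2 fun i => (hin.moments_w i).ae_growth] with ω hw i
  exact Growth.of_shift 1 (h.growth_state hlt (fun _ => Growth.const _) hw i)

theorem LinSys.prior_zero_succ (S : LinSys n m p) (xi : Fin n → ℝ) (w : ℕ → Fin n → ℝ) (k : ℕ) :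
    S.prior xi 0 w (k + 1) = S.A *ᵥ S.prior xi 0 w k + w k := by
  rw [LinSys.prior_succ, Pi.zero_apply, mulVec_zero, add_zero]

omit mΩ in
theorem measurable_noiseState (S : LinSys n m p) (k : ℕ) (i : Fin n) :
    Measurable[pastSigma xi w v ζ k] fun ω => S.prior (xi ω) 0 (fun k => w k ω) k i :=
  measurable_prior S (φ := fun _ _ => 0) (fun _ _ => measurable_const) k i

/-- The empirical covariance of the noise part of the state converges to the stationary one: its
deviation solves the Lyapunov recursion driven by martingale transforms. -/
theorem ae_growth_noiseState_cov (hin : GaussianInputs μ Sig Q R xi w v ζ) (hQ : Q.PosSemidef)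
    (hSig : Sig = S.A * Sig * (S.A)ᵀ + Q) (h : IsModal S.A ev E) (hlt : ∀ i, ‖ev i‖ < 1) :
    ∀ᵐ ω ∂μ, MGrowth (1 / 2) fun K => ∑ t ∈ Finset.range K,
      (vecMulVec (S.prior (xi ω) 0 (fun k => w k ω) t) (S.prior (xi ω) 0 (fun k => w k ω) t)
        - Sig) := by
  have h1 : ∀ i j, ∀ᵐ ω ∂μ, Growth (0 + 1 / 2) fun K => ∑ t ∈ Finset.range K,
      (S.A *ᵥ S.prior (xi ω) 0 (fun k => w k ω) t) i * w (t + 0) ω j := by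
    intro i j
    refine (hin.innov_w j).ae_growth 0 le_rfl (fun t => ?_) ?_
    · exact measurable_mulVec_apply (M := fun _ => S.A) (fun _ _ => measurable_const)
        (measurable_noiseState S t) i
    · filter_upwards [ae_growth_noiseState hin h hlt] with ω hω
      simpa using growth_mulVec (MGrowth.const S.A) hω i
  have h2 : ∀ i j, ∀ᵐ ω ∂μ, Growth (0 + 1 / 2) fun K => ∑ t ∈ Finset.range K,
      1 * (w (t + 0) ω i * w (t + 0) ω j - Q i j) := fun i j =>
    (hin.innov_ww hQ i j).ae_growth 0 le_rfl (fun _ => measurable_const)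
      (Eventually.of_forall fun _ => Growth.const 1)
  filter_upwards [ae_all_iff.2 fun i => ae_all_iff.2 (h1 i),
    ae_all_iff.2 fun i => ae_all_iff.2 (h2 i)] with ω h1 h2
  set x := S.prior (xi ω) 0 (fun k => w k ω) with hx
  have hrec : ∀ t, vecMulVec (x (t + 1)) (x (t + 1)) - Sig
      = S.A * (vecMulVec (x t) (x t) - Sig) * (S.A)ᵀ + (vecMulVec (S.A *ᵥ x t) (w t ω)
        + vecMulVec (w t ω) (S.A *ᵥ x t) + (vecMulVec (w t ω) (w t ω) - Q)) := by
    intro t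
    rw [hx, LinSys.prior_zero_succ, ← hx]
    conv_lhs => rw [hSig]
    rw [Matrix.mul_sub, Matrix.sub_mul, Matrix.mul_vecMulVec, Matrix.vecMulVec_mul,
      Matrix.vecMul_transpose, Matrix.add_vecMulVec, Matrix.vecMulVec_add, Matrix.vecMulVec_add]
    abel
  -- the partial sums of the deviations solve the same recursion
  refine h.growth_lyapunov hlt (F := fun K => (vecMulVec (x 0) (x 0) - Sig)
    + ∑ t ∈ Finset.range K, (vecMulVec (S.A *ᵥ x t) (w t ω) + vecMulVec (w t ω) (S.A *ᵥ x t)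
      + (vecMulVec (w t ω) (w t ω) - Q))) (fun K => ?_) ?_
  · rw [Finset.sum_range_succ', add_comm (Finset.sum _ _), Finset.mul_sum, Finset.sum_mul]
    simp only [hrec, Finset.sum_add_distrib]
    abel
  · refine ((MGrowth.const _).mono (by norm_num)).add fun i j => ?_
    have := (((h1 i j).add (h1 j i)).add (h2 i j)).mono (d := 1 / 2) (by norm_num)
    refine this.congr' (Eventually.of_forall fun K => ?_)
    simp only [Matrix.sum_apply, ← Finset.sum_add_distrib]
    refine Finset.sum_congr rfl fun t _ => ?_
    simp only [Matrix.add_apply, Matrix.sub_apply, vecMulVec_apply, add_zero]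
    ring

/-- The empirical covariance of the noise part of the output converges to `C Σ Cᵀ + R`. -/
theorem ae_growth_noiseOutput_cov (hin : GaussianInputs μ Sig Q R xi w v ζ) (hQ : Q.PosSemidef)
    (hR : R.PosSemidef) (hSig : Sig = S.A * Sig * (S.A)ᵀ + Q) (h : IsModal S.A ev E)
    (hlt : ∀ i, ‖ev i‖ < 1) :
    ∀ᵐ ω ∂μ, ∀ a b, Growth (1 / 2) fun K => ∑ t ∈ Finset.range K,
      ((S.C *ᵥ S.state (xi ω) 0 (fun k => w k ω) t + v t ω) a
        * (S.C *ᵥ S.state (xi ω) 0 (fun k => w k ω) t + v t ω) b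
        - (S.C * Sig * (S.C)ᵀ + R) a b) := by
  have h1 : ∀ i j, ∀ᵐ ω ∂μ, Growth (0 + 1 / 2) fun K => ∑ t ∈ Finset.range K,
      (S.C *ᵥ S.A *ᵥ S.prior (xi ω) 0 (fun k => w k ω) t) i * v (t + 0) ω j := by
    intro i j
    refine (hin.innov_v j).ae_growth 0 le_rfl (fun t => ?_) ?_
    · simp only [Matrix.mulVec_mulVec]
      exact measurable_mulVec_apply (M := fun _ => S.C * S.A) (fun _ _ => measurable_const)
        (measurable_noiseState S t) i
    · filter_upwards [ae_growth_noiseState hin h hlt] with ω hω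
      simpa using growth_mulVec (MGrowth.const (S.C * S.A)) hω i
  have h2 : ∀ i j, ∀ᵐ ω ∂μ, Growth (0 + 1 / 2) fun K => ∑ t ∈ Finset.range K, ∑ b,
      S.C i b * (w (t + 0) ω b * v (t + 0) ω j) := fun i j =>
    IsInnovation.ae_growth_sum (ℱ := hin.past) (g := fun b k ω => w k ω b * v k ω j)
      (fun b => hin.innov_wv b j) 0 (a := fun b _ _ => S.C i b) le_rfl
      (fun _ _ => measurable_const) (Eventually.of_forall fun _ b => Growth.const _)
  have h3 : ∀ i j, ∀ᵐ ω ∂μ, Growth (0 + 1 / 2) fun K => ∑ t ∈ Finset.range K,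
      1 * (v (t + 0) ω i * v (t + 0) ω j - R i j) := fun i j =>
    (hin.innov_vv hR i j).ae_growth 0 le_rfl (fun _ => measurable_const)
      (Eventually.of_forall fun _ => Growth.const 1)
  filter_upwards [ae_growth_noiseState_cov hin hQ hSig h hlt,
    ae_all_iff.2 fun i => ae_all_iff.2 (h1 i), ae_all_iff.2 fun i => ae_all_iff.2 (h2 i),
    ae_all_iff.2 fun i => ae_all_iff.2 (h3 i)] with ω h0 h1 h2 h3
  set x := S.prior (xi ω) 0 (fun k => w k ω) with hx
  -- cross terms: the sensor noise is independent of the past state and of the process noise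
  have hcross : ∀ i j, Growth (1 / 2) fun K => ∑ t ∈ Finset.range K,
      (S.C *ᵥ x (t + 1)) i * v t ω j := by
    intro i j
    refine (((h1 i j).add (h2 i j)).mono (by norm_num)).congr' (Eventually.of_forall fun K => ?_)
    simp only [← Finset.sum_add_distrib]
    refine Finset.sum_congr rfl fun t _ => ?_
    rw [hx, LinSys.prior_zero_succ, Matrix.mulVec_add, Pi.add_apply, add_mul, add_zero,
      mulVec.eq_def S.C (w t ω), dotProduct, Finset.sum_mul]
    simp only [mul_assoc]
  have hstate : MGrowth (1 / 2) fun K => ∑ t ∈ Finset.range K,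
      (vecMulVec (x (t + 1)) (x (t + 1)) - Sig) := by
    have h4 : MGrowth (1 / 2) fun _ : ℕ => vecMulVec (x 0) (x 0) - Sig :=
      (MGrowth.const _).mono (by norm_num)
    intro i j
    refine (((h0 i j).shift 1).sub (h4 i j)).congr' (Eventually.of_forall fun K => ?_)
    simp only
    rw [Finset.sum_range_succ', Matrix.add_apply, add_sub_cancel_right]
  intro a b
  have := ((((MGrowth.const S.C).mul_left_bdd hstate).mul_right_bdd
    (MGrowth.const (S.C)ᵀ) a b).add ((hcross a b).add (hcross b a))).add
      ((h3 a b).mono (d := 1 / 2) (by norm_num))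
  refine this.congr' (Eventually.of_forall fun K => ?_)
  simp only [Matrix.mul_sum, Matrix.sum_mul, Matrix.sum_apply, ← Finset.sum_add_distrib]
  refine Finset.sum_congr rfl fun t _ => ?_
  have hs : S.state (xi ω) 0 (fun k => w k ω) t = x (t + 1) := rfl
  rw [hs, Matrix.mul_sub, Matrix.sub_mul, Matrix.mul_vecMulVec, Matrix.vecMulVec_mul,
    Matrix.vecMul_transpose]
  simp only [Matrix.add_apply, Matrix.sub_apply, vecMulVec_apply, Pi.add_apply, add_zero]
  ring

end NoisePart

/-! ### The closed loop -/

section ClosedLoop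

variable {Ω : Type*} [MeasurableSpace Ω] {μ : Measure Ω} {n m p : ℕ} {S : LinSys n m p}
  {X : Matrix (Fin m ⊕ Fin p) (Fin m ⊕ Fin p) ℝ} {δ β : ℝ}
  {Sig Q : Matrix (Fin n) (Fin n) ℝ} {R : Matrix (Fin m) (Fin m) ℝ}
  {xi : Ω → Fin n → ℝ} {w : ℕ → Ω → Fin n → ℝ} {v : ℕ → Ω → Fin m → ℝ} {ζ : ℕ → Ω → Fin p → ℝ}
  {lam : ℕ → Ω → Fin (numEigenvalues S.A) → ℂ} {Ust : ℕ → Ω → Matrix (Fin p) (Fin p) ℝ}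
  {φ : ℕ → Ω → Fin p → ℝ} {y : ℕ → Ω → Fin m → ℝ}

omit [MeasurableSpace Ω] in
/-- The watermark of a run is an excitation: the term `δ (k + 1) ^ (-β) I` of the applied covariance
bounds its inverse, and the constraint bounds the covariance itself. -/
theorem isExcitation_of_isRun (hδ : 0 < δ) (hβ : 0 < β) (hX : X.PosDef)
    (hmeas : ∀ k i j, Measurable[pastSigma xi w v ζ k] fun ω => Ust k ω i j)
    (hrun : ∀ ω, IsRun S X δ β (xi ω) (fun k => w k ω) (fun k => v k ω) (fun k => ζ k ω)
      (fun k => lam k ω) (fun k => Ust k ω) (fun k => φ k ω) (fun k => y k ω)) :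
    IsExcitation xi w v ζ (β / 2) (fun k ω => CFC.sqrt (appliedCov δ β (fun k => Ust k ω) k))
      (fun k ω => (appliedCov δ β (fun k => Ust k ω) k)⁻¹
        * CFC.sqrt (appliedCov δ β (fun k => Ust k ω) k)) := by
  have he : ∀ k : ℕ, 0 < δ * ((k : ℝ) + 1) ^ (-β) := fun k => by positivity
  have hV : ∀ k ω, (Ust k ω).PosSemidef := fun k ω => ((hrun ω).argmax k).1.1
  have hfac := fun k ω => sqrt_factors (hV k ω) (he k)
  have hUm : ∀ k i j, Measurable[pastSigma xi w v ζ k]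
      fun ω => appliedCov δ β (fun k => Ust k ω) k i j := fun k i j =>
    (hmeas k i j).add_const _
  have hLm : ∀ k i j, Measurable[pastSigma xi w v ζ k]
      fun ω => CFC.sqrt (appliedCov δ β (fun k => Ust k ω) k) i j := fun k =>
    measurable_sqrt_apply (hUm k) fun ω => (hfac k ω).1.posSemidef
  obtain ⟨κ, hκ, hlow⟩ := PosDef.exists_lower_bound hX
  refine ⟨hLm, fun k => measurable_mul_apply (measurable_inv_apply (hUm k)) (hLm k),
    fun ω i j => ?_, fun ω i j => ?_, fun k ω => (hfac k ω).2.1⟩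
  · refine Growth.of_bounded (C := √(δ / κ + δ)) (Eventually.of_forall fun k => ?_)
    refine Real.abs_le_sqrt (((hfac k ω).2.2.1 i j).trans ?_)
    have h1 : ((k : ℝ) + 1) ^ (-β) ≤ 1 :=
      Real.rpow_le_one_of_one_le_of_nonpos (one_le_natCast_add_one k) (by linarith)
    exact add_le_add ((hrun ω).trace_le hκ hlow k) (mul_le_of_le_one_right hδ.le h1)
  · refine Growth.of_rpow_bound (C := √δ⁻¹) fun k => ?_
    have h0 : (0 : ℝ) ≤ (k : ℝ) + 1 := by positivity
    refine (Real.abs_le_sqrt ((hfac k ω).2.2.2 i j)).trans (le_of_eq ?_)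
    rw [mul_inv, ← Real.rpow_neg h0, neg_neg, Real.sqrt_mul (inv_nonneg.2 hδ.le),
      Real.sqrt_eq_rpow (_ ^ β), ← Real.rpow_mul h0]
    ring_nf

/-- The maximizers chosen by the algorithm converge like `k ^ (-(1 - β) / 2)`: correlation sums grow
like `k ^ (β / 2 + 1 / 2)`, where `k ^ (β / 2)` bounds the probes `U_k⁻¹ φ_k`, so this is the rate
of the estimated Markov parameters; the empirical covariance of the noise converges
faster. -/
theorem ae_growth_maximizer [IsProbabilityMeasure μ] {ev : Fin (numEigenvalues S.A) → ℂ}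
    {E : Fin (numEigenvalues S.A) → Matrix (Fin n) (Fin n) ℂ} (h : IsModal S.A ev E)
    (hlt : ∀ i, ‖ev i‖ < 1) (hobs : Observable S.A S.C) (hctr : Controllable S.A S.B)
    (hQ : Q.PosSemidef) (hR : R.PosSemidef) (hSig : Sig = S.A * Sig * (S.A)ᵀ + Q)
    {W : Matrix (Fin m) (Fin m) ℝ} (hW : W = S.C * Sig * (S.C)ᵀ + R) (hWpos : W.PosDef)
    (hX : X.PosDef) (hδ : 0 < δ) (hβ : 0 < β) (hβ1 : β < 1) {Uopt : Matrix (Fin p) (Fin p) ℝ}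
    (hlip : IsLipschitzOptimum (Pmat S.H W) (Xmat S.H X) δ Uopt)
    (hin : GaussianInputs μ Sig Q R xi w v ζ)
    (hmeas : ∀ k i j, Measurable[pastSigma xi w v ζ k] fun ω => Ust k ω i j)
    (hrun : ∀ ω, IsRun S X δ β (xi ω) (fun k => w k ω) (fun k => v k ω) (fun k => ζ k ω)
      (fun k => lam k ω) (fun k => Ust k ω) (fun k => φ k ω) (fun k => y k ω)) :
    ∀ᵐ ω ∂μ, MGrowth (-((1 - β) / 2)) fun k => Ust k ω - Uopt := by
  have hex := isExcitation_of_isRun hδ hβ hX hmeas hrun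
  have hcov := ae_growth_noiseOutput_cov hin hQ hR hSig h hlt
  rw [← hW] at hcov
  filter_upwards [hcov, hex.ae_growth_watermark hin,
    ae_all_iff.2 fun τ => hex.ae_growth_sum_output hin h hlt (by positivity) τ,
    ae_all_iff.2 fun i => (hin.moments_w i).ae_growth,
    ae_all_iff.2 fun i => (hin.moments_v i).ae_growth] with ω hcov hφ hsum hw hv
  have hr := hrun ω
  have hφe : (fun k => φ k ω)
      = fun k => CFC.sqrt (appliedCov δ β (fun k => Ust k ω) k) *ᵥ ζ k ω := hr.watermark_eq
  refine h.growth_argmax hlt hobs hctr hWpos hlip hr (by linarith) (by linarith) (fun τ => ?_)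
    (fun b => ?_) (fun a => ?_) hcov
  · have := growth_markovEst (y := fun k => y k ω) (φ := fun k => φ k ω)
      (U := appliedCov δ β fun k => Ust k ω) (H := S.H τ) (d := β / 2 + 1 / 2) τ ?_
    · rwa [show β / 2 + 1 / 2 - 1 = -((1 - β) / 2) by ring] at this
    · have hU : ∀ s, ((appliedCov δ β (fun k => Ust k ω) s)⁻¹)ᵀ
          = (appliedCov δ β (fun k => Ust k ω) s)⁻¹ := fun s => by
        have hpos : (appliedCov δ β (fun k => Ust k ω) s).PosDef :=
          (sqrt_factors (hr.argmax s).1.1 (e := δ * ((s : ℝ) + 1) ^ (-β)) (by positivity)).1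
        rw [Matrix.transpose_nonsing_inv, PosDef.transpose_eq hpos]
      have hy : ∀ k, y k ω = S.output (xi ω) (fun k => φ k ω) (fun k => w k ω)
          (fun k => v k ω) k := congrFun hr.output_eq
      rw [hφe] at hy
      refine fun i j => (hsum τ i j).congr' (Eventually.of_forall fun K => ?_)
      refine congrArg (fun M : Matrix (Fin m) (Fin p) ℝ => M i j)
        (Finset.sum_congr rfl fun s _ => ?_)
      rw [hy, congrFun hφe s, Matrix.vecMulVec_mul, ← Matrix.mulVec_transpose, hU,
        Matrix.mulVec_mulVec]
  · exact (hφ b).congr' (Eventually.of_forall fun k => (congrFun (congrFun hφe k) b).symm)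
  · refine Growth.add ?_ (hv a)
    simpa using growth_mulVec (MGrowth.const S.C)
      (h.growth_state hlt (xi := xi ω) (φ := 0) (fun _ => Growth.const 0) hw) a

theorem Growth.tendsto_div {c ε : ℝ} {f : ℕ → ℝ} (hf : Growth c f) (hε : 0 < ε) :
    Tendsto (fun k : ℕ => ((k : ℝ) ^ (c + ε))⁻¹ * f k) atTop (𝓝 0) := by
  have h1 := (Asymptotics.isBigO_refl (fun k : ℕ => ((k : ℝ) ^ (c + ε))⁻¹) atTop).mul
    (hf (ε / 2) (by linarith))
  refine h1.trans_tendsto ?_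
  have h2 : Tendsto (fun k : ℕ => (((k : ℝ) + 1) / k) ^ (c + ε)) atTop (𝓝 1) := by
    have h3 : Tendsto (fun k : ℕ => ((k : ℝ) + 1) / k) atTop (𝓝 1) := by
      have := tendsto_const_nhds (x := (1 : ℝ)).add (tendsto_inv_atTop_nhds_zero_nat (𝕜 := ℝ))
      rw [add_zero] at this
      refine this.congr' ?_
      filter_upwards [eventually_gt_atTop 0] with k hk
      have : (k : ℝ) ≠ 0 := by positivity
      field_simp
    simpa using h3.rpow_const (p := c + ε) (Or.inl one_ne_zero)
  have h4 : Tendsto (fun k : ℕ => ((k : ℝ) + 1) ^ (-(ε / 2))) atTop (𝓝 0) :=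
    (tendsto_rpow_neg_atTop (by linarith)).comp
      (tendsto_natCast_atTop_atTop.atTop_add tendsto_const_nhds)
  have h5 := h2.mul h4
  rw [mul_zero] at h5
  refine h5.congr' ?_
  filter_upwards [eventually_gt_atTop 0] with k hk
  have hk0 : (0 : ℝ) < k := by positivity
  rw [Real.div_rpow (by positivity) hk0.le, div_mul_eq_mul_div, ← Real.rpow_add (by positivity),
    div_eq_inv_mul]
  congr 2
  ring

theorem rateExponent_lt {β : ℝ} (hβ : β ≠ 1 / 3) : rateExponent β < rateExponent (1 / 3) := by
  have h1 : rateExponent (1 / 3) = 1 / 3 := by norm_num [rateExponent]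
  rw [h1, rateExponent, min_lt_iff]
  rcases lt_or_gt_of_ne hβ with h | h
  · exact Or.inr h
  · exact Or.inl (by linarith)

/-- The exploration term decays like `k ^ (-β)` and the maximizers converge like
`k ^ (-(1 - β) / 2)`; the slower of the two rates is that of the applied covariance. -/
theorem growth_appliedCov {δ β : ℝ} {V : ℕ → Matrix (Fin p) (Fin p) ℝ}
    {U : Matrix (Fin p) (Fin p) ℝ} (h : MGrowth (-((1 - β) / 2)) fun k => V k - U) :
    MGrowth (-rateExponent β) fun k => appliedCov δ β V k - U := by
  intro i j
  have h1 : Growth (-β) fun k : ℕ => (δ * ((k : ℝ) + 1) ^ (-β))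
      * (1 : Matrix (Fin p) (Fin p) ℝ) i j := by
    refine Growth.mul_const (Growth.of_rpow_bound (C := |δ|) fun k => ?_) _
    rw [abs_mul, abs_of_nonneg (Real.rpow_nonneg (by positivity) _)]
  have h2 := ((h i j).mono (d := -rateExponent β) (neg_le_neg (min_le_left _ _))).add
    (h1.mono (neg_le_neg (min_le_right _ _)))
  refine h2.congr' (Eventually.of_forall fun k => ?_)
  simp only [appliedCov, Matrix.sub_apply, Matrix.add_apply, Matrix.smul_apply, smul_eq_mul]
  ring

end ClosedLoop

end Watermark

end

theorem mainTheorem3 {n m p : ℕ} (hn : 0 < n)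
    (S : Watermark.LinSys n m p)
    (Q : Matrix (Fin n) (Fin n) ℝ) (hQ : Q.PosSemidef)
    (R : Matrix (Fin m) (Fin m) ℝ) (hR : R.PosSemidef)
    (hstab : Watermark.StrictlyStable S.A)
    (hobs : Watermark.Observable S.A S.C) (hctr : Watermark.Controllable S.A S.B)
    (hdiag : Watermark.Diagonalizable S.A)
    -- the stationary state covariance and the covariance of the noise part of the output
    (Sig : Matrix (Fin n) (Fin n) ℝ) (hSig : Sig = S.A * Sig * (S.A)ᵀ + Q)
    (W : Matrix (Fin m) (Fin m) ℝ) (hW : W = S.C * Sig * (S.C)ᵀ + R) (hWpos : W.PosDef)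
    (X : Matrix (Fin m ⊕ Fin p) (Fin m ⊕ Fin p) ℝ) (hX : X.PosDef)
    (hmax : Watermark.HasUniqueMaxEigenvalue
      ((Watermark.Xmat S.H X)⁻¹ * Watermark.Pmat S.H W))
    (δ : ℝ) (hδ : 0 < δ) :
    -- the optimal covariance is well defined
    (∃! Uopt : Matrix (Fin p) (Fin p) ℝ, S.IsOptimalCov W X δ Uopt) ∧
    -- almost sure convergence of the applied covariance along every run of the algorithm
    (∀ Uopt : Matrix (Fin p) (Fin p) ℝ, S.IsOptimalCov W X δ Uopt →
      ∀ (β : ℝ), 0 < β → β < 1 →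
      ∀ {Ω : Type*} [MeasurableSpace Ω] (μ : Measure Ω) [IsProbabilityMeasure μ]
        (xi : Ω → Fin n → ℝ) (w : ℕ → Ω → Fin n → ℝ) (v : ℕ → Ω → Fin m → ℝ)
        (ζ : ℕ → Ω → Fin p → ℝ),
        Watermark.GaussianInputs μ Sig Q R xi w v ζ →
      ∀ (lam : ℕ → Ω → Fin (Watermark.numEigenvalues S.A) → ℂ)
        (Ust : ℕ → Ω → Matrix (Fin p) (Fin p) ℝ)
        (φ : ℕ → Ω → Fin p → ℝ) (y : ℕ → Ω → Fin m → ℝ),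
        -- the maximizers are chosen on the basis of the past
        (∀ k i j, Measurable[Watermark.pastSigma xi w v ζ k] fun ω => Ust k ω i j) →
        (∀ ω, Watermark.IsRun S X δ β (xi ω) (fun k => w k ω) (fun k => v k ω) (fun k => ζ k ω)
          (fun k => lam k ω) (fun k => Ust k ω) (fun k => φ k ω) (fun k => y k ω)) →
      ∀ ε : ℝ, 0 < ε → ∀ᵐ ω ∂μ,
        Tendsto (fun k : ℕ => ((k : ℝ) ^ (-Watermark.rateExponent β + ε))⁻¹ •
          (Watermark.appliedCov δ β (fun k => Ust k ω) k - Uopt)) atTop (𝓝 0)) ∧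
    -- the exponent is largest exactly at `β = 1/3`
    (∀ β : ℝ, 0 < β → β < 1 → β ≠ 1 / 3 →
      Watermark.rateExponent β < Watermark.rateExponent (1 / 3)) := by
  obtain ⟨ev, E, h⟩ := Watermark.exists_isModal hdiag
  have hlt : ∀ i, ‖ev i‖ < 1 := fun i => hstab _ (h.mem_spectrum i)
  obtain ⟨U, hU, hlip⟩ := h.exists_optimum hn hlt hobs hctr hWpos hX hmax hδ
  have hiff := Watermark.isOptimalCov_iff (h.hasCorr hlt) W X δ
  refine ⟨⟨U, (hiff U).2 hU, fun V hV => hlip.eq ((hiff V).1 hV)⟩, ?_,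
    fun β _ _ hβ => Watermark.rateExponent_lt hβ⟩
  intro Uopt hopt β hβ hβ1 Ω _ μ _ xi w v ζ hin lam Ust φ y hmeas hrun ε hε
  obtain rfl : Uopt = U := hlip.eq ((hiff Uopt).1 hopt)
  filter_upwards [Watermark.ae_growth_maximizer h hlt hobs hctr hQ hR hSig hW hWpos hX hδ hβ hβ1
    hlip hin hmeas hrun] with ω hω
  exact tendsto_pi_nhds.2 fun i => tendsto_pi_nhds.2 fun j =>
    (Watermark.growth_appliedCov hω i j).tendsto_div hε
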